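/- All graphs are finite and simple. Let $kP_3$ denote the disjoint union of $k$ paths on three vertices; a graph is $kP_3$-free if no induced subgraph of it is isomorphic to $kP_3$. For $r \ge 1$, an $r$-list assignment of $G$ is a map $L\colon V(G)\to 2^{\{1,\dots,r\}}$; a coloring $\phi$ of an induced subgraph $G[F]$ (adjacent vertices receive distinct colors) respects $L$ if $\phi(v)\in L(v)$ for all $v \in F$. In Max-Weight List $r$-Colorable Induced Subgraph the input is a graph $G$ with weights $w\colon V(G)\to\mathbb{Q}_{\ge 0}$ and an $r$-list assignment $L$ of $G$, and the task is to find $F\subseteq V(G)$ such that $G[F]$ admits a coloring that respects $L$ and $w(F)=\sum_{v\in F}w(v)$ is maximum among all such sets. Running times refer to a random access machine on natural numbers and rational numbers whose only arithmetic operations are addition and subtraction (truncated at $0$ for natural numbers) and comparison. The time of a run is its number of elementary operations; its bit cost charges every operation also for the binary length of the number it produces. The graph and the lists are given by $0/1$-matrices, and $\|w\|$ denotes the total binary length of the weights. Theorem. There is an absolute constant $C$ such that the following hold. 1. For all integers $r, k\ge 1$ there is an algorithm (depending on $r$ and $k$ only) that solves Max-Weight List $r$-Colorable Induced Subgraph on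 every $kP_3$-free graph $G$ in time at most $(|V(G)|+2)^{Crk}$, that is, $|V(G)|^{O(rk)}$, and with bit cost at most $(|V(G)|+\|w\|+2)^{Crk}$. In particular, for fixed $r$ and $k$ the problem is solvable in polynomial time on $kP_3$-free graphs. 2. For every $k\ge 1$ there is an algorithm that, given a $kP_3$-free graph $G$ with weights $w\colon V(G)\to\mathbb{Q}_{\ge 0}$, finds a minimum-weight set of vertices intersecting every odd cycle of $G$ (Odd Cycle Transversal) in time at most $(|V(G)|+2)^{Ck}$ and with bit cost at most $(|V(G)|+\|w\|+2)^{Ck}$. 3. For all $r,k\ge 1$ there is an algorithm that, given a $kP_3$-free graph $G$ and an $r$-list assignment $L$ of $G$, decides whether $G$ has a coloring that respects $L$ (List $r$-Coloring) in time and with bit cost at most $(|V(G)|+2)^{Crk}$. -/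

import Mathlib

open Finset

/-! ## Graphs, lists and weights -/

/-- `kP₃`: the disjoint union of `k` copies of the path on three vertices. -/
def kP3 (k : ℕ) : SimpleGraph (Fin k × Fin 3) where
  Adj x y := x.1 = y.1 ∧ (SimpleGraph.pathGraph 3).Adj x.2 y.2
  symm := ⟨fun _ _ h => ⟨h.1.symm, h.2.symm⟩⟩
  loopless := ⟨fun x h => (SimpleGraph.pathGraph 3).loopless.irrefl x.2 h.2⟩

/-- `G` is `kP₃`-free: no induced subgraph of `G` is isomorphic to `kP₃`. -/
def IsKP3Free {V : Type*} (k : ℕ) (G : SimpleGraph V) : Prop :=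
  ¬ (kP3 k).IsIndContained G

/-- `G` has a proper coloring that respects the lists `L`. -/
def ListColorable {V : Type*} {r : ℕ} (G : SimpleGraph V) (L : V → Finset (Fin r)) : Prop :=
  ∃ φ : G.Coloring (Fin r), ∀ v, φ v ∈ L v

/-- The induced subgraph `G[F]` has a proper coloring that respects the lists `L`. -/
def InducedListColorable {V : Type*} {r : ℕ} (G : SimpleGraph V) (L : V → Finset (Fin r))
    (F : Finset V) : Prop :=
  ListColorable (G.induce (F : Set V)) fun v => L v

/-- `F` is a solution of Max-Weight List `r`-Colorable Induced Subgraph on `(G, w, L)`. -/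
def IsMaxWeightListColorable {V : Type*} {r : ℕ} (G : SimpleGraph V) (w : V → ℚ≥0)
    (L : V → Finset (Fin r)) (F : Finset V) : Prop :=
  InducedListColorable G L F ∧
    ∀ F' : Finset V, InducedListColorable G L F' → ∑ v ∈ F', w v ≤ ∑ v ∈ F, w v

/-- `X` intersects every odd cycle of `G`. -/
def IsOddCycleTransversal {V : Type*} (G : SimpleGraph V) (X : Finset V) : Prop :=
  ∀ (v : V) (p : G.Walk v v), p.IsCycle → Odd p.length → ∃ x ∈ X, x ∈ p.support

/-- `X` is a solution of (weighted) Odd Cycle Transversal on `(G, w)`. -/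
def IsMinWeightOddCycleTransversal {V : Type*} (G : SimpleGraph V) (w : V → ℚ≥0)
    (X : Finset V) : Prop :=
  IsOddCycleTransversal G X ∧
    ∀ X' : Finset V, IsOddCycleTransversal G X' → ∑ v ∈ X, w v ≤ ∑ v ∈ X', w v

/-! ## Machine model

A random access machine with arrays of natural numbers and arrays of rational numbers, running
structured programs. The only arithmetic is addition and subtraction (no multiplication, division
or rounding). Two costs of a run are counted: the number of elementary operations, and the bit
cost, in which an operation is charged for the binary length of the number that it produces. -/

/-- A memory: `s.nat A i` and `s.rat A i` are the entries `i` of the `A`-th array of natural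
numbers and of the `A`-th array of rational numbers. -/
structure Mem where
  nat : ℕ → ℕ → ℕ
  rat : ℕ → ℕ → ℚ

/-- Write `x` to entry `i` of the natural-number array `A`. -/
def Mem.setNat (s : Mem) (A i x : ℕ) : Mem :=
  { s with nat := Function.update s.nat A (Function.update (s.nat A) i x) }

/-- Write `q` to entry `i` of the rational array `A`. -/
def Mem.setRat (s : Mem) (A i : ℕ) (q : ℚ) : Mem :=
  { s with rat := Function.update s.rat A (Function.update (s.rat A) i q) }

/-- Binary length of a rational number: sign, numerator and denominator. -/
def ratSize (q : ℚ) : ℕ := 1 + Nat.size q.num.natAbs + Nat.size q.den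

/-- Expressions with natural-number values. Array names are fixed in the program; the index of an
entry may be computed. Subtraction is truncated. -/
inductive NatExp where
  | const (c : ℕ)
  | get (A : ℕ) (i : NatExp)
  | add (e f : NatExp)
  | sub (e f : NatExp)

namespace NatExp

/-- The value of an expression. -/
def eval (s : Mem) : NatExp → ℕ
  | const c => c
  | get A i => s.nat A (i.eval s)
  | add e f => e.eval s + f.eval s
  | sub e f => e.eval s - f.eval s

/-- The number of elementary operations in an evaluation. -/
def steps : NatExp → ℕ
  | const _ => 1
  | get _ i => 1 + i.steps
  | add e f => 1 + e.steps + f.steps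
  | sub e f => 1 + e.steps + f.steps

/-- The bit cost of an evaluation. -/
def bits (s : Mem) : NatExp → ℕ
  | const c => 1 + Nat.size c
  | get A i => 1 + Nat.size ((get A i).eval s) + i.bits s
  | add e f => 1 + Nat.size ((add e f).eval s) + e.bits s + f.bits s
  | sub e f => 1 + Nat.size ((sub e f).eval s) + e.bits s + f.bits s

end NatExp

/-- Expressions with rational values. -/
inductive RatExp where
  | const (c : ℚ)
  | get (A : ℕ) (i : NatExp)
  | add (e f : RatExp)
  | sub (e f : RatExp)

namespace RatExp

/-- The value of an expression. -/
def eval (s : Mem) : RatExp → ℚ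
  | const c => c
  | get A i => s.rat A (i.eval s)
  | add e f => e.eval s + f.eval s
  | sub e f => e.eval s - f.eval s

/-- The number of elementary operations in an evaluation. -/
def steps : RatExp → ℕ
  | const _ => 1
  | get _ i => 1 + i.steps
  | add e f => 1 + e.steps + f.steps
  | sub e f => 1 + e.steps + f.steps

/-- The bit cost of an evaluation. -/
def bits (s : Mem) : RatExp → ℕ
  | const c => 1 + ratSize c
  | get A i => 1 + ratSize ((get A i).eval s) + i.bits s
  | add e f => 1 + ratSize ((add e f).eval s) + e.bits s + f.bits s
  | sub e f => 1 + ratSize ((sub e f).eval s) + e.bits s + f.bits s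

end RatExp

/-- Tests. -/
inductive Test where
  | natLE (e f : NatExp)
  | ratLE (e f : RatExp)
  | neg (b : Test)
  | conj (b c : Test)

namespace Test

/-- The truth of a test. -/
def holds (s : Mem) : Test → Prop
  | natLE e f => e.eval s ≤ f.eval s
  | ratLE e f => e.eval s ≤ f.eval s
  | neg b => ¬ b.holds s
  | conj b c => b.holds s ∧ c.holds s

/-- The number of elementary operations in a test. -/
def steps : Test → ℕ
  | natLE e f => 1 + e.steps + f.steps
  | ratLE e f => 1 + e.steps + f.steps
  | neg b => 1 + b.steps
  | conj b c => 1 + b.steps + c.steps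

/-- The bit cost of a test. -/
def bits (s : Mem) : Test → ℕ
  | natLE e f => 1 + e.bits s + f.bits s
  | ratLE e f => 1 + e.bits s + f.bits s
  | neg b => 1 + b.bits s
  | conj b c => 1 + b.bits s + c.bits s

end Test

/-- Programs. -/
inductive Prog where
  | skip
  | setNat (A : ℕ) (i e : NatExp)
  | setRat (A : ℕ) (i : NatExp) (e : RatExp)
  | seq (p q : Prog)
  | cond (b : Test) (p q : Prog)
  | loop (b : Test) (p : Prog)

/-- `Exec p s s' t c`: the program `p`, started in memory `s`, halts in memory `s'` after exactly
`t` elementary operations of total bit cost `c`. -/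
inductive Exec : Prog → Mem → Mem → ℕ → ℕ → Prop
  | skip (s : Mem) : Exec .skip s s 1 1
  | setNat (s : Mem) (A : ℕ) (i e : NatExp) :
      Exec (.setNat A i e) s (s.setNat A (i.eval s) (e.eval s))
        (1 + i.steps + e.steps) (1 + i.bits s + e.bits s)
  | setRat (s : Mem) (A : ℕ) (i : NatExp) (e : RatExp) :
      Exec (.setRat A i e) s (s.setRat A (i.eval s) (e.eval s))
        (1 + i.steps + e.steps) (1 + i.bits s + e.bits s)
  | seq {p q : Prog} {s s₁ s₂ : Mem} {t₁ t₂ c₁ c₂ : ℕ} :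
      Exec p s s₁ t₁ c₁ → Exec q s₁ s₂ t₂ c₂ → Exec (.seq p q) s s₂ (t₁ + t₂) (c₁ + c₂)
  | condTrue {b : Test} {p q : Prog} {s s₁ : Mem} {t c : ℕ} :
      b.holds s → Exec p s s₁ t c → Exec (.cond b p q) s s₁ (1 + b.steps + t) (1 + b.bits s + c)
  | condFalse {b : Test} {p q : Prog} {s s₁ : Mem} {t c : ℕ} :
      ¬ b.holds s → Exec q s s₁ t c → Exec (.cond b p q) s s₁ (1 + b.steps + t) (1 + b.bits s + c)
  | loopDone {b : Test} {p : Prog} {s : Mem} :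
      ¬ b.holds s → Exec (.loop b p) s s (1 + b.steps) (1 + b.bits s)
  | loopStep {b : Test} {p : Prog} {s s₁ s₂ : Mem} {t₁ t₂ c₁ c₂ : ℕ} :
      b.holds s → Exec p s s₁ t₁ c₁ → Exec (.loop b p) s₁ s₂ t₂ c₂ →
      Exec (.loop b p) s s₂ (1 + b.steps + t₁ + t₂) (1 + b.bits s + c₁ + c₂)

/-- `p`, started in `s`, halts in `s'` after at most `T` elementary operations, of total bit cost
at most `B`. -/
def HaltsWithin (p : Prog) (s s' : Mem) (T B : ℕ) : Prop :=
  ∃ t c : ℕ, Exec p s s' t c ∧ t ≤ T ∧ c ≤ B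

/-! ## Input and output -/

open Classical in
/-- The initial memory for a graph `G` with vertices `0, …, n - 1`, weights `w` and lists `L`.
Natural-number arrays: array `0` holds `n` in entry `0`, array `1` holds the adjacency matrix of
`G` row by row, array `2` holds the `n × r` incidence matrix of the lists row by row. Rational
array `0` holds the weights. All other entries are `0`. -/
noncomputable def inputMem {n r : ℕ} (G : SimpleGraph (Fin n)) (w : Fin n → ℚ≥0)
    (L : Fin n → Finset (Fin r)) : Mem where
  nat A a :=
    if A = 0 ∧ a = 0 then n
    else if A = 1 ∧ ∃ u v : Fin n, a = u * n + v ∧ G.Adj u v then 1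
    else if A = 2 ∧ ∃ (v : Fin n) (c : Fin r), a = v * r + c ∧ c ∈ L v then 1
    else 0
  rat A a := if h : A = 0 ∧ a < n then (w ⟨a, h.2⟩ : ℚ) else 0

/-- The output vertex set: the vertices `v` with a nonzero entry `v` in natural-number array `3`. -/
def outputSet (n : ℕ) (s : Mem) : Finset (Fin n) :=
  univ.filter fun v => s.nat 3 v ≠ 0

/-- The output of a decision problem: entry `0` of natural-number array `3` is nonzero. -/
def Accepts (s : Mem) : Prop := s.nat 3 0 ≠ 0

/-- The number of vertices plus the total binary length of the weights. -/
def inputSize {n : ℕ} (w : Fin n → ℚ≥0) : ℕ := n + ∑ v, ratSize (w v)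

/-! Every color class of a solution is independent. The unknown classes are replaced by a polynomial
number of candidate clusters (disjoint unions of cliques); inside fixed clusters the problem is a
weighted bipartite matching.

Clusters (`exists_certificate`). Suppose that `U` has no packing of `m + 1` induced paths on three
vertices, and let `I ⊆ U` be independent. If `m = 0`, then `U` itself is a cluster. Otherwise, start
from a seed, run through the vertices and add each one that keeps the set a cluster. Let `i` be the
first vertex of `I` that is rejected. Then `i` and two vertices `x`, `y` of the current cluster `D`
form an induced path. Outside the closed neighborhoods of `i`, `x`, `y` there is no packing of `m`
paths, so the members of `I` there lie in a cluster obtained by induction. The earlier members of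
`I` are in the cluster `D`, where the closed neighborhood of `x` is a clique; so at most one of
them, `a`, meets it, and likewise at most one, `b`, for `y`. Turning `i`, `a`, `b` into isolated
vertices of the inductive cluster gives a new seed that contains all of `I` up to `i`, and the sweep
can continue beyond `i`. A later failure replaces the seed by another one that does not depend on
the old seed, so only the last failure is recorded: five vertices per level, hence `5 * m` vertices
in all. With `m = k - 1` there are `n ^ (5 * (k - 1) * r)` choices of certificates for `r` colors.

Matching. For fixed clusters, a coloring assigns distinct (color, clique) pairs to the colored
vertices. The sets that can be colored form a transversal matroid, so the greedy algorithm by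
decreasing weight is optimal. An augmenting path search decides whether the next vertex can be
colored. When it fails, the vertices found form a tight set, a Hall obstruction, which bounds the
number of processed vertices in any colorable set (`card_inter_le`); the inequality `opt` of
`IsGreedyState` converts these counts into weights.

Costs. The algorithm is a nest of counting loops, with one loop per certificate digit, so its time
is at most a constant times `(n + 2)` to the nesting depth (`LoopProg.exec_compile`). Since only
addition and subtraction are available, a step lengthens numbers by at most about one bit, and the
rationals keep the common denominator of the input weights (`Exec.bits_le`). Odd Cycle Transversal
is the complement of the case of two colors with full lists. List coloring asks whether, for unit
weights, the optimum is the whole vertex set. -/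

/-! ## A total language with counting loops -/

namespace Mem

@[simp] theorem nat_setNat_same (s : Mem) (A i x j : ℕ) :
    (s.setNat A i x).nat A j = if j = i then x else s.nat A j := by
  simp [setNat, Function.update_apply]

theorem nat_setNat_of_ne (s : Mem) {A A' : ℕ} (i x : ℕ) (h : A' ≠ A) :
    (s.setNat A i x).nat A' = s.nat A' := by
  simp [setNat, Function.update_of_ne h]

@[simp] theorem rat_setNat (s : Mem) (A i x : ℕ) : (s.setNat A i x).rat = s.rat := rfl

@[simp] theorem rat_setRat_same (s : Mem) (A i : ℕ) (q : ℚ) (j : ℕ) :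
    (s.setRat A i q).rat A j = if j = i then q else s.rat A j := by
  simp [setRat, Function.update_apply]

theorem rat_setRat_of_ne (s : Mem) {A A' : ℕ} (i : ℕ) (q : ℚ) (h : A' ≠ A) :
    (s.setRat A i q).rat A' = s.rat A' := by
  simp [setRat, Function.update_of_ne h]

end Mem

/-- Programs whose only loops are counting loops `for x = 0, …, n - 1`, where `n` is entry `0` of
array `0` and the counter is entry `0` of array `x`. -/
inductive LoopProg where
  | skip
  | setNat (A : ℕ) (i e : NatExp)
  | setRat (A : ℕ) (i : NatExp) (e : RatExp)
  | seq (p q : LoopProg)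
  | cond (b : Test) (p q : LoopProg)
  | count (x : ℕ) (p : LoopProg)

/-- Entry `0` of array `A`. -/
abbrev NatExp.reg (A : ℕ) : NatExp := .get A (.const 0)

namespace LoopProg

/-- The translation into general programs. -/
def compile : LoopProg → Prog
  | skip => .skip
  | setNat A i e => .setNat A i e
  | setRat A i e => .setRat A i e
  | seq p q => .seq p.compile q.compile
  | cond b p q => .cond b p.compile q.compile
  | .count x p => .seq (.setNat x (.const 0) (.const 0))
      (.loop (.neg (.natLE (.reg 0) (.reg x)))
        (.seq p.compile (.setNat x (.const 0) (.add (.reg x) (.const 1)))))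

/-- The memory after `i` rounds of a counting loop with body `f` and counter `x`. -/
def iter (x : ℕ) (f : Mem → Mem) (s : Mem) : ℕ → Mem
  | 0 => s.setNat x 0 0
  | i + 1 => (f (iter x f s i)).setNat x 0 (i + 1)

open Classical in
/-- The final memory of a run. -/
noncomputable def run : LoopProg → Mem → Mem
  | skip, s => s
  | setNat A i e, s => s.setNat A (i.eval s) (e.eval s)
  | setRat A i e, s => s.setRat A (i.eval s) (e.eval s)
  | seq p q, s => q.run (p.run s)
  | cond b p q, s => if b.holds s then p.run s else q.run s
  | .count x p, s => iter x p.run s (s.nat 0 0)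

/-- The natural-number arrays that a program may change. -/
def natWrites : LoopProg → Finset ℕ
  | skip => ∅
  | setNat A _ _ => {A}
  | setRat _ _ _ => ∅
  | seq p q => p.natWrites ∪ q.natWrites
  | cond _ p q => p.natWrites ∪ q.natWrites
  | .count x p => insert x p.natWrites

/-- The rational arrays that a program may change. -/
def ratWrites : LoopProg → Finset ℕ
  | skip => ∅
  | setNat _ _ _ => ∅
  | setRat A _ _ => {A}
  | seq p q => p.ratWrites ∪ q.ratWrites
  | cond _ p q => p.ratWrites ∪ q.ratWrites
  | .count _ p => p.ratWrites

/-- No loop body changes the counter of its loop, and the loop bound is never changed. -/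
def WF : LoopProg → Prop
  | skip => True
  | setNat A _ _ => A ≠ 0
  | setRat _ _ _ => True
  | seq p q => p.WF ∧ q.WF
  | cond _ p q => p.WF ∧ q.WF
  | .count x p => x ≠ 0 ∧ x ∉ p.natWrites ∧ p.WF

/-- The nesting depth of the loops. -/
def depth : LoopProg → ℕ
  | skip => 0
  | setNat _ _ _ => 0
  | setRat _ _ _ => 0
  | seq p q => max p.depth q.depth
  | cond _ p q => max p.depth q.depth
  | .count _ p => p.depth + 1

/-- The number of elementary operations when every operation is performed once. -/
def weight : LoopProg → ℕ
  | skip => 1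
  | setNat _ i e => 1 + i.steps + e.steps
  | setRat _ i e => 1 + i.steps + e.steps
  | seq p q => p.weight + q.weight
  | cond b p q => 1 + b.steps + p.weight + q.weight
  | .count _ p => p.weight + 16

/-! ### Frame rules, loop invariants and running time of counting programs -/

theorem WF.zero_notMem {p : LoopProg} (h : p.WF) : 0 ∉ p.natWrites := by
  induction p with
  | skip => simp [natWrites]
  | setNat A i e => simpa [natWrites] using (h : A ≠ 0).symm
  | setRat A i e => simp [natWrites]
  | seq p q hp hq => simpa [natWrites] using ⟨hp h.1, hq h.2⟩
  | cond b p q hp hq => simpa [natWrites] using ⟨hp h.1, hq h.2⟩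
  | count x p hp => simpa [natWrites] using ⟨h.1.symm, hp h.2.2⟩

/-- The frame rule. Correctness proofs use it to carry data across subprograms that do not write to
the arrays holding them. -/
theorem nat_run {p : LoopProg} {A : ℕ} (hA : A ∉ p.natWrites) (s : Mem) :
    (p.run s).nat A = s.nat A := by
  induction p generalizing s with
  | skip => rfl
  | setNat B i e => exact Mem.nat_setNat_of_ne _ _ _ (by simpa [natWrites] using hA)
  | setRat B i e => rfl
  | seq p q hp hq =>
    simp only [natWrites, mem_union, not_or] at hA
    rw [run, hq hA.2, hp hA.1]
  | cond b p q hp hq =>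
    simp only [natWrites, mem_union, not_or] at hA
    rw [run]
    split_ifs
    exacts [hp hA.1 s, hq hA.2 s]
  | count x p hp =>
    simp only [natWrites, mem_insert, not_or] at hA
    have h : ∀ i, (iter x p.run s i).nat A = s.nat A := by
      intro i
      induction i with
      | zero => exact Mem.nat_setNat_of_ne _ _ _ hA.1
      | succ i ih => rw [iter, Mem.nat_setNat_of_ne _ _ _ hA.1, hp hA.2, ih]
    exact h _

theorem rat_run {p : LoopProg} {A : ℕ} (hA : A ∉ p.ratWrites) (s : Mem) :
    (p.run s).rat A = s.rat A := by
  induction p generalizing s with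
  | skip => rfl
  | setNat B i e => rfl
  | setRat B i e => exact Mem.rat_setRat_of_ne _ _ _ (by simpa [ratWrites] using hA)
  | seq p q hp hq =>
    simp only [ratWrites, mem_union, not_or] at hA
    rw [run, hq hA.2, hp hA.1]
  | cond b p q hp hq =>
    simp only [ratWrites, mem_union, not_or] at hA
    rw [run]
    split_ifs
    exacts [hp hA.1 s, hq hA.2 s]
  | count x p hp =>
    simp only [ratWrites] at hA
    have h : ∀ i, (iter x p.run s i).rat A = s.rat A := by
      intro i
      induction i with
      | zero => rfl
      | succ i ih => rw [iter, Mem.rat_setNat, hp hA, ih]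
    exact h _

theorem run_seq (p q : LoopProg) (s : Mem) : (seq p q).run s = q.run (p.run s) := rfl

theorem run_setNat (A : ℕ) (i e : NatExp) (s : Mem) :
    (setNat A i e).run s = s.setNat A (i.eval s) (e.eval s) := rfl

theorem run_setRat (A : ℕ) (i : NatExp) (e : RatExp) (s : Mem) :
    (setRat A i e).run s = s.setRat A (i.eval s) (e.eval s) := rfl

theorem run_skip (s : Mem) : skip.run s = s := rfl

theorem run_cond_pos {b : Test} {s : Mem} (h : b.holds s) (p q : LoopProg) :
    (cond b p q).run s = p.run s := if_pos h

theorem run_cond_neg {b : Test} {s : Mem} (h : ¬ b.holds s) (p q : LoopProg) :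
    (cond b p q).run s = q.run s := if_neg h

/-- Reasoning about a counting loop by a loop invariant. -/
theorem run_for {x : ℕ} {p : LoopProg} {n : ℕ} {s : Mem}
    (hn : s.nat 0 0 = n) (Inv : ℕ → Mem → Prop) (h0 : Inv 0 (s.setNat x 0 0))
    (hs : ∀ i < n, ∀ u : Mem, u.nat x 0 = i → (∀ A ∉ insert x p.natWrites, u.nat A = s.nat A) →
      (∀ A ∉ p.ratWrites, u.rat A = s.rat A) → Inv i u →
      Inv (i + 1) ((p.run u).setNat x 0 (i + 1))) :
    Inv n ((LoopProg.count x p).run s) := by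
  have h : ∀ i ≤ n, Inv i (iter x p.run s i) ∧ (iter x p.run s i).nat x 0 = i ∧
      (∀ A ∉ insert x p.natWrites, (iter x p.run s i).nat A = s.nat A) ∧
      (∀ A ∉ p.ratWrites, (iter x p.run s i).rat A = s.rat A) := by
    intro i
    induction i with
    | zero =>
      refine fun _ => ⟨h0, by simp [iter], fun A hA => ?_, fun A _ => rfl⟩
      exact Mem.nat_setNat_of_ne _ _ _ (by simp only [mem_insert, not_or] at hA; exact hA.1)
    | succ i ih =>
      intro hi
      obtain ⟨h1, h2, h3, h4⟩ := ih (by omega)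
      refine ⟨hs i (by omega) _ h2 h3 h4 h1, by simp [iter], fun A hA => ?_, fun A hA => ?_⟩
      · have hA' := hA
        simp only [mem_insert, not_or] at hA'
        rw [iter, Mem.nat_setNat_of_ne _ _ _ hA'.1, nat_run hA'.2, h3 A hA]
      · rw [iter, Mem.rat_setNat, rat_run hA, h4 A hA]
  rw [run, hn]
  exact (h n le_rfl).1

/-- The compiled program has the same effect, within the static time bound. -/
theorem exec_compile {p : LoopProg} (hwf : p.WF) (s : Mem) :
    ∃ t c, Exec p.compile s (p.run s) t c ∧ t ≤ p.weight * (s.nat 0 0 + 2) ^ p.depth := by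
  induction p generalizing s with
  | skip => exact ⟨1, 1, .skip s, by simp [weight, depth]⟩
  | setNat A i e => exact ⟨_, _, .setNat s A i e, by simp [weight, depth]⟩
  | setRat A i e => exact ⟨_, _, .setRat s A i e, by simp [weight, depth]⟩
  | seq p q hp hq =>
    obtain ⟨t, c, h, ht⟩ := hp hwf.1 s
    obtain ⟨t', c', h', ht'⟩ := hq hwf.2 (p.run s)
    rw [nat_run hwf.1.zero_notMem] at ht'
    refine ⟨_, _, .seq h h', ?_⟩
    have h1 := Nat.pow_le_pow_right (n := s.nat 0 0 + 2) (by omega) (le_max_left p.depth q.depth)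
    have h2 := Nat.pow_le_pow_right (n := s.nat 0 0 + 2) (by omega) (le_max_right p.depth q.depth)
    simp only [weight, depth]
    nlinarith [Nat.mul_le_mul_left p.weight h1, Nat.mul_le_mul_left q.weight h2]
  | cond b p q hp hq =>
    have h1 := Nat.pow_le_pow_right (n := s.nat 0 0 + 2) (by omega) (le_max_left p.depth q.depth)
    have h2 := Nat.pow_le_pow_right (n := s.nat 0 0 + 2) (by omega) (le_max_right p.depth q.depth)
    have h3 := Nat.one_le_pow (max p.depth q.depth) (s.nat 0 0 + 2) (by omega)
    have h1' := Nat.mul_le_mul_left p.weight h1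
    have h2' := Nat.mul_le_mul_left q.weight h2
    have h3' := Nat.mul_le_mul_left (1 + b.steps) h3
    by_cases hb : b.holds s
    · obtain ⟨t, c, h, ht⟩ := hp hwf.1 s
      refine ⟨1 + b.steps + t, 1 + b.bits s + c, by
        rw [run_cond_pos hb]; exact .condTrue hb h, ?_⟩
      simp only [weight, depth, add_mul] at *
      omega
    · obtain ⟨t, c, h, ht⟩ := hq hwf.2 s
      refine ⟨1 + b.steps + t, 1 + b.bits s + c, by
        rw [run_cond_neg hb]; exact .condFalse hb h, ?_⟩
      simp only [weight, depth, add_mul] at *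
      omega
  | count x p hp =>
    obtain ⟨hx0, hxp, hpw⟩ := hwf
    set n := s.nat 0 0 with hn
    set M := p.weight * (n + 2) ^ p.depth with hM
    have hx : ∀ i, (iter x p.run s i).nat x 0 = i ∧ (iter x p.run s i).nat 0 0 = n := by
      intro i
      induction i with
      | zero => exact ⟨by simp [iter], by rw [iter, Mem.nat_setNat_of_ne _ _ _ hx0.symm]⟩
      | succ i ih =>
        exact ⟨by simp [iter], by
          rw [iter, Mem.nat_setNat_of_ne _ _ _ hx0.symm, nat_run hpw.zero_notMem, ih.2]⟩
    -- Induction on the number `j` of remaining rounds. A loop test costs 7 operations, and the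
    -- increment of the counter 6 more, so a round costs 13 besides its body.
    have key : ∀ j ≤ n, ∃ t c, Exec (.loop (.neg (.natLE (.reg 0) (.reg x)))
        (.seq p.compile (.setNat x (.const 0) (.add (.reg x) (.const 1)))))
        (iter x p.run s (n - j)) (iter x p.run s n) t c ∧ t ≤ 7 + j * (M + 13) := by
      intro j
      induction j with
      | zero =>
        refine fun _ => ⟨_, _, .loopDone ?_, ?_⟩
        · simp [Test.holds, NatExp.eval, (hx n).1, (hx n).2]
        · simp [Test.steps, NatExp.steps]
      | succ j ih =>
        intro hj
        obtain ⟨t, c, h, ht⟩ := ih (by omega)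
        obtain ⟨t', c', h', ht'⟩ := hp hpw (iter x p.run s (n - (j + 1)))
        rw [(hx _).2] at ht'
        -- The compiled loop increments the counter, whereas `iter` overwrites it; the results agree
        -- because the body leaves the counter alone.
        have hstep : iter x p.run s (n - j) = ((p.run (iter x p.run s (n - (j + 1)))).setNat x
            ((NatExp.const 0).eval (p.run (iter x p.run s (n - (j + 1)))))
            ((NatExp.add (.reg x) (.const 1)).eval (p.run (iter x p.run s (n - (j + 1)))))) := by
          have : n - j = (n - (j + 1)) + 1 := by omega
          rw [this, iter]
          simp [NatExp.eval, nat_run hxp, (hx _).1]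
        rw [hstep] at h
        refine ⟨_, _, .loopStep ?_ (.seq h' (.setNat _ _ _ _)) h, ?_⟩
        · simp only [Test.holds, NatExp.eval, (hx _).1, (hx _).2]
          omega
        · simp only [Test.steps, NatExp.steps]
          rw [add_mul]
          omega
    obtain ⟨t, c, h, ht⟩ := key n le_rfl
    rw [Nat.sub_self] at h
    refine ⟨_, _, .seq (.setNat _ _ _ _) h, ?_⟩
    simp only [weight, depth, NatExp.steps]
    have h3 := Nat.one_le_pow p.depth (n + 2) (by omega)
    calc 1 + 1 + 1 + t ≤ (16 + M) * (n + 2) := by nlinarith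
      _ ≤ (16 * (n + 2) ^ p.depth + p.weight * (n + 2) ^ p.depth) * (n + 2) := by
        gcongr
        omega
      _ = _ := by ring

end LoopProg

/-! ## Bit cost in terms of the number of operations -/

/-- All natural numbers in memory are less than `2 ^ m`, and all rational numbers are fractions with
denominator `D` and numerator of absolute value at most `2 ^ m`. -/
def Mem.SizeLE (D m : ℕ) (s : Mem) : Prop :=
  (∀ A i, s.nat A i < 2 ^ m) ∧ ∀ A i, ∃ z : ℤ, s.rat A i * D = z ∧ z.natAbs ≤ 2 ^ m

theorem Mem.SizeLE.mono {D m m' : ℕ} {s : Mem} (h : s.SizeLE D m) (hm : m ≤ m') :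
    s.SizeLE D m' := by
  have := Nat.pow_le_pow_right (n := 2) (by omega) hm
  refine ⟨fun A i => (h.1 A i).trans_le this, fun A i => ?_⟩
  obtain ⟨z, hz, hz'⟩ := h.2 A i
  exact ⟨z, hz, hz'.trans this⟩

/-- All constants are less than `2 ^ b`. -/
def NatExp.ConstLT (b : ℕ) : NatExp → Prop
  | const c => c < 2 ^ b
  | get _ i => i.ConstLT b
  | add e f => e.ConstLT b ∧ f.ConstLT b
  | sub e f => e.ConstLT b ∧ f.ConstLT b

/-- All natural-number constants are less than `2 ^ b`, all rational ones are `0` or `1`. -/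
def RatExp.ConstLT (b : ℕ) : RatExp → Prop
  | const c => c = 0 ∨ c = 1
  | get _ i => i.ConstLT b
  | add e f => e.ConstLT b ∧ f.ConstLT b
  | sub e f => e.ConstLT b ∧ f.ConstLT b

/-- All natural-number constants are less than `2 ^ b`, all rational ones are `0` or `1`. -/
def Test.ConstLT (b : ℕ) : Test → Prop
  | natLE e f => e.ConstLT b ∧ f.ConstLT b
  | ratLE e f => e.ConstLT b ∧ f.ConstLT b
  | neg c => c.ConstLT b
  | conj c d => c.ConstLT b ∧ d.ConstLT b

/-- All natural-number constants are less than `2 ^ b`, all rational ones are `0` or `1`. -/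
def Prog.ConstLT (b : ℕ) : Prog → Prop
  | skip => True
  | setNat _ i e => i.ConstLT b ∧ e.ConstLT b
  | setRat _ i e => i.ConstLT b ∧ e.ConstLT b
  | seq p q => p.ConstLT b ∧ q.ConstLT b
  | cond c p q => c.ConstLT b ∧ p.ConstLT b ∧ q.ConstLT b
  | loop c p => c.ConstLT b ∧ p.ConstLT b

theorem NatExp.steps_pos (e : NatExp) : 1 ≤ e.steps := by cases e <;> simp [steps] <;> omega

theorem RatExp.steps_pos (e : RatExp) : 1 ≤ e.steps := by cases e <;> simp [steps] <;> omega

/-- Splits the bit budget of a sum between its summands: the operation itself pays for the carry. -/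
theorem two_pow_add_le {m a b : ℕ} (ha : 1 ≤ a) (hb : 1 ≤ b) :
    2 ^ (m + a) + 2 ^ (m + b) ≤ 2 ^ (m + (1 + a + b)) := by
  have h1 := Nat.pow_le_pow_right (n := 2) (by omega) (show m + a ≤ m + (a + b) by omega)
  have h2 := Nat.pow_le_pow_right (n := 2) (by omega) (show m + b ≤ m + (a + b) by omega)
  have h3 : 2 ^ (m + (1 + a + b)) = 2 * 2 ^ (m + (a + b)) := by ring
  omega

theorem NatExp.eval_lt {D m b : ℕ} {s : Mem} (hs : s.SizeLE D m) (hb : b ≤ m) {e : NatExp}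
    (he : e.ConstLT b) : e.eval s < 2 ^ (m + e.steps) := by
  induction e with
  | const c => exact lt_of_lt_of_le he (Nat.pow_le_pow_right (by omega) (by omega))
  | get A i _ => exact lt_of_lt_of_le (hs.1 _ _) (Nat.pow_le_pow_right (by omega) (by omega))
  | add e f ihe ihf =>
    have := two_pow_add_le (m := m) e.steps_pos f.steps_pos
    have h1 := ihe he.1
    have h2 := ihf he.2
    simp only [eval, steps]
    omega
  | sub e f ihe ihf =>
    have := two_pow_add_le (m := m) e.steps_pos f.steps_pos
    have h1 := ihe he.1
    have h2 := ihf he.2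
    simp only [eval, steps]
    omega

/-- Every subexpression has a value below `2 ^ N`, so each of the steps is charged at most `1 + N`.
-/
theorem NatExp.bits_le {D m b : ℕ} {s : Mem} (hs : s.SizeLE D m) (hb : b ≤ m) {e : NatExp}
    (he : e.ConstLT b) {N : ℕ} (hN : m + e.steps ≤ N) : e.bits s ≤ e.steps * (1 + N) := by
  have hsize : Nat.size (e.eval s) ≤ N := (Nat.size_le.2 (eval_lt hs hb he)).trans hN
  induction e with
  | const c => simpa [bits, steps, eval] using hsize
  | get A i ih =>
    simp only [steps] at hN
    have := ih he (by omega) ((Nat.size_le.2 (eval_lt (e := i) hs hb he)).trans (by omega))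
    simp only [bits, steps, add_mul]
    omega
  | add e f ihe ihf =>
    simp only [steps] at hN
    have h1 := ihe he.1 (by omega) ((Nat.size_le.2 (eval_lt hs hb he.1)).trans (by omega))
    have h2 := ihf he.2 (by omega) ((Nat.size_le.2 (eval_lt hs hb he.2)).trans (by omega))
    simp only [bits, steps, add_mul]
    omega
  | sub e f ihe ihf =>
    simp only [steps] at hN
    have h1 := ihe he.1 (by omega) ((Nat.size_le.2 (eval_lt hs hb he.1)).trans (by omega))
    have h2 := ihf he.2 (by omega) ((Nat.size_le.2 (eval_lt hs hb he.2)).trans (by omega))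
    simp only [bits, steps, add_mul]
    omega

/-- Sums and differences do not leave the fractions with denominator `D`, so only the integer
numerators have to be bounded. The constant `1` has numerator `D`, which is why `D` must be bounded
too. -/
theorem RatExp.eval_bound {D m b : ℕ} {s : Mem} (hs : s.SizeLE D m) (hD : D ≤ 2 ^ m) {e : RatExp}
    (he : e.ConstLT b) : ∃ z : ℤ, e.eval s * D = z ∧ z.natAbs ≤ 2 ^ (m + e.steps) := by
  induction e with
  | const c =>
    have hle : 2 ^ m ≤ 2 ^ (m + (const c).steps) := Nat.pow_le_pow_right (by omega) (by omega)
    rcases he with rfl | rfl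
    · exact ⟨0, by simp [eval], by simp⟩
    · exact ⟨D, by simp [eval], by simpa using hD.trans hle⟩
  | get A i =>
    obtain ⟨z, hz, hz'⟩ := hs.2 A (i.eval s)
    exact ⟨z, hz, hz'.trans (Nat.pow_le_pow_right (by omega) (by omega))⟩
  | add e f ihe ihf =>
    obtain ⟨z, hz, hz'⟩ := ihe he.1
    obtain ⟨y, hy, hy'⟩ := ihf he.2
    have := two_pow_add_le (m := m) e.steps_pos f.steps_pos
    refine ⟨z + y, by push_cast; rw [eval, add_mul, hz, hy], ?_⟩
    simp only [steps]
    omega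
  | sub e f ihe ihf =>
    obtain ⟨z, hz, hz'⟩ := ihe he.1
    obtain ⟨y, hy, hy'⟩ := ihf he.2
    have := two_pow_add_le (m := m) e.steps_pos f.steps_pos
    refine ⟨z - y, by push_cast; rw [eval, sub_mul, hz, hy], ?_⟩
    simp only [steps]
    omega

/-- In lowest terms the denominator divides `D` and the numerator divides `z`, so reduction enlarges
neither. Numbers up to `2 ^ N` have at most `N + 1` bits; with the sign this gives `3 + 2 * N`. -/
theorem ratSize_le_of_mul_eq {D : ℕ} (hD0 : 0 < D) {q : ℚ} {z : ℤ} (hz : q * D = z) {N : ℕ}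
    (hDN : D ≤ 2 ^ N) (hzN : z.natAbs ≤ 2 ^ N) : ratSize q ≤ 3 + 2 * N := by
  have hmul : q.num * D = z * q.den := by
    have h : (q.num : ℚ) * D = z * q.den := by
      rw [← hz, ← Rat.mul_den_eq_num]
      ring
    exact_mod_cast h
  have hdvd : q.den ∣ D := by
    have h1 : (q.den : ℤ) ∣ q.num * D := hmul ▸ Dvd.intro_left z rfl
    have h2 : IsCoprime (q.den : ℤ) q.num :=
      (Int.isCoprime_iff_nat_coprime.2 (by simpa using q.reduced)).symm
    exact_mod_cast h2.dvd_of_dvd_mul_left h1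
  obtain ⟨t, ht⟩ := hdvd
  have hden : q.den ≤ 2 ^ N := by
    refine le_trans ?_ hDN
    exact Nat.le_of_dvd hD0 ⟨t, ht⟩
  have hnum : q.num.natAbs ≤ z.natAbs := by
    have hz2 : q.num * t = z := by
      have h0 : (q.den : ℤ) ≠ 0 := by exact_mod_cast q.den_ne_zero
      apply mul_right_cancel₀ h0
      rw [← hmul, ht]
      push_cast
      ring
    rw [← hz2, Int.natAbs_mul]
    have : t ≠ 0 := by rintro rfl; omega
    exact Nat.le_mul_of_pos_right _ (by simpa using Nat.pos_of_ne_zero this)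
  have hlt : 2 ^ N < 2 ^ (N + 1) := Nat.pow_lt_pow_right (by omega) (by omega)
  have h1 := Nat.size_le.2 ((hnum.trans hzN).trans_lt hlt)
  have h2 := Nat.size_le.2 (hden.trans_lt hlt)
  unfold ratSize
  omega

theorem RatExp.bits_le {D m b : ℕ} {s : Mem} (hs : s.SizeLE D m) (hb : b ≤ m) (hD0 : 0 < D)
    (hD : D ≤ 2 ^ m) {e : RatExp} (he : e.ConstLT b) {N : ℕ} (hN : m + e.steps ≤ N) :
    e.bits s ≤ e.steps * (4 + 2 * N) := by
  have hsize : ∀ f : RatExp, f.ConstLT b → m + f.steps ≤ N → ratSize (f.eval s) ≤ 3 + 2 * N := by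
    intro f hf hfN
    obtain ⟨z, hz, hz'⟩ := f.eval_bound hs hD hf
    exact ratSize_le_of_mul_eq hD0 hz (hD.trans (Nat.pow_le_pow_right (by omega) (by omega)))
      (hz'.trans (Nat.pow_le_pow_right (by omega) hfN))
  have hcur := hsize e he hN
  induction e with
  | const c =>
    simp only [bits, steps, eval] at *
    omega
  | get A i =>
    simp only [steps] at hN
    have := NatExp.bits_le hs hb he (N := N) (by omega)
    simp only [bits, steps, add_mul, mul_add, mul_left_comm _ 2 N] at *
    omega
  | add e f ihe ihf =>
    simp only [steps] at hN
    have h1 := ihe he.1 (by omega) (hsize _ he.1 (by omega))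
    have h2 := ihf he.2 (by omega) (hsize _ he.2 (by omega))
    simp only [bits, steps, add_mul] at *
    omega
  | sub e f ihe ihf =>
    simp only [steps] at hN
    have h1 := ihe he.1 (by omega) (hsize _ he.1 (by omega))
    have h2 := ihf he.2 (by omega) (hsize _ he.2 (by omega))
    simp only [bits, steps, add_mul] at *
    omega

theorem Test.bits_le {D m b : ℕ} {s : Mem} (hs : s.SizeLE D m) (hb : b ≤ m) (hD0 : 0 < D)
    (hD : D ≤ 2 ^ m) {e : Test} (he : e.ConstLT b) {N : ℕ} (hN : m + e.steps ≤ N) :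
    e.bits s ≤ e.steps * (4 + 2 * N) := by
  induction e with
  | natLE e f =>
    simp only [steps] at hN
    have h1 := NatExp.bits_le hs hb he.1 (N := N) (by omega)
    have h2 := NatExp.bits_le hs hb he.2 (N := N) (by omega)
    simp only [bits, steps, add_mul, mul_add] at *
    nlinarith
  | ratLE e f =>
    simp only [steps] at hN
    have h1 := RatExp.bits_le hs hb hD0 hD he.1 (N := N) (by omega)
    have h2 := RatExp.bits_le hs hb hD0 hD he.2 (N := N) (by omega)
    simp only [bits, steps, add_mul] at *
    omega
  | neg c ih =>
    simp only [steps] at hN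
    have h1 := ih he (by omega)
    simp only [bits, steps, add_mul] at *
    omega
  | conj c d ihc ihd =>
    simp only [steps] at hN
    have h1 := ihc he.1 (by omega)
    have h2 := ihd he.2 (by omega)
    simp only [bits, steps, add_mul] at *
    omega

/-- A run of `t` operations has bit cost `O(t (m + t))`, if the memory has entries of `m` bits and
the rational numbers in it have a common denominator of `m` bits. -/
theorem Exec.bits_le {p : Prog} {s s' : Mem} {t c : ℕ} (h : Exec p s s' t c) {D b m : ℕ}
    (hp : p.ConstLT b) (hb : b ≤ m) (hD0 : 0 < D) (hD : D ≤ 2 ^ m) (hs : s.SizeLE D m) {N : ℕ}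
    (hN : m + t ≤ N) : c ≤ t * (4 + 2 * N) ∧ s'.SizeLE D (m + t) := by
  have hD' : ∀ j, D ≤ 2 ^ (m + j) := fun j =>
    hD.trans (Nat.pow_le_pow_right (by omega) (by omega))
  induction h generalizing m with
  | skip s => exact ⟨by omega, hs.mono (by omega)⟩
  | setNat s A i e =>
    have h1 := NatExp.bits_le hs hb hp.1 (N := N) (by omega)
    have h2 := NatExp.bits_le hs hb hp.2 (N := N) (by omega)
    refine ⟨by simp only [add_mul, mul_add] at *; nlinarith, fun A' i' => ?_, ?_⟩
    · have h0 := (NatExp.eval_lt hs hb hp.2).trans_le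
        (Nat.pow_le_pow_right (n := 2) (by omega) (show m + e.steps ≤ m + (1 + i.steps + e.steps) by
          omega))
      by_cases hA : A' = A
      · subst hA
        rw [Mem.nat_setNat_same]
        split_ifs
        exacts [h0, (hs.mono (by omega)).1 _ _]
      · rw [Mem.nat_setNat_of_ne _ _ _ hA]
        exact (hs.mono (by omega)).1 _ _
    · exact (hs.mono (by omega)).2
  | setRat s A i e =>
    have h1 := NatExp.bits_le hs hb hp.1 (N := N) (by omega)
    have h2 := RatExp.bits_le hs hb hD0 hD hp.2 (N := N) (by omega)
    refine ⟨by simp only [add_mul, mul_add] at *; nlinarith, (hs.mono (by omega)).1,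
      fun A' i' => ?_⟩
    by_cases hA : A' = A
    · subst hA
      rw [Mem.rat_setRat_same]
      split_ifs
      · obtain ⟨z, hz, hz'⟩ := RatExp.eval_bound hs hD hp.2
        exact ⟨z, hz, hz'.trans (Nat.pow_le_pow_right (by omega) (by omega))⟩
      · exact (hs.mono (by omega)).2 _ _
    · rw [Mem.rat_setRat_of_ne _ _ _ hA]
      exact (hs.mono (by omega)).2 _ _
  | seq _ _ ih1 ih2 =>
    obtain ⟨h1, h1'⟩ := ih1 hp.1 hb hD hs (by omega) hD'
    obtain ⟨h2, h2'⟩ := ih2 hp.2 (by omega) (hD' _) h1' (by omega)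
      (fun j => by rw [add_assoc]; exact hD' _)
    exact ⟨by rw [add_mul]; omega, by rwa [← add_assoc]⟩
  | condTrue _ _ ih =>
    have h0 := Test.bits_le hs hb hD0 hD hp.1 (N := N) (by omega)
    obtain ⟨h1, h1'⟩ := ih hp.2.1 hb hD hs (by omega) hD'
    exact ⟨by simp only [add_mul] at *; omega, h1'.mono (by omega)⟩
  | condFalse _ _ ih =>
    have h0 := Test.bits_le hs hb hD0 hD hp.1 (N := N) (by omega)
    obtain ⟨h1, h1'⟩ := ih hp.2.2 hb hD hs (by omega) hD'
    exact ⟨by simp only [add_mul] at *; omega, h1'.mono (by omega)⟩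
  | loopDone _ =>
    have h0 := Test.bits_le hs hb hD0 hD hp.1 (N := N) (by omega)
    exact ⟨by simp only [add_mul] at *; omega, hs.mono (by omega)⟩
  | loopStep _ _ _ ih1 ih2 =>
    have h0 := Test.bits_le hs hb hD0 hD hp.1 (N := N) (by omega)
    obtain ⟨h1, h1'⟩ := ih1 hp.2 hb hD hs (by omega) hD'
    obtain ⟨h2, h2'⟩ := ih2 hp (by omega) (hD' _) h1' (by omega)
      (fun j => by rw [add_assoc]; exact hD' _)
    exact ⟨by simp only [add_mul] at *; omega, h2'.mono (by omega)⟩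

/-! ## Clusters containing a given independent set

Throughout, `B` is the reflexive closure of the adjacency relation of a graph on `ℕ`. -/

/-- `x`, `y`, `z` are the successive vertices of an induced path. -/
def IsInducedP3 (B : ℕ → ℕ → Prop) (x y z : ℕ) : Prop := B x y ∧ B y z ∧ ¬ B x z

/-- `C` induces a disjoint union of cliques. -/
def IsCluster (B : ℕ → ℕ → Prop) (C : Set ℕ) : Prop :=
  ∀ x ∈ C, ∀ y ∈ C, ∀ z ∈ C, B x y → B y z → B x z

/-- `I` induces an edgeless graph. -/
def IsIndep (B : ℕ → ℕ → Prop) (I : Set ℕ) : Prop := ∀ x ∈ I, ∀ y ∈ I, B x y → x = y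

/-- `U` contains `k` pairwise disjoint and anticomplete induced paths on three vertices. -/
def HasPacking (B : ℕ → ℕ → Prop) : ℕ → Set ℕ → Prop
  | 0, _ => True
  | k + 1, U => ∃ x ∈ U, ∃ y ∈ U, ∃ z ∈ U, IsInducedP3 B x y z ∧
      HasPacking B k {u | u ∈ U ∧ ¬ B u x ∧ ¬ B u y ∧ ¬ B u z}

/-- Add to `C` the vertices `0, …, i - 1` of `U` in turn, as long as the result is a cluster. -/
def sweep (B : ℕ → ℕ → Prop) (U C : Set ℕ) : ℕ → Set ℕ
  | 0 => C
  | i + 1 => {u | u ∈ sweep B U C i ∨ u = i ∧ i ∈ U ∧ IsCluster B (insert i (sweep B U C i))}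

/-- Add `a` to `C` and delete the neighbors of `a`. -/
def isolate (B : ℕ → ℕ → Prop) (a : ℕ) (C : Set ℕ) : Set ℕ := {u | u = a ∨ u ∈ C ∧ ¬ B u a}

/-- The vertices of `U` before `v` that are outside the closed neighborhoods of `v`, `x`, `y`. -/
def residualSet (B : ℕ → ℕ → Prop) (U : Set ℕ) (v x y : ℕ) : Set ℕ :=
  {u | u ∈ U ∧ u < v ∧ ¬ B u v ∧ ¬ B u x ∧ ¬ B u y}

/-- The cluster from which the last sweep starts when the certificate `g` with `m` levels is
decoded in `U`. -/
def seed (B : ℕ → ℕ → Prop) (n : ℕ) (g : ℕ → ℕ) : ℕ → Set ℕ → Set ℕ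
  | 0, _ => ∅
  | m + 1, U =>
    if g (5 * m) = g (5 * m + 1) then sweep B U (seed B n g m U) n
    else isolate B (g (5 * m + 4)) (isolate B (g (5 * m + 3)) (isolate B (g (5 * m))
      (sweep B (residualSet B U (g (5 * m)) (g (5 * m + 1)) (g (5 * m + 2)))
        (seed B n g m (residualSet B U (g (5 * m)) (g (5 * m + 1)) (g (5 * m + 2)))) n)))

/-- The cluster encoded by the certificate `g` with `m` levels. -/
def decode (B : ℕ → ℕ → Prop) (n : ℕ) (g : ℕ → ℕ) (m : ℕ) (U : Set ℕ) : Set ℕ :=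
  sweep B U (seed B n g m U) n

/-! ### Existence of certificates -/

section
variable {B : ℕ → ℕ → Prop}

theorem HasPacking.mono {k : ℕ} {U U' : Set ℕ} (h : HasPacking B k U) (hU : U ⊆ U') :
    HasPacking B k U' := by
  induction k generalizing U U' with
  | zero => trivial
  | succ k ih =>
    obtain ⟨x, hx, y, hy, z, hz, hP, h⟩ := h
    exact ⟨x, hU hx, y, hU hy, z, hU hz, hP, ih h fun u hu => ⟨hU hu.1, hu.2⟩⟩

theorem subset_sweep (U C : Set ℕ) (i : ℕ) : C ⊆ sweep B U C i := by
  induction i with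
  | zero => exact subset_rfl
  | succ i ih => exact fun u hu => .inl (ih hu)

theorem sweep_subset {U C : Set ℕ} (h : C ⊆ U) (i : ℕ) : sweep B U C i ⊆ U := by
  induction i with
  | zero => exact h
  | succ i ih =>
    rintro u (hu | ⟨rfl, hu, _⟩)
    exacts [ih hu, hu]

/-- Holds for every `U`, because each addition is guarded by the cluster condition. -/
theorem IsCluster.sweep {U C : Set ℕ} (h : IsCluster B C) (i : ℕ) :
    IsCluster B (sweep B U C i) := by
  induction i with
  | zero => exact h
  | succ i ih =>
    by_cases hi : i ∈ U ∧ IsCluster B (insert i (_root_.sweep B U C i))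
    · intro x hx y hy z hz
      refine hi.2 x ?_ y ?_ z ?_
      · exact hx.elim .inr fun h => .inl h.1
      · exact hy.elim .inr fun h => .inl h.1
      · exact hz.elim .inr fun h => .inl h.1
    · intro x hx y hy z hz
      refine ih x ?_ y ?_ z ?_
      · exact hx.elim id fun h => absurd h.2 hi
      · exact hy.elim id fun h => absurd h.2 hi
      · exact hz.elim id fun h => absurd h.2 hi

/-- After the deletion of its neighbors, `a` is a clique of its own, and the other triples are
inherited from `C`. -/
theorem IsCluster.isolate (hs : ∀ u v, B u v → B v u) {C : Set ℕ}
    (h : IsCluster B C) (a : ℕ) : IsCluster B (isolate B a C) := by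
  rintro x (rfl | hx) y (rfl | hy) z (rfl | hz) hxy hyz
  · exact hyz
  · exact hyz
  · exact absurd (hs _ _ hxy) hy.2
  · exact absurd (hs _ _ hxy) hy.2
  · exact hxy
  · exact absurd hxy hx.2
  · exact absurd hyz hy.2
  · exact h x hx.1 y hy.1 z hz.1 hxy hyz

theorem IsCluster.seed (hs : ∀ u v, B u v → B v u) (n : ℕ) (g : ℕ → ℕ) (m : ℕ) (U : Set ℕ) :
    IsCluster B (seed B n g m U) := by
  induction m generalizing U with
  | zero => exact fun x hx => hx.elim
  | succ m ih =>
    rw [_root_.seed]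
    split_ifs
    · exact (ih U).sweep n
    · exact ((((ih _).sweep n).isolate hs _).isolate hs _).isolate hs _

theorem IsCluster.decode (hs : ∀ u v, B u v → B v u) (n : ℕ) (g : ℕ → ℕ) (m : ℕ) (U : Set ℕ) :
    IsCluster B (decode B n g m U) := (IsCluster.seed hs n g m U).sweep n

/-- In the zero certificate the first two digits of each level agree, so decoding only iterates
sweeps inside `U`. This starts the induction over sweep positions in `exists_certificate`. -/
theorem seed_zero_subset (n m : ℕ) (U : Set ℕ) : seed B n (fun _ => 0) m U ⊆ U := by
  induction m with
  | zero => exact Set.empty_subset U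
  | succ m ih =>
    rw [seed, if_pos rfl]
    exact sweep_subset ih n

/-- Decoding `m` levels reads only the digits below `5 * m`. Hence a level can be put on top of a
certificate, and the certificates of several colors can share one sequence. -/
theorem seed_congr (n : ℕ) {g g' : ℕ → ℕ} {m : ℕ} (h : ∀ d < 5 * m, g d = g' d) (U : Set ℕ) :
    seed B n g m U = seed B n g' m U := by
  induction m generalizing U with
  | zero => rfl
  | succ m ih =>
    have ih' := ih fun d hd => h d (by omega)
    simp only [seed, ih', h (5 * m) (by omega), h (5 * m + 1) (by omega), h (5 * m + 2) (by omega),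
      h (5 * m + 3) (by omega), h (5 * m + 4) (by omega)]

/-- A failed extension of a cluster by a vertex is witnessed by an induced path. -/
theorem exists_P3_of_not_isCluster_insert (hr : ∀ u, B u u) (hs : ∀ u v, B u v → B v u)
    {D : Set ℕ} (hD : IsCluster B D) {i : ℕ} (h : ¬ IsCluster B (insert i D)) :
    ∃ x ∈ D, ∃ y ∈ D, x ≠ i ∧ (IsInducedP3 B i x y ∨ IsInducedP3 B x i y) := by
  unfold IsCluster at h
  push Not at h
  obtain ⟨x, hx, y, hy, z, hz, hxy, hyz, hxz⟩ := h
  rcases hx with rfl | hx <;> rcases hy with rfl | hy <;> rcases hz with rfl | hz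
  · exact absurd hyz hxz
  · exact absurd hyz hxz
  · exact absurd (hr _) hxz
  -- The inequality with `i` is recorded because certificates mark an inactive level by equal first
  -- and second digits.
  · exact ⟨y, hy, z, hz, by rintro rfl; exact hxz hyz, .inl ⟨hxy, hyz, hxz⟩⟩
  · exact absurd hxy hxz
  · exact ⟨x, hx, z, hz, by rintro rfl; exact hxz hyz, .inr ⟨hxy, hyz, hxz⟩⟩
  · exact ⟨y, hy, x, hx, by rintro rfl; exact hxz hxy,
      .inl ⟨hs _ _ hyz, hs _ _ hxy, fun h => hxz (hs _ _ h)⟩⟩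
  · exact absurd (hD x hx y hy z hz hxy hyz) hxz

/-- If `U` has no packing of `m + 1` induced paths on three vertices, then every independent set
in `U` is contained in a cluster that is encoded by a certificate with `m` levels. -/
theorem exists_certificate (hr : ∀ u, B u u) (hs : ∀ u v, B u v → B v u) {n : ℕ} (hn : 0 < n)
    {I : Set ℕ} (hI : IsIndep B I) (m : ℕ) {U : Set ℕ} (hUn : ∀ u ∈ U, u < n)
    (hU : ¬ HasPacking B (m + 1) U) :
    ∃ g : ℕ → ℕ, (∀ d, g d < n) ∧ seed B n g m U ⊆ U ∧ I ∩ U ⊆ decode B n g m U := by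
  induction m generalizing U with
  | zero =>
    refine ⟨fun _ => 0, fun _ => hn, Set.empty_subset U, ?_⟩
    -- Without any induced path on three vertices, every subset of `U` is a cluster, so the sweep
    -- rejects nothing.
    have key : ∀ i, ∀ u ∈ U, u < i → u ∈ sweep B U ∅ i := by
      intro i
      induction i with
      | zero => intro u _ h; omega
      | succ i ih =>
        intro u hu hui
        rcases Nat.lt_succ_iff_lt_or_eq.1 hui with h | rfl
        · exact .inl (ih u hu h)
        · refine .inr ⟨rfl, hu, ?_⟩
          intro x hx y hy z hz hxy hyz
          by_contra hxz
          have hsub : insert u (sweep B U ∅ u) ⊆ U :=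
            Set.insert_subset hu (sweep_subset (Set.empty_subset U) u)
          exact hU ⟨x, hsub hx, y, hsub hy, z, hsub hz, ⟨hxy, hyz, hxz⟩, trivial⟩
    exact fun u hu => key n u hu.2 (hUn u hu.2)
  | succ m ih =>
    -- Induction on the sweep position: some seed lets the sweep keep all members of `I` below `i`.
    -- A failure at `i` replaces the certificate, so its length does not grow with the number of
    -- failures.
    have key : ∀ i ≤ n, ∃ g : ℕ → ℕ, (∀ d, g d < n) ∧ seed B n g (m + 1) U ⊆ U ∧
        ∀ u ∈ I, u ∈ U → u < i → u ∈ sweep B U (seed B n g (m + 1) U) i := by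
      intro i
      induction i with
      | zero => exact fun _ => ⟨fun _ => 0, fun _ => hn, seed_zero_subset n _ U, fun u _ _ h => by
          omega⟩
      | succ i ihi =>
        intro hin
        obtain ⟨g, hg, hgU, hgI⟩ := ihi (by omega)
        by_cases hiI : i ∈ I ∧ i ∈ U ∧
            ¬ IsCluster B (insert i (sweep B U (seed B n g (m + 1) U) i))
        swap
        · refine ⟨g, hg, hgU, fun u hu huU hui => ?_⟩
          rcases Nat.lt_succ_iff_lt_or_eq.1 hui with h | rfl
          · exact .inl (hgI u hu huU h)
          · refine .inr ⟨rfl, huU, ?_⟩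
            by_contra h
            exact hiI ⟨hu, huU, h⟩
        obtain ⟨hiI, hiU, hcl⟩ := hiI
        have hD : IsCluster B (sweep B U (seed B n g (m + 1) U) i) :=
          (IsCluster.seed hs n g (m + 1) U).sweep i
        set D := sweep B U (seed B n g (m + 1) U) i with hDdef
        have hDU : D ⊆ U := sweep_subset hgU i
        obtain ⟨x, hx, y, hy, hxi, hP⟩ := exists_P3_of_not_isCluster_insert hr hs hD hcl
        -- The path on `i`, `x`, `y` is anticomplete to the residual set, so it would extend a
        -- packing there by one path. Its end or its middle vertex is `i`.
        have hpack : ¬ HasPacking B (m + 1) (residualSet B U i x y) := by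
          intro h
          apply hU
          rcases hP with hP | hP
          · exact ⟨i, hiU, x, hDU hx, y, hDU hy, hP,
              h.mono fun u hu => ⟨hu.1, hu.2.2⟩⟩
          · exact ⟨x, hDU hx, i, hiU, y, hDU hy, hP,
              h.mono fun u hu => ⟨hu.1, hu.2.2.2.1, hu.2.2.1, hu.2.2.2.2⟩⟩
        obtain ⟨g', hg', hg'U, hg'I⟩ := ih (U := residualSet B U i x y)
          (fun u hu => hUn u hu.1) hpack
        -- The earlier members of `I` lie in the cluster `D`; two of them in the closed neighborhood
        -- of `x` would be adjacent. If there is none, the choice `i` is harmless, since `i` enters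
        -- the seed anyway.
        have hsel : ∀ x ∈ D, ∃ a ∈ I, a ∈ U ∧ ∀ u ∈ I, u ∈ U → u < i → B u x → u = a := by
          intro x hx
          by_cases h : ∃ a ∈ I, a ∈ U ∧ a < i ∧ B a x
          · obtain ⟨a, haI, haU, hai, hax⟩ := h
            exact ⟨a, haI, haU, fun u hu huU hui hux => hI u hu a haI
              (hD u (hgI u hu huU hui) x hx a (hgI a haI haU hai) hux (hs _ _ hax))⟩
          · exact ⟨i, hiI, hiU, fun u hu huU hui hux => absurd ⟨u, hu, huU, hui, hux⟩ h⟩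
        obtain ⟨a, haI, haU, ha⟩ := hsel x hx
        obtain ⟨b, hbI, hbU, hb⟩ := hsel y hy
        -- The inductive certificate with the five digits of one level on top.
        let f : ℕ → ℕ := fun d => if d < 5 * m then g' d else if d = 5 * m then i else
          if d = 5 * m + 1 then x else if d = 5 * m + 2 then y else if d = 5 * m + 3 then a else b
        have f0 : f (5 * m) = i := by simp [f]
        have f1 : f (5 * m + 1) = x := by simp [f]
        have f2 : f (5 * m + 2) = y := by simp [f]
        have f3 : f (5 * m + 3) = a := by simp [f]
        have f4 : f (5 * m + 4) = b := by simp [f]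
        have hf : ∀ W, seed B n f m W = seed B n g' m W :=
          seed_congr n fun d hd => by simp [f, hd]
        have hseed : seed B n f (m + 1) U = isolate B b (isolate B a (isolate B i
            (decode B n g' m (residualSet B U i x y)))) := by
          rw [seed, f0, f1, f2, f3, f4, if_neg hxi.symm, hf]
          rfl
        refine ⟨f, fun d => ?_, ?_, ?_⟩
        · simp only [f]
          split_ifs
          exacts [hg' d, hin, hUn x (hDU hx), hUn y (hDU hy), hUn a haU, hUn b hbU]
        · rw [hseed]
          rintro u (rfl | ⟨rfl | ⟨rfl | ⟨hu, -⟩, -⟩, -⟩)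
          exacts [hbU, haU, hiU, (sweep_subset hg'U n hu).1]
        · intro u hu huU hui
          -- The new seed alone already contains `I` up to and including `i`.
          apply subset_sweep
          have hcase : u = i ∨ u = a ∨ u = b ∨ u ∈ residualSet B U i x y := by
            by_cases h1 : u = i
            · exact .inl h1
            by_cases h2 : B u x
            · exact .inr (.inl (ha u hu huU (by omega) h2))
            by_cases h3 : B u y
            · exact .inr (.inr (.inl (hb u hu huU (by omega) h3)))
            · exact .inr (.inr (.inr ⟨huU, by omega, fun h => h1 (hI u hu i hiI h), h2, h3⟩))
          -- Isolating a member of `I` deletes no other member of `I`, by independence.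
          have hiso : ∀ c ∈ I, ∀ C : Set ℕ, u = c ∨ u ∈ C → u ∈ isolate B c C := by
            intro c hc C h
            rcases h with h | h
            · exact .inl h
            · by_cases h' : B u c
              · exact .inl (hI u hu c hc h')
              · exact .inr ⟨h, h'⟩
          rw [hseed]
          rcases hcase with h | h | h | h
          · exact hiso b hbI _ (.inr (hiso a haI _ (.inr (hiso i hiI _ (.inl h)))))
          · exact hiso b hbI _ (.inr (hiso a haI _ (.inl h)))
          · exact hiso b hbI _ (.inl h)
          · exact hiso b hbI _ (.inr (hiso a haI _ (.inr (hiso i hiI _ (.inr (hg'I ⟨hu, h⟩))))))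
    obtain ⟨g, hg, hgU, hgI⟩ := key n le_rfl
    exact ⟨g, hg, hgU, fun u hu => hgI u hu.1 hu.2 (hUn u hu.2)⟩

end

/-! ## Greedy matching of vertices to cliques

A color `c ≠ 0` may be used at the vertex `v` if `Al v c`; the vertices that may use `c` form a
cluster. A partial coloring uses every color at most once in every clique of the cluster of this
color; `0` means uncolored. -/

/-- `col` is a partial coloring of the vertices `0, …, n - 1`. -/
structure IsPartialColoring (n : ℕ) (B Al : ℕ → ℕ → Prop) (col : ℕ → ℕ) : Prop where
  allowed : ∀ v < n, col v ≠ 0 → Al v (col v)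
  inj : ∀ u < n, ∀ v < n, col u = col v → col u ≠ 0 → B u v → u = v

/-- Every color that is allowed at a vertex of `T` is blocked by a vertex of `T`. -/
structure IsTight (n : ℕ) (B Al : ℕ → ℕ → Prop) (col : ℕ → ℕ) (T : Finset ℕ) : Prop where
  subset : T ⊆ range n
  blocked : ∀ v ∈ T, ∀ c, Al v c → ∃ u ∈ T, col u = c ∧ B u v

/-- The colored vertices. -/
def colored (n : ℕ) (col : ℕ → ℕ) : Finset ℕ := {v ∈ range n | col v ≠ 0}

theorem mem_colored {n : ℕ} {col : ℕ → ℕ} {v : ℕ} : v ∈ colored n col ↔ v < n ∧ col v ≠ 0 := by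
  simp [colored]

/-- The data that describe how the graph restricts colorings. -/
structure IsColorSystem (B Al : ℕ → ℕ → Prop) : Prop where
  refl : ∀ u, B u u
  symm : ∀ u v, B u v → B v u
  ne_zero : ∀ v, ¬ Al v 0
  trans : ∀ c x y z, Al x c → Al y c → Al z c → B x y → B y z → B x z

/-- The parent of the vertex `u` in the search tree wants to take over the color of `u`. -/
structure IsTreeEdge (B Al : ℕ → ℕ → Prop) (col : ℕ → ℕ) (vis : Finset ℕ) (par d : ℕ → ℕ)
    (u : ℕ) : Prop where
  ne_zero : col u ≠ 0
  mem : par u ∈ vis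
  allowed : Al (par u) (col u)
  adj : B u (par u)
  lt : d (par u) < d u

/-- `vis` is the set of vertices found in the search for an augmenting path from `p`, `par` maps
them to their parents. -/
structure IsSearchTree (n : ℕ) (B Al : ℕ → ℕ → Prop) (col : ℕ → ℕ) (p : ℕ) (vis : Finset ℕ)
    (par d : ℕ → ℕ) : Prop where
  root : p ∈ vis
  subset : vis ⊆ range n
  edge : ∀ u ∈ vis, u ≠ p → IsTreeEdge B Al col vis par d u
  lt_card : ∀ u ∈ vis, d u < vis.card

theorem IsSearchTree.singleton {n : ℕ} {B Al : ℕ → ℕ → Prop} {col : ℕ → ℕ} {p : ℕ} (hp : p < n)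
    (par : ℕ → ℕ) : IsSearchTree n B Al col p {p} par fun _ => 0 where
  root := mem_singleton_self p
  subset := by simpa using hp
  edge u hu hup := absurd (mem_singleton.1 hu) hup
  lt_card := by simp

/-- The rank of the new vertex is the number of vertices found before it. It exceeds all earlier
ranks, so ranks decrease strictly towards the root. -/
theorem IsSearchTree.extend {n : ℕ} {B Al : ℕ → ℕ → Prop} (hB : IsColorSystem B Al)
    {col : ℕ → ℕ} {p : ℕ} {vis : Finset ℕ} {par d : ℕ → ℕ}
    (h : IsSearchTree n B Al col p vis par d) {u v : ℕ} (hv : v ∈ vis) (hu : u < n)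
    (huv : u ∉ vis) (hal : Al v (col u)) (hadj : B u v) :
    IsSearchTree n B Al col p (insert u vis) (Function.update par u v)
      (Function.update d u vis.card) where
  root := mem_insert_of_mem h.root
  subset := insert_subset (mem_range.2 hu) h.subset
  edge x hx hxp := by
    have hvu : v ≠ u := fun h => huv (h ▸ hv)
    by_cases hxu : x = u
    · subst hxu
      refine ⟨fun h0 => hB.ne_zero _ (h0 ▸ hal), ?_, ?_, ?_, ?_⟩
      · simp [hv]
      · simpa
      · simpa
      · simpa [hvu] using h.lt_card v hv
    · have hxv : x ∈ vis := (mem_insert.1 hx).resolve_left hxu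
      have he := h.edge x hxv hxp
      have hpu : par x ≠ u := fun h => huv (h ▸ he.mem)
      refine ⟨he.ne_zero, ?_, ?_, ?_, ?_⟩
      · simp [hxu, he.mem]
      · simpa [hxu] using he.allowed
      · simpa [hxu] using he.adj
      · simpa [hxu, hpu] using he.lt
  lt_card x hx := by
    rw [card_insert_of_notMem huv]
    by_cases hxu : x = u
    · simp [hxu]
    · have := h.lt_card x ((mem_insert.1 hx).resolve_left hxu)
      simp only [Function.update_of_ne hxu]
      omega

/-- Only pairs that contain `x` are new, and `c` is free at `x`. -/
theorem IsPartialColoring.update {n : ℕ} {B Al : ℕ → ℕ → Prop} (hB : IsColorSystem B Al)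
    {col : ℕ → ℕ} (h : IsPartialColoring n B Al col) {x c : ℕ} (hc : Al x c)
    (hfree : ∀ u < n, col u = c → ¬ B u x) :
    IsPartialColoring n B Al (Function.update col x c) where
  allowed v hv hv0 := by
    by_cases hvx : v = x
    · subst hvx
      simpa
    · rw [Function.update_of_ne hvx] at hv0 ⊢
      exact h.allowed v hv hv0
  inj u hu v hv huv hu0 hadj := by
    by_cases hux : u = x <;> by_cases hvx : v = x
    · rw [hux, hvx]
    · subst hux
      rw [Function.update_self, Function.update_of_ne hvx] at huv
      exact absurd (hB.symm _ _ hadj) (hfree v hv huv.symm)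
    · subst hvx
      rw [Function.update_self, Function.update_of_ne hux] at huv
      exact absurd hadj (hfree u hu huv)
    · rw [Function.update_of_ne hux] at hu0
      rw [Function.update_of_ne hux, Function.update_of_ne hvx] at huv
      exact h.inj u hu v hv huv hu0 hadj

/-- `col` arises from `col₀` by coloring `p` in addition to the colored vertices; tight sets that do
not contain `p` stay tight. -/
structure IsAugmentation (n : ℕ) (B Al : ℕ → ℕ → Prop) (col₀ : ℕ → ℕ) (p : ℕ) (col : ℕ → ℕ) :
    Prop where
  coloring : IsPartialColoring n B Al col
  ne_zero_iff : ∀ v, col v ≠ 0 ↔ v = p ∨ col₀ v ≠ 0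
  tight : ∀ T : Finset ℕ, IsTight n B Al col₀ T → IsTight n B Al col T

/-- An intermediate state in an augmentation of `col₀`: the vertex `x` may take the free color `c`,
and it remains to shift the colors on the path from `p` to `x`. -/
structure IsShiftState (n : ℕ) (B Al : ℕ → ℕ → Prop) (col₀ : ℕ → ℕ) (p : ℕ) (vis : Finset ℕ)
    (par d col : ℕ → ℕ) (x c : ℕ) : Prop where
  coloring : IsPartialColoring n B Al col
  ne_zero_iff : ∀ v, col v ≠ 0 ↔ col₀ v ≠ 0
  tight : ∀ T : Finset ℕ, IsTight n B Al col₀ T → IsTight n B Al col T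
  root : col p = 0
  mem : x ∈ vis
  allowed : Al x c
  free : ∀ u < n, col u = c → ¬ B u x
  edge : ∀ y ∈ vis, y ≠ p → d y ≤ d x → IsTreeEdge B Al col vis par d y

/-! ### Shifting colors along an augmenting path -/

section
variable {n : ℕ} {B Al : ℕ → ℕ → Prop} {col₀ col : ℕ → ℕ} {p x c : ℕ} {vis : Finset ℕ}
  {par d : ℕ → ℕ}

/-- A vertex of a tight set has no free color, since each of its allowed colors is blocked within
the set. So `x` is not in `T`, and no blocker in `T` changes its color. -/
theorem IsShiftState.tight_update (h : IsShiftState n B Al col₀ p vis par d col x c)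
    {T : Finset ℕ} (hT : IsTight n B Al col₀ T) :
    IsTight n B Al (Function.update col x c) T := by
  have hT' := h.tight T hT
  refine ⟨hT.subset, fun v hv c' hc' => ?_⟩
  obtain ⟨u, hu, huc, huv⟩ := hT'.blocked v hv c' hc'
  refine ⟨u, hu, ?_, huv⟩
  rwa [Function.update_of_ne]
  rintro rfl
  obtain ⟨y, hy, hyc, hyu⟩ := hT'.blocked u hu c h.allowed
  exact h.free y (mem_range.1 (hT.subset hy)) hyc hyu

theorem IsSearchTree.isShiftState (h : IsSearchTree n B Al col p vis par d)
    (hcol : IsPartialColoring n B Al col) (hp : col p = 0) (hx : x ∈ vis) (hc : Al x c)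
    (hfree : ∀ u < n, col u = c → ¬ B u x) :
    IsShiftState n B Al col p vis par d col x c :=
  ⟨hcol, fun _ => Iff.rfl, fun _ h => h, hp, hx, hc, hfree, fun y hy hyp _ => h.edge y hy hyp⟩

theorem IsShiftState.isAugmentation (hB : IsColorSystem B Al)
    (h : IsShiftState n B Al col₀ p vis par d col p c) :
    IsAugmentation n B Al col₀ p (Function.update col p c) where
  coloring := h.coloring.update hB h.allowed h.free
  ne_zero_iff v := by
    by_cases hv : v = p
    · subst hv
      have : c ≠ 0 := fun h0 => hB.ne_zero _ (h0 ▸ h.allowed)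
      simpa using this
    · simp [hv, ← h.ne_zero_iff v]
  tight T hT := h.tight_update hT

/-- When `x` takes `c`, its old color becomes free at its parent: another vertex with this color
adjacent to the parent would, by transitivity in the cluster of that color, be adjacent to `x`. The
remaining tree edges have smaller rank and do not involve the color of `x`. -/
theorem IsShiftState.step (hB : IsColorSystem B Al) (hvis : vis ⊆ range n)
    (h : IsShiftState n B Al col₀ p vis par d col x c) (hxp : x ≠ p) :
    IsShiftState n B Al col₀ p vis par d (Function.update col x c) (par x) (col x) ∧
      d (par x) < d x := by
  have hx := h.edge x h.mem hxp le_rfl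
  have hc0 : c ≠ 0 := fun h0 => hB.ne_zero _ (h0 ▸ h.allowed)
  have hxn : x < n := mem_range.1 (hvis h.mem)
  refine ⟨⟨h.coloring.update hB h.allowed h.free, fun v => ?_, fun T hT => h.tight_update hT, ?_,
    hx.mem, hx.allowed, fun u hu huc hadj => ?_, fun y hy hyp hyd => ?_⟩, hx.lt⟩
  · by_cases hv : v = x
    · subst hv
      simpa [hc0] using (h.ne_zero_iff v).1 hx.ne_zero
    · rw [Function.update_of_ne hv]
      exact h.ne_zero_iff v
  · rw [Function.update_of_ne hxp.symm]
    exact h.root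
  · by_cases hux : u = x
    · subst hux
      rw [Function.update_self] at huc
      exact h.free u hu huc.symm (hB.refl u)
    · rw [Function.update_of_ne hux] at huc
      have hu0 : col u ≠ 0 := huc ▸ hx.ne_zero
      refine hux (h.coloring.inj u hu x hxn huc hu0 (hB.trans (col x) u (par x) x ?_ hx.allowed
        (h.coloring.allowed x hxn hx.ne_zero) hadj (hB.symm _ _ hx.adj)))
      exact huc ▸ h.coloring.allowed u hu hu0
  · have hyx : y ≠ x := by
      rintro rfl
      exact absurd hx.lt (by omega)
    have he := h.edge y hy hyp (hyd.trans hx.lt.le)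
    exact ⟨by rw [Function.update_of_ne hyx]; exact he.ne_zero, he.mem,
      by rw [Function.update_of_ne hyx]; exact he.allowed, he.adj, he.lt⟩

end

/-- `F` can be colored. -/
def IsColorable (n : ℕ) (B Al : ℕ → ℕ → Prop) (F : Finset ℕ) : Prop :=
  F ⊆ range n ∧ ∃ col, IsPartialColoring n B Al col ∧ ∀ v ∈ F, col v ≠ 0

/-- The invariant of the greedy algorithm, when the vertices of `P` have been processed. -/
structure IsGreedyState (n : ℕ) (B Al : ℕ → ℕ → Prop) (w : ℕ → ℚ) (P : Finset ℕ) (col : ℕ → ℕ) :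
    Prop where
  subset : P ⊆ range n
  coloring : IsPartialColoring n B Al col
  mem_of_ne_zero : ∀ v < n, col v ≠ 0 → v ∈ P
  le : ∀ v ∈ P, ∀ u < n, u ∉ P → w u ≤ w v
  tight : ∃ T ⊆ P, IsTight n B Al col T ∧ ∀ v ∈ P, col v = 0 → v ∈ T
  -- A weighted form of the cardinality bound: each vertex by which the coloring exceeds `F` within
  -- `P` is worth at least the threshold `θ`. Keeping `θ` variable makes the inequality inductive.
  opt : ∀ F, IsColorable n B Al F → ∀ θ, 0 ≤ θ → (∀ v ∈ P, θ ≤ w v) →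
    ∑ v ∈ F ∩ P, w v + (((colored n col).card : ℚ) - (F ∩ P).card) * θ ≤ ∑ v ∈ colored n col, w v

/-! ### Optimality of the greedy rule -/

section
variable {n : ℕ} {B Al : ℕ → ℕ → Prop} {w : ℕ → ℚ} {P : Finset ℕ} {col col' : ℕ → ℕ} {p : ℕ}

theorem IsGreedyState.empty (h : ∀ v < n, col v = 0) :
    IsGreedyState n B Al w ∅ col where
  subset := empty_subset _
  coloring := ⟨fun v hv h0 => absurd (h v hv) h0, fun u hu _ _ _ h0 => absurd (h u hu) h0⟩
  mem_of_ne_zero v hv h0 := absurd (h v hv) h0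
  le := by simp
  tight := ⟨∅, subset_rfl, ⟨empty_subset _, by simp⟩, by simp⟩
  opt F _ θ _ _ := by
    have : colored n col = ∅ := by
      ext v
      simpa [mem_colored] using h v
    simp [this]

/-- A colorable set has no more vertices in `P` than the coloring, if the uncolored vertices of `P`
lie in a tight subset of `P`. -/
theorem card_inter_le (hB : IsColorSystem B Al) {T : Finset ℕ} (hP : P ⊆ range n)
    (hcol : IsPartialColoring n B Al col) (hT : IsTight n B Al col T)
    (hPT : ∀ v ∈ P, col v = 0 → v ∈ T) {F : Finset ℕ} (hF : IsColorable n B Al F) :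
    (F ∩ P).card ≤ (colored n col).card := by
  obtain ⟨hFn, ψ, hψ, hψ0⟩ := hF
  have hal : ∀ v ∈ F, Al v (ψ v) := fun v hv =>
    hψ.allowed v (mem_range.1 (hFn hv)) (hψ0 v hv)
  -- The injection into the colored vertices fixes vertices outside `T` and sends a vertex of `T` to
  -- the vertex of `T` that blocks the color given to it by `ψ`.
  have hex : ∀ v ∈ F ∩ P, ∃ u ∈ colored n col, (v ∈ T → u ∈ T ∧ col u = ψ v ∧ B u v) ∧
      (v ∉ T → u = v) := by
    intro v hv
    obtain ⟨hvF, hvP⟩ := mem_inter.1 hv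
    by_cases hvT : v ∈ T
    · obtain ⟨u, hu, huc, huv⟩ := hT.blocked v hvT (ψ v) (hal v hvF)
      refine ⟨u, mem_colored.2 ⟨mem_range.1 (hT.subset hu), ?_⟩,
        fun _ => ⟨hu, huc, huv⟩, fun h => absurd hvT h⟩
      rw [huc]
      exact hψ0 v hvF
    · exact ⟨v, mem_colored.2 ⟨mem_range.1 (hP hvP), fun h0 => hvT (hPT v hvP h0)⟩,
        fun h => absurd h hvT, fun _ => rfl⟩
  choose! f hf hfT hfT' using hex
  refine card_le_card_of_injOn f (fun v hv => hf v hv) fun v hv v' hv' h => ?_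
  have hvF := (mem_inter.1 hv).1
  have hvF' := (mem_inter.1 hv').1
  by_cases h1 : v ∈ T <;> by_cases h2 : v' ∈ T
  · obtain ⟨huT, hc, hadj⟩ := hfT v hv h1
    obtain ⟨-, hc', hadj'⟩ := hfT v' hv' h2
    rw [← h] at hc' hadj'
    have hψψ : ψ v = ψ v' := hc.symm.trans hc'
    have hu := mem_colored.1 (hf v hv)
    refine hψ.inj v (mem_range.1 (hFn hvF)) v' (mem_range.1 (hFn hvF')) hψψ (hψ0 v hvF) ?_
    -- Two vertices with the same blocker have the same color under `ψ` and lie in the same clique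
    -- of its cluster.
    exact hB.trans (ψ v) v (f v) v' (hal v hvF) (hc ▸ hcol.allowed _ hu.1 hu.2)
      (hψψ ▸ hal v' hvF') (hB.symm _ _ hadj) hadj'
  · have := (hfT v hv h1).1
    rw [h, hfT' v' hv' h2] at this
    exact absurd this h2
  · have := (hfT v' hv' h2).1
    rw [← h, hfT' v hv h1] at this
    exact absurd this h1
  · rw [← hfT' v hv h1, ← hfT' v' hv' h2, h]

/-- Processing a further vertex `p` of maximum weight, which may become colored or not. -/
theorem IsGreedyState.process (hB : IsColorSystem B Al) (h : IsGreedyState n B Al w P col)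
    (hp : p < n) (hpP : p ∉ P) (hmax : ∀ u < n, u ∉ P → w u ≤ w p) (hw : 0 ≤ w p)
    (hcol : IsPartialColoring n B Al col')
    (hiff : ∀ v, v ≠ p → (col' v ≠ 0 ↔ col v ≠ 0))
    (htight : ∃ T ⊆ insert p P, IsTight n B Al col' T ∧ ∀ v ∈ insert p P, col' v = 0 → v ∈ T) :
    IsGreedyState n B Al w (insert p P) col' := by
  have hPn : insert p P ⊆ range n := insert_subset (mem_range.2 hp) h.subset
  refine ⟨hPn, hcol, fun v hv h0 => ?_, fun v hv u hu huP => ?_, htight, ?_⟩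
  · by_cases hvp : v = p
    · exact hvp ▸ mem_insert_self _ _
    · exact mem_insert_of_mem (h.mem_of_ne_zero v hv ((hiff v hvp).1 h0))
  · simp only [mem_insert, not_or] at huP
    rcases mem_insert.1 hv with rfl | hv
    · exact hmax u hu huP.2
    · exact h.le v hv u hu huP.2
  intro F hF θ hθ hθw
  have hθp := hθw p (mem_insert_self _ _)
  -- The largest threshold still admissible before `p` is processed. Afterwards it can only be
  -- lowered.
  have hopt := h.opt F hF (w p) hw fun v hv => h.le v hv p hp hpP
  obtain ⟨T₀, -, hT₀, hPT₀⟩ := h.tight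
  have hcard₀ : ((F ∩ P).card : ℚ) ≤ (colored n col).card := by
    exact_mod_cast card_inter_le hB h.subset h.coloring hT₀ hPT₀ hF
  obtain ⟨T, -, hT, hPT⟩ := htight
  have hcard : ((F ∩ insert p P).card : ℚ) ≤ (colored n col').card := by
    exact_mod_cast card_inter_le hB hPn hcol hT hPT hF
  have hpcol : p ∉ colored n col := fun hc => hpP (h.mem_of_ne_zero p hp (mem_colored.1 hc).2)
  have hpFP : p ∉ F ∩ P := fun hc => hpP (mem_inter.1 hc).2
  have hFsum : p ∈ F → (∑ v ∈ F ∩ insert p P, w v = w p + ∑ v ∈ F ∩ P, w v) ∧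
      ((F ∩ insert p P).card : ℚ) = (F ∩ P).card + 1 := by
    intro hpF
    rw [inter_insert_of_mem hpF, sum_insert hpFP, card_insert_of_notMem hpFP]
    exact ⟨rfl, by push_cast; rfl⟩
  have hFsum' : p ∉ F → F ∩ insert p P = F ∩ P := fun hpF => inter_insert_of_notMem hpF
  have hSsum : col' p ≠ 0 → (∑ v ∈ colored n col', w v = w p + ∑ v ∈ colored n col, w v) ∧
      ((colored n col').card : ℚ) = (colored n col).card + 1 := by
    intro hp0
    have : colored n col' = insert p (colored n col) := by
      ext v
      by_cases hvp : v = p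
      · subst hvp
        simp [mem_colored, hp, hp0]
      · simp only [mem_colored, mem_insert, hvp, false_or, hiff v hvp]
    rw [this, sum_insert hpcol, card_insert_of_notMem hpcol]
    exact ⟨rfl, by push_cast; rfl⟩
  have hSsum' : col' p = 0 → colored n col' = colored n col := by
    intro hp0
    ext v
    by_cases hvp : v = p
    · subst hvp
      simp only [mem_colored, hp0, ne_eq, not_true_eq_false, and_false, false_iff, not_and]
      exact fun hv h0 => hpP (h.mem_of_ne_zero v hv h0)
    · simp only [mem_colored, hiff v hvp]
  -- Let `c` and `f` be the sizes of the coloring and of `F ∩ P` before the step. The claim follows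
  -- from the product of `w p - θ` with `c - f`, or with `c - f - 1` if `p` lies in `F` but stays
  -- uncolored; the cardinality bounds make these factors nonnegative.
  by_cases hpF : p ∈ F <;> by_cases hp0 : col' p = 0
  · obtain ⟨e1, e2⟩ := hFsum hpF
    rw [hSsum' hp0] at hcard ⊢
    rw [e2] at hcard
    rw [e1, e2]
    nlinarith
  · obtain ⟨e1, e2⟩ := hFsum hpF
    obtain ⟨e3, e4⟩ := hSsum hp0
    rw [e1, e2, e3, e4]
    nlinarith
  · rw [hFsum' hpF, hSsum' hp0]
    nlinarith
  · obtain ⟨e3, e4⟩ := hSsum hp0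
    rw [hFsum' hpF, e3, e4]
    nlinarith

/-- The vertices of `R` other than `p` are colored, hence processed. Tight sets are closed under
union, so the union of `R` with the old tight set covers the uncolored vertices including `p`. -/
theorem IsGreedyState.reject (hB : IsColorSystem B Al) (h : IsGreedyState n B Al w P col)
    (hp : p < n) (hpP : p ∉ P) (hmax : ∀ u < n, u ∉ P → w u ≤ w p) (hw : 0 ≤ w p)
    {R : Finset ℕ} (hR : IsTight n B Al col R) (hpR : p ∈ R)
    (hRcol : ∀ v ∈ R, v ≠ p → col v ≠ 0) : IsGreedyState n B Al w (insert p P) col := by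
  refine h.process hB hp hpP hmax hw h.coloring (fun _ _ => Iff.rfl) ?_
  obtain ⟨T, hTP, hT, hPT⟩ := h.tight
  refine ⟨T ∪ R, union_subset (hTP.trans (subset_insert _ _)) fun v hv => ?_,
    ⟨union_subset hT.subset hR.subset, fun v hv c hc => ?_⟩, fun v hv h0 => ?_⟩
  · by_cases hvp : v = p
    · exact hvp ▸ mem_insert_self _ _
    · exact mem_insert_of_mem (h.mem_of_ne_zero v (mem_range.1 (hR.subset hv)) (hRcol v hv hvp))
  · rcases mem_union.1 hv with hv | hv
    · obtain ⟨u, hu, huv⟩ := hT.blocked v hv c hc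
      exact ⟨u, mem_union_left _ hu, huv⟩
    · obtain ⟨u, hu, huv⟩ := hR.blocked v hv c hc
      exact ⟨u, mem_union_right _ hu, huv⟩
  · rcases mem_insert.1 hv with rfl | hv
    · exact mem_union_right _ hpR
    · exact mem_union_left _ (hPT v hv h0)

/-- An augmentation uncolors nothing and preserves tightness, so the old tight set still covers all
uncolored processed vertices. -/
theorem IsGreedyState.accept (hB : IsColorSystem B Al) (h : IsGreedyState n B Al w P col)
    (hp : p < n) (hpP : p ∉ P) (hmax : ∀ u < n, u ∉ P → w u ≤ w p) (hw : 0 ≤ w p)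
    (hcol : IsAugmentation n B Al col p col') : IsGreedyState n B Al w (insert p P) col' := by
  refine h.process hB hp hpP hmax hw hcol.coloring (fun v hv => by simp [hcol.ne_zero_iff v, hv]) ?_
  obtain ⟨T, hTP, hT, hPT⟩ := h.tight
  refine ⟨T, hTP.trans (subset_insert _ _), hcol.tight T hT, fun v hv h0 => ?_⟩
  have := mt (hcol.ne_zero_iff v).2 (not_not.2 h0)
  push Not at this
  exact hPT v ((mem_insert.1 hv).resolve_left this.1) this.2

/-- When all vertices have been processed, the coloring has maximum weight. -/
theorem IsGreedyState.sum_le (h : IsGreedyState n B Al w (range n) col) (hw : ∀ v < n, 0 ≤ w v)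
    {F : Finset ℕ} (hF : IsColorable n B Al F) : ∑ v ∈ F, w v ≤ ∑ v ∈ colored n col, w v := by
  -- Threshold zero removes the cardinality term.
  have := h.opt F hF 0 le_rfl fun v hv => hw v (mem_range.1 hv)
  simpa [inter_eq_left.2 hF.1] using this

end

/-! ## Programs for clusters -/

namespace Test

/-- The test `e ≠ 0`. -/
abbrev nz (e : NatExp) : Test := natLE (.const 1) e

/-- The test `e = f`. -/
abbrev natEq (e f : NatExp) : Test := conj (natLE e f) (natLE f e)

theorem holds_nz (s : Mem) (e : NatExp) : (nz e).holds s ↔ e.eval s ≠ 0 := by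
  simp [holds, NatExp.eval, Nat.one_le_iff_ne_zero]

theorem holds_natEq (s : Mem) (e f : NatExp) : (natEq e f).holds s ↔ e.eval s = f.eval s := by
  simp [holds, le_antisymm_iff]

theorem holds_conj (s : Mem) (b c : Test) : (conj b c).holds s ↔ b.holds s ∧ c.holds s := Iff.rfl

theorem holds_neg (s : Mem) (b : Test) : (neg b).holds s ↔ ¬ b.holds s := Iff.rfl

end Test

theorem NatExp.eval_const (s : Mem) (c : ℕ) : (const c).eval s = c := rfl

theorem NatExp.eval_get (s : Mem) (A : ℕ) (e : NatExp) :
    (get A e).eval s = s.nat A (e.eval s) := rfl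

theorem NatExp.eval_add (s : Mem) (e f : NatExp) : (add e f).eval s = e.eval s + f.eval s := rfl

/-- The entry of the adjacency matrix at row `e` and column `f`; array `4` holds the positions of
the rows. -/
abbrev NatExp.adj (e f : NatExp) : NatExp := .get 1 (.add (.get 4 e) f)

/-- The positions less than `n` of the nonzero entries of array `A`. -/
def Mem.supp (n A : ℕ) (s : Mem) : Finset ℕ := {v ∈ range n | s.nat A v ≠ 0}

theorem Mem.mem_supp {n A v : ℕ} {s : Mem} : v ∈ s.supp n A ↔ v < n ∧ s.nat A v ≠ 0 := by
  simp [supp]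

theorem Mem.supp_congr {n A : ℕ} {s s' : Mem} (h : s.nat A = s'.nat A) :
    s.supp n A = s'.supp n A := by
  simp [supp, h]

/-- The memory holds the matrix of the relation `B` on `0, …, n - 1`. -/
structure Mem.HasGraph (n : ℕ) (B : ℕ → ℕ → Prop) (s : Mem) : Prop where
  size : s.nat 0 0 = n
  row : ∀ u < n, s.nat 4 u = u * n
  adj : ∀ u < n, ∀ v < n, (s.nat 1 (u * n + v) ≠ 0 ↔ B u v)
  adj_le : ∀ u < n, ∀ v < n, s.nat 1 (u * n + v) ≤ 1

theorem Mem.HasGraph.congr {n : ℕ} {B : ℕ → ℕ → Prop} {s s' : Mem} (h : s.HasGraph n B)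
    (h0 : s'.nat 0 = s.nat 0) (h1 : s'.nat 1 = s.nat 1) (h4 : s'.nat 4 = s.nat 4) :
    s'.HasGraph n B := by
  obtain ⟨a, b, c, d⟩ := h
  exact ⟨by rw [h0, a], by rwa [h4], by rwa [h1], by rwa [h1]⟩

theorem Mem.HasGraph.eval_adj {n : ℕ} {B : ℕ → ℕ → Prop} {s : Mem} (h : s.HasGraph n B)
    {e f : NatExp} (he : e.eval s < n) (hf : f.eval s < n) :
    (NatExp.adj e f).eval s ≠ 0 ↔ B (e.eval s) (f.eval s) := by
  simp only [NatExp.eval]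
  rw [h.row _ he]
  exact h.adj _ he _ hf

theorem Mem.HasGraph.eval_adj_le {n : ℕ} {B : ℕ → ℕ → Prop} {s : Mem} (h : s.HasGraph n B)
    {e f : NatExp} (he : e.eval s < n) (hf : f.eval s < n) : (NatExp.adj e f).eval s ≤ 1 := by
  simp only [NatExp.eval]
  rw [h.row _ he]
  exact h.adj_le _ he _ hf

namespace LoopProg

/-- The program computes `sweep`. -/
def sweepProg (U C : ℕ) : LoopProg :=
  .count 20 (.cond (.nz (.get U (.reg 20)))
    (.seq (.setNat 7 (.const 0) (.const 1))
      (.seq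
        (.count 21 (.count 22 (.cond
          (.conj (.nz (.get C (.reg 21))) (.conj (.nz (.get C (.reg 22)))
            (.conj (.nz (.adj (.reg 20) (.reg 21)))
              (.neg (.natEq (.adj (.reg 20) (.reg 22)) (.adj (.reg 21) (.reg 22)))))))
          (.setNat 7 (.const 0) (.const 0)) .skip)))
        (.cond (.nz (.reg 7)) (.setNat C (.reg 20) (.const 1)) .skip)))
    .skip)

/-- Testing a condition for all values of a loop counter. -/
theorem run_for_check {x n : ℕ} {p : LoopProg} {s : Mem} (hn : s.nat 0 0 = n) (hx : x ≠ 7)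
    (P : ℕ → Prop)
    (hp : ∀ i < n, ∀ u : Mem, u.nat x 0 = i → (∀ A ∉ insert x p.natWrites, u.nat A = s.nat A) →
      ((p.run u).nat 7 0 ≠ 0 ↔ u.nat 7 0 ≠ 0 ∧ P i)) :
    ((LoopProg.count x p).run s).nat 7 0 ≠ 0 ↔ s.nat 7 0 ≠ 0 ∧ ∀ i < n, P i := by
  refine run_for hn (fun i u => u.nat 7 0 ≠ 0 ↔ s.nat 7 0 ≠ 0 ∧ ∀ j < i, P j) ?_ ?_
  · rw [Mem.nat_setNat_of_ne _ _ _ hx.symm]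
    simp
  · intro i hi u hu hf _ hI
    rw [Mem.nat_setNat_of_ne _ _ _ hx.symm, hp i hi u hu hf, hI, and_assoc]
    refine and_congr_right fun _ => ?_
    rw [Nat.forall_lt_succ_right]

/-- The new vertex must have the same closed neighborhood in `C` as each of its neighbors there.
This form of the condition needs loops over only two vertices. -/
theorem isCluster_insert_iff {B : ℕ → ℕ → Prop} (hr : ∀ u, B u u) (hs : ∀ u v, B u v → B v u)
    {C : Set ℕ} (hC : IsCluster B C) (u : ℕ) :
    IsCluster B (insert u C) ↔ ∀ x ∈ C, ∀ y ∈ C, B u x → (B u y ↔ B x y) := by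
  refine ⟨fun h x hx y hy hux => ⟨fun huy => ?_, fun hxy => ?_⟩, fun h => ?_⟩
  · exact h x (.inr hx) u (.inl rfl) y (.inr hy) (hs _ _ hux) huy
  · exact h u (.inl rfl) x (.inr hx) y (.inr hy) hux hxy
  · by_contra hcl
    obtain ⟨x, hx, y, hy, -, ⟨h1, h2, h3⟩ | ⟨h1, h2, h3⟩⟩ :=
      exists_P3_of_not_isCluster_insert hr hs hC hcl
    · exact h3 ((h x hx y hy h1).2 h2)
    · exact h3 ((h x hx y hy (hs _ _ h1)).1 h2)

theorem supp_run_sweepProg {n U C : ℕ} {B : ℕ → ℕ → Prop} {s : Mem} (hs : s.HasGraph n B)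
    (hr : ∀ u, B u u) (hsymm : ∀ u v, B u v → B v u) (hU : 50 ≤ U) (hC : 50 ≤ C) (hUC : U ≠ C)
    (hcl : IsCluster B (s.supp n C)) :
    (((sweepProg U C).run s).supp n C : Set ℕ) = sweep B (s.supp n U) (s.supp n C) n := by
  refine run_for hs.size
    (fun i u => (u.supp n C : Set ℕ) = sweep B (s.supp n U) (s.supp n C) i) ?_ ?_
  · rw [Mem.supp_congr (Mem.nat_setNat_of_ne _ _ _ (by omega))]
    rfl
  intro i hi u hui hf _ hI
  have hf' : ∀ A, A ≠ 7 → A ≠ 20 → A ≠ 21 → A ≠ 22 → A ≠ C → u.nat A = s.nat A := by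
    intro A h1 h2 h3 h4 h5
    exact hf A (by simp [natWrites, h1, h2, h3, h4, h5])
  have hu : u.HasGraph n B := hs.congr (hf' 0 (by omega) (by omega) (by omega) (by omega) (by omega))
    (hf' 1 (by omega) (by omega) (by omega) (by omega) (by omega))
    (hf' 4 (by omega) (by omega) (by omega) (by omega) (by omega))
  have hUu : u.nat U = s.nat U :=
    hf' U (by omega) (by omega) (by omega) (by omega) (by omega)
  have hmemC : ∀ x, x ∈ sweep B (s.supp n U) (s.supp n C) i ↔ x < n ∧ u.nat C x ≠ 0 := by
    intro x
    rw [← hI, mem_coe, Mem.mem_supp]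
  have hcli : IsCluster B (sweep B (s.supp n U) (s.supp n C) i) := hcl.sweep i
  rw [Mem.supp_congr (Mem.nat_setNat_of_ne _ _ _ (by omega))]
  by_cases hiU : u.nat U i = 0
  · rw [run_cond_neg (by rw [Test.holds_nz]; simpa [NatExp.eval, hui] using hiU), run_skip, hI]
    ext x
    refine ⟨fun hx => .inl hx, fun hx => hx.elim id fun h => ?_⟩
    exact absurd hiU (hUu ▸ (Mem.mem_supp.1 (mem_coe.1 h.2.1)).2)
  rw [run_cond_pos (by rw [Test.holds_nz]; simpa [NatExp.eval, hui] using hiU), run_seq, run_seq,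
    run_setNat]
  set u1 := u.setNat 7 ((NatExp.const 0).eval u) ((NatExp.const 1).eval u) with hu1
  have hu1' : ∀ A, A ≠ 7 → u1.nat A = u.nat A := fun A h => Mem.nat_setNat_of_ne _ _ _ h
  set q : LoopProg := .count 21 (.count 22 (.cond
          (.conj (.nz (.get C (.reg 21))) (.conj (.nz (.get C (.reg 22)))
            (.conj (.nz (.adj (.reg 20) (.reg 21)))
              (.neg (.natEq (.adj (.reg 20) (.reg 22)) (.adj (.reg 21) (.reg 22)))))))
          (.setNat 7 (.const 0) (.const 0)) .skip)) with hq
  have hqf : ∀ A, A ≠ 7 → A ≠ 21 → A ≠ 22 → (q.run u1).nat A = u.nat A := by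
    intro A h1 h2 h3
    rw [nat_run (by simp [hq, natWrites, h1, h2, h3]), hu1' A h1]
  have hflag : (q.run u1).nat 7 0 ≠ 0 ↔ IsCluster B (insert i (u.supp n C : Set ℕ)) := by
    rw [hI, isCluster_insert_iff hr hsymm hcli]
    rw [hq, run_for_check (n := n) (by rw [hu1' 0 (by omega), hu.size]) (by omega)
      (fun x => ∀ y < n, u.nat C x ≠ 0 → u.nat C y ≠ 0 → B i x → (B i y ↔ B x y))]
    · rw [hu1]
      simp only [hmemC]
      simp [NatExp.eval]
      grind
    · intro x hx v hvx hvf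
      rw [run_for_check (n := n) (by rw [hvf 0 (by simp [natWrites]), hu1' 0 (by omega), hu.size])
        (by omega) (fun y => u.nat C x ≠ 0 → u.nat C y ≠ 0 → B i x → (B i y ↔ B x y))]
      intro y hy v' hvy hvf'
      have hv' : ∀ A, A ≠ 7 → A ≠ 21 → A ≠ 22 → v'.nat A = u.nat A := by
        intro A h1 h2 h3
        rw [hvf' A (by simp [natWrites, h1, h3]), hvf A (by simp [natWrites, h1, h2, h3]),
          hu1' A h1]
      have hG : v'.HasGraph n B := hu.congr (hv' 0 (by omega) (by omega) (by omega))
        (hv' 1 (by omega) (by omega) (by omega)) (hv' 4 (by omega) (by omega) (by omega))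
      have e20 : (NatExp.reg 20).eval v' = i := by
        simp only [NatExp.eval, hv' 20 (by omega) (by omega) (by omega), hui]
      have e21 : (NatExp.reg 21).eval v' = x := by
        simp only [NatExp.eval, hvf' 21 (by simp [natWrites]), hvx]
      have e22 : (NatExp.reg 22).eval v' = y := by simp only [NatExp.eval, hvy]
      have a1 := hG.eval_adj (e := .reg 20) (f := .reg 21) (by omega) (by omega)
      have a2 := hG.eval_adj (e := .reg 20) (f := .reg 22) (by omega) (by omega)
      have a3 := hG.eval_adj (e := .reg 21) (f := .reg 22) (by omega) (by omega)
      have b2 := hG.eval_adj_le (e := .reg 20) (f := .reg 22) (by omega) (by omega)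
      have b3 := hG.eval_adj_le (e := .reg 21) (f := .reg 22) (by omega) (by omega)
      rw [e20, e21] at a1
      rw [e20, e22] at a2
      rw [e21, e22] at a3
      have hC' : v'.nat C = u.nat C := hv' C (by omega) (by omega) (by omega)
      have eC1 : (NatExp.get C (.reg 21)).eval v' = u.nat C x := by rw [NatExp.eval_get, e21, hC']
      have eC2 : (NatExp.get C (.reg 22)).eval v' = u.nat C y := by rw [NatExp.eval_get, e22, hC']
      have htest : (Test.conj (.nz (.get C (.reg 21))) (.conj (.nz (.get C (.reg 22)))
            (.conj (.nz (.adj (.reg 20) (.reg 21)))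
              (.neg (.natEq (.adj (.reg 20) (.reg 22)) (.adj (.reg 21) (.reg 22))))))).holds v' ↔
          ¬ (u.nat C x ≠ 0 → u.nat C y ≠ 0 → B i x → (B i y ↔ B x y)) := by
        rw [Test.holds_conj, Test.holds_conj, Test.holds_conj, Test.holds_neg, Test.holds_natEq,
          Test.holds_nz, Test.holds_nz, Test.holds_nz, a1, eC1, eC2, ← a2, ← a3]
        -- The matrix has entries `0` and `1`, so equal entries mean equivalent adjacencies.
        have : (NatExp.adj (.reg 20) (.reg 22)).eval v' = (NatExp.adj (.reg 21) (.reg 22)).eval v' ↔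
            ((NatExp.adj (.reg 20) (.reg 22)).eval v' ≠ 0 ↔
              (NatExp.adj (.reg 21) (.reg 22)).eval v' ≠ 0) := by omega
        rw [this]
        simp only [Classical.not_imp]
      by_cases ht : (Test.conj (.nz (.get C (.reg 21))) (.conj (.nz (.get C (.reg 22)))
            (.conj (.nz (.adj (.reg 20) (.reg 21)))
              (.neg (.natEq (.adj (.reg 20) (.reg 22)) (.adj (.reg 21) (.reg 22))))))).holds v'
      · rw [run_cond_pos ht, run_setNat]
        have := htest.1 ht
        simp [NatExp.eval, this]
      · rw [run_cond_neg ht, run_skip]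
        have := not_not.1 (mt htest.2 ht)
        exact ⟨fun h => ⟨h, this⟩, fun h => h.1⟩
  have h20 : (q.run u1).nat 20 0 = i := by
    rw [hqf 20 (by omega) (by omega) (by omega), hui]
  have hCq : (q.run u1).nat C = u.nat C := hqf C (by omega) (by omega) (by omega)
  by_cases hok : (q.run u1).nat 7 0 = 0
  · rw [run_cond_neg (by rw [Test.holds_nz]; simpa [NatExp.eval] using hok), run_skip,
      Mem.supp_congr hCq, hI]
    ext x
    refine ⟨fun hx => .inl hx, fun hx => hx.elim id fun h => ?_⟩
    rw [hI] at hflag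
    exact absurd hok (hflag.2 h.2.2)
  · rw [run_cond_pos (by rw [Test.holds_nz]; simpa [NatExp.eval] using hok), run_setNat]
    ext x
    simp only [mem_coe, Mem.mem_supp, sweep, Set.mem_ofPred_eq, hmemC, NatExp.eval, h20,
      Mem.nat_setNat_same, hCq]
    rw [hI] at hflag
    have := hflag.1 hok
    by_cases hxi : x = i
    · subst hxi
      simp only [if_true]
      rw [hUu] at hiU
      exact ⟨fun _ => .inr ⟨trivial, ⟨hi, hiU⟩, this⟩, fun _ => ⟨hi, one_ne_zero⟩⟩
    · simp [hxi]

end LoopProg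

/-! ### Elementwise updates and the decoding of certificates -/

namespace LoopProg

/-- For `i = 0, …, n - 1`, assign the value of `e` or of `f` to entry `i` of the array `C`, according
to the test `b`. -/
def mapProg (C : ℕ) (b : Test) (e f : NatExp) : LoopProg :=
  .count 20 (.cond b (.setNat C (.reg 20) e) (.setNat C (.reg 20) f))

theorem natWrites_mapProg (C : ℕ) (b : Test) (e f : NatExp) :
    (mapProg C b e f).natWrites = {20, C} := by
  simp [mapProg, natWrites]

/-- In round `i` the entry `i` of `C` still has its old value, so the new value may depend on it and
arrays can be updated in place. -/
theorem nat_run_mapProg {n C : ℕ} {b : Test} {e f : NatExp} {s : Mem} (hn : s.nat 0 0 = n)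
    (hC : C ≠ 20) (val : ℕ → ℕ)
    (h : ∀ i < n, ∀ u : Mem, u.nat 20 0 = i → (∀ A, A ≠ 20 → A ≠ C → u.nat A = s.nat A) →
      u.rat = s.rat → u.nat C i = s.nat C i →
      (b.holds u → e.eval u = val i) ∧ (¬ b.holds u → f.eval u = val i)) :
    ∀ j < n, ((mapProg C b e f).run s).nat C j = val j := by
  have key := run_for (p := .cond b (.setNat C (.reg 20) e) (.setNat C (.reg 20) f)) hn
    (fun i u => ∀ j, u.nat C j = if j < i then val j else s.nat C j) (x := 20) ?_ ?_
  · intro j hj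
    exact (key j).trans (if_pos hj)
  · intro j
    rw [Mem.nat_setNat_of_ne _ _ _ hC]
    simp
  · intro i hi u hu hf hfr hI j
    have h' := h i hi u hu (fun A h1 h2 => hf A (by simp [natWrites, h1, h2]))
      (funext fun A => hfr A (by simp [ratWrites])) (by rw [hI, if_neg (lt_irrefl i)])
    rw [Mem.nat_setNat_of_ne _ _ _ hC]
    have hval : (run (.cond b (.setNat C (.reg 20) e) (.setNat C (.reg 20) f)) u).nat C j =
        if j = i then val i else u.nat C j := by
      have h20 : (NatExp.reg 20).eval u = i := hu
      by_cases hb : b.holds u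
      · rw [run_cond_pos hb, run_setNat, Mem.nat_setNat_same, h20, h'.1 hb]
      · rw [run_cond_neg hb, run_setNat, Mem.nat_setNat_same, h20, h'.2 hb]
    rw [hval, hI]
    by_cases hji : j = i
    · simp [hji]
    · have : j < i + 1 ↔ j < i := by omega
      simp [hji, this]

/-- Reset entries `0, …, n - 1` of array `C` to `c`. -/
def fillProg (C c : ℕ) : LoopProg := mapProg C (.natLE (.const 0) (.const 0)) (.const c) (.const c)

theorem nat_run_fillProg {n C c : ℕ} {s : Mem} (hn : s.nat 0 0 = n) (hC : C ≠ 20) :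
    ∀ j < n, ((fillProg C c).run s).nat C j = c :=
  nat_run_mapProg hn hC (fun _ => c) fun _ _ _ _ _ _ _ => ⟨fun _ => rfl, fun _ => rfl⟩

/-- The program computes `residualSet`; the vertices are in the registers `v`, `x`, `y`. -/
def residualProg (V U v x y : ℕ) : LoopProg :=
  mapProg V (.conj (.nz (.get U (.reg 20))) (.conj (.neg (.natLE (.reg v) (.reg 20)))
    (.conj (.neg (.nz (.adj (.reg 20) (.reg v)))) (.conj (.neg (.nz (.adj (.reg 20) (.reg x))))
      (.neg (.nz (.adj (.reg 20) (.reg y)))))))) (.const 1) (.const 0)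

theorem supp_run_residualProg {n V U v x y : ℕ} {B : ℕ → ℕ → Prop} {s : Mem}
    (hs : s.HasGraph n B) (hV : 50 ≤ V) (hU : 50 ≤ U) (hUV : U ≠ V) (hv : 50 ≤ v) (hvV : v ≠ V)
    (hx : 50 ≤ x) (hxV : x ≠ V) (hy : 50 ≤ y) (hyV : y ≠ V) (hvn : s.nat v 0 < n)
    (hxn : s.nat x 0 < n) (hyn : s.nat y 0 < n) :
    (((residualProg V U v x y).run s).supp n V : Set ℕ) =
      residualSet B (s.supp n U) (s.nat v 0) (s.nat x 0) (s.nat y 0) := by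
  classical
  have h := nat_run_mapProg (C := V) hs.size (by omega)
    (fun i => if i ∈ residualSet B (s.supp n U) (s.nat v 0) (s.nat x 0) (s.nat y 0) then 1 else 0)
    (b := .conj (.nz (.get U (.reg 20))) (.conj (.neg (.natLE (.reg v) (.reg 20)))
    (.conj (.neg (.nz (.adj (.reg 20) (.reg v)))) (.conj (.neg (.nz (.adj (.reg 20) (.reg x))))
      (.neg (.nz (.adj (.reg 20) (.reg y)))))))) (e := .const 1) (f := .const 0) ?_
  · ext j
    rw [mem_coe, Mem.mem_supp]
    by_cases hj : j < n
    · rw [residualProg, h j hj]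
      simp [hj]
    · refine ⟨fun h => absurd h.1 hj, fun h => absurd (Mem.mem_supp.1 (mem_coe.1 h.1)).1 hj⟩
  · intro i hi u hu hf _ _
    have hG : u.HasGraph n B := hs.congr (hf 0 (by omega) (by omega)) (hf 1 (by omega) (by omega))
      (hf 4 (by omega) (by omega))
    have e20 : (NatExp.reg 20).eval u = i := hu
    have ev : (NatExp.reg v).eval u = s.nat v 0 := by
      simp only [NatExp.eval, hf v (by omega) hvV]
    have ex : (NatExp.reg x).eval u = s.nat x 0 := by
      simp only [NatExp.eval, hf x (by omega) hxV]
    have ey : (NatExp.reg y).eval u = s.nat y 0 := by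
      simp only [NatExp.eval, hf y (by omega) hyV]
    have eU : (NatExp.get U (.reg 20)).eval u = s.nat U i := by
      rw [NatExp.eval_get, e20, hf U (by omega) hUV]
    have a1 := hG.eval_adj (e := .reg 20) (f := .reg v) (by omega) (by omega)
    have a2 := hG.eval_adj (e := .reg 20) (f := .reg x) (by omega) (by omega)
    have a3 := hG.eval_adj (e := .reg 20) (f := .reg y) (by omega) (by omega)
    rw [e20, ev] at a1
    rw [e20, ex] at a2
    rw [e20, ey] at a3
    have hle : (Test.natLE (.reg v) (.reg 20)).holds u ↔ s.nat v 0 ≤ i := by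
      simp only [Test.holds, ev, e20]
    simp only [Test.holds_conj, Test.holds_neg, Test.holds_nz, hle, a1, a2, a3, eU, residualSet,
      Set.mem_ofPred_eq, mem_coe, Mem.mem_supp, hi, true_and, not_le, NatExp.eval_const]
    exact ⟨fun h => (if_pos h).symm, fun h => (if_neg h).symm⟩

/-- The program computes `isolate`; the vertex is in register `a`. -/
def isolateProg (C a : ℕ) : LoopProg :=
  .seq (mapProg C (.nz (.adj (.reg 20) (.reg a))) (.const 0) (.get C (.reg 20)))
    (.setNat C (.reg a) (.const 1))

theorem nat_run_isolateProg {C a A : ℕ} (hA : A ≠ 20) (hAC : A ≠ C) (s : Mem) :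
    ((isolateProg C a).run s).nat A = s.nat A :=
  nat_run (by simp [isolateProg, natWrites, natWrites_mapProg, hA, hAC]) s

theorem supp_run_isolateProg {n C a : ℕ} {B : ℕ → ℕ → Prop} {s : Mem}
    (hs : s.HasGraph n B) (hC : 50 ≤ C) (ha : 50 ≤ a) (haC : a ≠ C)
    (han : s.nat a 0 < n) :
    (((isolateProg C a).run s).supp n C : Set ℕ) = isolate B (s.nat a 0) (s.supp n C) := by
  classical
  have h := nat_run_mapProg (C := C) hs.size (by omega)
    (fun i => if B i (s.nat a 0) then 0 else s.nat C i)
    (b := .nz (.adj (.reg 20) (.reg a))) (e := .const 0) (f := .get C (.reg 20)) ?_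
  · ext j
    rw [mem_coe, Mem.mem_supp, isolateProg, run_seq, run_setNat, Mem.nat_setNat_same]
    have ea : (NatExp.reg a).eval ((mapProg C (.nz (.adj (.reg 20) (.reg a))) (.const 0)
        (.get C (.reg 20))).run s) = s.nat a 0 := by
      simp only [NatExp.eval]
      rw [nat_run]
      simp only [natWrites_mapProg, mem_insert, mem_singleton]
      omega
    rw [ea]
    simp only [isolate, Set.mem_ofPred_eq, mem_coe, Mem.mem_supp, NatExp.eval_const]
    by_cases hja : j = s.nat a 0
    · simp [hja, han]
    · by_cases hj : j < n
      · rw [h j hj]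
        simp [hja, hj, and_comm]
      · simp [hja, hj]
  · intro i hi u hu hf _ hCi
    have hG : u.HasGraph n B := hs.congr (hf 0 (by omega) (by omega)) (hf 1 (by omega) (by omega))
      (hf 4 (by omega) (by omega))
    have e20 : (NatExp.reg 20).eval u = i := hu
    have ea : (NatExp.reg a).eval u = s.nat a 0 := by
      simp only [NatExp.eval, hf a (by omega) haC]
    have a1 := hG.eval_adj (e := .reg 20) (f := .reg a) (by omega) (by omega)
    rw [e20, ea] at a1
    have eC : (NatExp.get C (.reg 20)).eval u = s.nat C i := by
      rw [NatExp.eval_get, e20, hCi]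
    simp only [Test.holds_nz, a1, eC]
    exact ⟨fun h => (if_pos h).symm, fun h => (if_neg h).symm⟩

/-- The array for the cluster of color `c`. -/
def clusterArr (c : ℕ) : ℕ := 100 + 3 * c

/-- The array for the vertex set at level `m` of the decoding of a certificate. -/
def levelArr (m : ℕ) : ℕ := 101 + 3 * m

/-- The register for the entry `d` of the certificates. -/
def digitArr (d : ℕ) : ℕ := 102 + 3 * d

/-- The certificate in memory, from entry `β` on. -/
def _root_.Mem.digits (β : ℕ) (s : Mem) (d : ℕ) : ℕ := s.nat (digitArr (β + d)) 0

/-- The program computes `decode`, for a certificate with `m` levels that begins at entry `β`. -/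
def decodeProg (C β : ℕ) : ℕ → LoopProg
  | 0 => .seq (fillProg C 0) (sweepProg (levelArr 0) C)
  | m + 1 =>
    .seq
      (.cond (.natEq (.reg (digitArr (β + 5 * m))) (.reg (digitArr (β + (5 * m + 1)))))
        (mapProg (levelArr m) (.natLE (.const 0) (.const 0)) (.get (levelArr (m + 1)) (.reg 20))
          (.get (levelArr (m + 1)) (.reg 20)))
        (residualProg (levelArr m) (levelArr (m + 1)) (digitArr (β + 5 * m))
          (digitArr (β + (5 * m + 1))) (digitArr (β + (5 * m + 2)))))
      (.seq (decodeProg C β m)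
        (.seq
          (.cond (.natEq (.reg (digitArr (β + 5 * m))) (.reg (digitArr (β + (5 * m + 1)))))
            .skip
            (.seq (isolateProg C (digitArr (β + 5 * m)))
              (.seq (isolateProg C (digitArr (β + (5 * m + 3))))
                (isolateProg C (digitArr (β + (5 * m + 4)))))))
          (sweepProg (levelArr (m + 1)) C)))

theorem natWrites_decodeProg {C β m A : ℕ} (hA : A ∈ (decodeProg C β m).natWrites) :
    A = C ∨ A ∈ ({7, 20, 21, 22} : Finset ℕ) ∨ ∃ j < m, A = levelArr j := by
  induction m with
  | zero =>
    simp only [decodeProg, natWrites, fillProg, natWrites_mapProg, sweepProg, mem_union, mem_insert,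
      mem_singleton, notMem_empty] at hA ⊢
    tauto
  | succ m ih =>
    have : A ∈ (decodeProg C β m).natWrites ∨ A = C ∨ A ∈ ({7, 20, 21, 22} : Finset ℕ) ∨
        A = levelArr m := by
      simp only [decodeProg, natWrites, natWrites_mapProg, residualProg, isolateProg, sweepProg,
        mem_union, mem_insert, mem_singleton, notMem_empty] at hA ⊢
      tauto
    rcases this with h | h | h | h
    · rcases ih h with h | h | ⟨j, hj, h⟩
      exacts [.inl h, .inr (.inl h), .inr (.inr ⟨j, by omega, h⟩)]
    · exact .inl h
    · exact .inr (.inl h)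
    · exact .inr (.inr ⟨m, by omega, h⟩)

theorem nat_run_decodeProg {C β m A : ℕ} (h1 : A ≠ C)
    (h2 : A ∉ ({7, 20, 21, 22} : Finset ℕ)) (h3 : ∀ j < m, A ≠ levelArr j) (s : Mem) :
    ((decodeProg C β m).run s).nat A = s.nat A := by
  refine nat_run (fun h => ?_) s
  rcases natWrites_decodeProg h with h | h | ⟨j, hj, h⟩
  exacts [h1 h, h2 h, h3 j hj h]

/-- A single recursive call suffices, because the seed of level `m + 1` is built from `decode` with
`m` levels, on the same or on the residual vertex set. Arrays for clusters, levels and digits have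
indices in different residue classes modulo 3, so they do not interfere. -/
theorem supp_run_decodeProg {n c β m : ℕ} {B : ℕ → ℕ → Prop} {s : Mem} (hs : s.HasGraph n B)
    (hr : ∀ u, B u u) (hsymm : ∀ u v, B u v → B v u) (hd : ∀ d < 5 * m, s.digits β d < n) :
    (((decodeProg (clusterArr c) β m).run s).supp n (clusterArr c) : Set ℕ) =
      decode B n (s.digits β) m (s.supp n (levelArr m)) := by
  induction m generalizing s with
  | zero =>
    set s1 := (fillProg (clusterArr c) 0).run s with hs1
    have hf : ∀ A, A ≠ 20 → A ≠ clusterArr c → s1.nat A = s.nat A := fun A h1 h2 =>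
      nat_run (by simp [fillProg, natWrites_mapProg, h1, h2]) s
    have hG : s1.HasGraph n B := by
      have h100 : 100 ≤ clusterArr c := Nat.le_add_right 100 (3 * c)
      refine hs.congr (hf _ ?_ ?_) (hf _ ?_ ?_) (hf _ ?_ ?_) <;> omega
    have h0 : s1.supp n (clusterArr c) = ∅ := by
      ext v
      simp only [Mem.mem_supp, notMem_empty, iff_false, not_and, not_not]
      exact nat_run_fillProg hs.size (by simp only [clusterArr]; omega) v
    rw [decodeProg, run_seq, ← hs1, supp_run_sweepProg hG hr hsymm (by simp only [levelArr]; omega)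
      (by simp only [clusterArr]; omega) (by simp only [levelArr, clusterArr]; omega)
      (by rw [h0]; intro x hx; simp at hx), h0,
      Mem.supp_congr (hf _ (by simp only [levelArr]; omega)
        (by simp only [levelArr, clusterArr]; omega)), decode, seed]
    simp
  | succ m ih =>
    have hdig : ∀ p q, digitArr p ≠ clusterArr q ∧ digitArr p ≠ levelArr q ∧
        clusterArr p ≠ levelArr q := by
      simp only [digitArr, clusterArr, levelArr]
      omega
    have hinj : ∀ p q, levelArr p = levelArr q → p = q := by
      simp only [levelArr]
      omega
    have h50 : ∀ p, 100 ≤ clusterArr p ∧ 100 ≤ levelArr p ∧ 100 ≤ digitArr p := by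
      simp only [digitArr, clusterArr, levelArr]
      omega
    set v := digitArr (β + 5 * m) with hv
    set x := digitArr (β + (5 * m + 1)) with hx
    set y := digitArr (β + (5 * m + 2)) with hy
    set a := digitArr (β + (5 * m + 3)) with ha
    set b := digitArr (β + (5 * m + 4)) with hb
    set p1 : LoopProg := .cond (.natEq (.reg v) (.reg x))
        (mapProg (levelArr m) (.natLE (.const 0) (.const 0)) (.get (levelArr (m + 1)) (.reg 20))
          (.get (levelArr (m + 1)) (.reg 20)))
        (residualProg (levelArr m) (levelArr (m + 1)) v x y) with hp1
    set p3 : LoopProg := .cond (.natEq (.reg v) (.reg x)) .skip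
        (.seq (isolateProg (clusterArr c) v)
          (.seq (isolateProg (clusterArr c) a) (isolateProg (clusterArr c) b))) with hp3
    have hprog : decodeProg (clusterArr c) β (m + 1) = .seq p1 (.seq (decodeProg (clusterArr c) β m)
      (.seq p3 (sweepProg (levelArr (m + 1)) (clusterArr c)))) := rfl
    set s1 := p1.run s with hs1
    set s2 := (decodeProg (clusterArr c) β m).run s1 with hs2
    set s3 := p3.run s2 with hs3
    rw [hprog, run_seq, run_seq, run_seq]
    have hf1 : ∀ A, A ≠ 20 → A ≠ levelArr m → s1.nat A = s.nat A := fun A h1 h2 =>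
      nat_run (by simp [hp1, natWrites, residualProg, natWrites_mapProg, h1, h2]) s
    have hf2 : ∀ A, A ≠ clusterArr c → A ∉ ({7, 20, 21, 22} : Finset ℕ) →
        (∀ j < m, A ≠ levelArr j) → s2.nat A = s1.nat A := fun A h1 h2 h3 =>
      nat_run_decodeProg h1 h2 h3 s1
    have hf3 : ∀ A, A ≠ 20 → A ≠ clusterArr c → s3.nat A = s2.nat A := fun A h1 h2 =>
      nat_run (by simp [hp3, natWrites, isolateProg, natWrites_mapProg, h1, h2]) s2
    have hsmall : ∀ A, A < 7 → s1.nat A = s.nat A ∧ s2.nat A = s1.nat A ∧ s3.nat A = s2.nat A := by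
      intro A hA
      have h1 := h50 c
      refine ⟨hf1 A (by omega) (by have := h50 m; omega), hf2 A (by omega) ?_
        (fun j _ => by have := h50 j; omega), hf3 A (by omega) (by omega)⟩
      simp only [mem_insert, mem_singleton]
      omega
    have hG1 : s1.HasGraph n B := hs.congr (hsmall 0 (by omega)).1 (hsmall 1 (by omega)).1
      (hsmall 4 (by omega)).1
    have hG2 : s2.HasGraph n B := hG1.congr (hsmall 0 (by omega)).2.1 (hsmall 1 (by omega)).2.1
      (hsmall 4 (by omega)).2.1
    have hG3 : s3.HasGraph n B := hG2.congr (hsmall 0 (by omega)).2.2 (hsmall 1 (by omega)).2.2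
      (hsmall 4 (by omega)).2.2
    have hD1 : ∀ d, s1.nat (digitArr d) = s.nat (digitArr d) := fun d =>
      hf1 _ (by have := h50 d; omega) (hdig _ _).2.1
    have hD2 : ∀ d, s2.nat (digitArr d) = s.nat (digitArr d) := fun d => by
      rw [hf2 _ (hdig _ _).1 (by
        have := h50 d
        simp only [mem_insert, mem_singleton]
        omega) (fun j _ => (hdig _ _).2.1), hD1]
    have hdigits : s1.digits β = s.digits β := funext fun d => by
      rw [Mem.digits, hD1, Mem.digits]
    have hL3 : s3.nat (levelArr (m + 1)) = s.nat (levelArr (m + 1)) := by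
      have h1 := h50 (m + 1)
      rw [hf3 _ (by omega) (hdig _ _).2.2.symm, hf2 _ (hdig _ _).2.2.symm _ (fun j hj h => by
        have := hinj _ _ h; omega), hf1 _ (by omega) (fun h => by have := hinj _ _ h; omega)]
      simp only [mem_insert, mem_singleton]
      omega
    have ih' := ih hG1 (by rw [hdigits]; exact fun d h => hd d (by omega))
    rw [← hs2, hdigits] at ih'
    have hseed : (s3.supp n (clusterArr c) : Set ℕ) =
        seed B n (s.digits β) (m + 1) (s.supp n (levelArr (m + 1))) := by
      have e1 : s.digits β (5 * m) = s.nat v 0 := rfl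
      have e2 : s.digits β (5 * m + 1) = s.nat x 0 := rfl
      have e3 : s.digits β (5 * m + 2) = s.nat y 0 := rfl
      have e4 : s.digits β (5 * m + 3) = s.nat a 0 := rfl
      have e5 : s.digits β (5 * m + 4) = s.nat b 0 := rfl
      have hv2 : s2.nat v = s.nat v := hD2 _
      have hx2 : s2.nat x = s.nat x := hD2 _
      have ha2 : s2.nat a = s.nat a := hD2 _
      have hb2 : s2.nat b = s.nat b := hD2 _
      have hc100 := h50 c
      rw [seed, e1, e2, e3, e4, e5]
      by_cases hvx : s.nat v 0 = s.nat x 0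
      · rw [if_pos hvx]
        have ht : (Test.natEq (.reg v) (.reg x)).holds s := by
          rw [Test.holds_natEq]
          exact hvx
        have ht2 : (Test.natEq (.reg v) (.reg x)).holds s2 := by
          rw [Test.holds_natEq]
          simpa only [NatExp.eval, hv2, hx2] using hvx
        rw [hs3, hp3, run_cond_pos ht2, run_skip, ih', decode]
        -- An inactive level: the vertex set is copied unchanged to the next level.
        have : s1.supp n (levelArr m) = s.supp n (levelArr (m + 1)) := by
          have hval : ∀ j < n, s1.nat (levelArr m) j = s.nat (levelArr (m + 1)) j := by
            have hm := h50 m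
            have hm1 := h50 (m + 1)
            rw [hs1, hp1, run_cond_pos ht]
            refine nat_run_mapProg hs.size (by omega) _ fun i hi u hu hf _ _ => ?_
            have : (NatExp.get (levelArr (m + 1)) (.reg 20)).eval u = s.nat (levelArr (m + 1)) i := by
              simp only [NatExp.eval, hu]
              rw [hf _ (by omega) (fun h => by have := hinj _ _ h; omega)]
            exact ⟨fun _ => this, fun _ => this⟩
          ext j
          simp only [Mem.mem_supp]
          exact and_congr_right fun hj => by rw [hval j hj]
        rw [this]
      · rw [if_neg hvx]
        have ht : ¬ (Test.natEq (.reg v) (.reg x)).holds s := by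
          rw [Test.holds_natEq]
          exact hvx
        have ht2 : ¬ (Test.natEq (.reg v) (.reg x)).holds s2 := by
          rw [Test.holds_natEq]
          simpa only [NatExp.eval, hv2, hx2] using hvx
        have hm := h50 m
        have hm1 := h50 (m + 1)
        have hv' := h50 (β + 5 * m)
        have hx' := h50 (β + (5 * m + 1))
        have hy' := h50 (β + (5 * m + 2))
        have ha' := h50 (β + (5 * m + 3))
        have hb' := h50 (β + (5 * m + 4))
        have hlev : (s1.supp n (levelArr m) : Set ℕ) = residualSet B (s.supp n (levelArr (m + 1)))
            (s.nat v 0) (s.nat x 0) (s.nat y 0) := by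
          rw [hs1, hp1, run_cond_neg ht]
          exact supp_run_residualProg hs (by omega) (by omega)
            (fun h => by have := hinj _ _ h; omega) (by omega) (hdig _ _).2.1 (by omega)
            (hdig _ _).2.1 (by omega) (hdig _ _).2.1 (hd (5 * m) (by omega))
            (hd (5 * m + 1) (by omega)) (hd (5 * m + 2) (by omega))
        have hiso : ∀ (u : Mem) (d : ℕ), u.HasGraph n B → u.nat (digitArr d) 0 < n →
            (((isolateProg (clusterArr c) (digitArr d)).run u).supp n (clusterArr c) : Set ℕ) =
              isolate B (u.nat (digitArr d) 0) (u.supp n (clusterArr c)) ∧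
            ((isolateProg (clusterArr c) (digitArr d)).run u).HasGraph n B ∧
            ∀ d', ((isolateProg (clusterArr c) (digitArr d)).run u).nat (digitArr d') =
              u.nat (digitArr d') := by
          intro u d hu hun
          have hd100 := h50 d
          refine ⟨supp_run_isolateProg hu (by omega) (by omega) (hdig _ _).1 hun, hu.congr ?_ ?_ ?_,
            fun d' => nat_run_isolateProg (by have := h50 d'; omega) (hdig _ _).1 u⟩
          all_goals exact nat_run_isolateProg (by omega) (by omega) u
        obtain ⟨i1, j1, k1⟩ := hiso s2 (β + 5 * m) hG2 (by rw [hD2]; exact hd (5 * m) (by omega))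
        obtain ⟨i2, j2, k2⟩ := hiso _ (β + (5 * m + 3)) j1
          (by rw [k1, hD2]; exact hd (5 * m + 3) (by omega))
        obtain ⟨i3, j3, k3⟩ := hiso _ (β + (5 * m + 4)) j2
          (by rw [k2, k1, hD2]; exact hd (5 * m + 4) (by omega))
        rw [hs3, hp3, run_cond_neg ht2, run_seq, run_seq, i3, i2, i1, k2, k1, k1, hD2, hD2, hD2, ih',
          hlev]
        rfl
    rw [supp_run_sweepProg hG3 hr hsymm (by have := h50 (m + 1); omega) (by have := h50 c; omega)
      (hdig _ _).2.2.symm (by rw [hseed]; exact IsCluster.seed hsymm _ _ _ _), hseed,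
      Mem.supp_congr hL3]
    rfl

end LoopProg

/-! ## Programs for the matching -/

namespace LoopProg

/-- The programs `f 0`, …, `f (r - 1)` in turn. -/
def unroll (f : ℕ → LoopProg) : ℕ → LoopProg
  | 0 => .skip
  | r + 1 => .seq (unroll f r) (f r)

theorem natWrites_unroll {f : ℕ → LoopProg} {r A : ℕ} (h : ∀ c < r, A ∉ (f c).natWrites) :
    A ∉ (unroll f r).natWrites := by
  induction r with
  | zero => simp [unroll, natWrites]
  | succ r ih =>
    simp only [unroll, natWrites, mem_union, not_or]
    exact ⟨ih fun c hc => h c (by omega), h r (by omega)⟩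

end LoopProg

theorem Mem.card_supp_le (n A : ℕ) (s : Mem) : (s.supp n A).card ≤ n :=
  (card_le_card (filter_subset _ _)).trans_eq (card_range n)

/-- The data of the problem that are fixed during a computation. -/
structure Mem.MatchEnv (n r : ℕ) (B Al : ℕ → ℕ → Prop) (s : Mem) : Prop where
  graph : s.HasGraph n B
  allowed : ∀ v < n, ∀ x, Al v x ↔ ∃ c < r, x = c + 1 ∧ s.nat (LoopProg.clusterArr c) v ≠ 0

theorem Mem.MatchEnv.congr {n r : ℕ} {B Al : ℕ → ℕ → Prop} {s s' : Mem} (h : s.MatchEnv n r B Al)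
    (h' : ∀ A, A < 7 ∨ 100 ≤ A → s'.nat A = s.nat A) : s'.MatchEnv n r B Al := by
  refine ⟨h.graph.congr (h' 0 (by omega)) (h' 1 (by omega)) (h' 4 (by omega)), fun v hv x => ?_⟩
  rw [h.allowed v hv]
  simp only [h' _ (.inr (Nat.le_add_right 100 (3 * _))), LoopProg.clusterArr]

/-- Arrays `9` and `10` hold a search tree with root `p`; if register `14` holds a nonzero color,
then this color is free at the vertex in register `13`. -/
structure Mem.Searching (n : ℕ) (B Al : ℕ → ℕ → Prop) (col : ℕ → ℕ) (p : ℕ) (s : Mem) : Prop where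
  tree : ∃ d, IsSearchTree n B Al col p (s.supp n 9) (s.nat 10) d
  found : s.nat 14 0 ≠ 0 → s.nat 13 0 ∈ s.supp n 9 ∧ Al (s.nat 13 0) (s.nat 14 0) ∧
    ∀ x < n, col x = s.nat 14 0 → ¬ B x (s.nat 13 0)

theorem Mem.Searching.congr {n : ℕ} {B Al : ℕ → ℕ → Prop} {col : ℕ → ℕ} {p : ℕ} {s s' : Mem}
    (h : s.Searching n B Al col p) (h9 : s'.nat 9 = s.nat 9) (h10 : s'.nat 10 = s.nat 10)
    (h13 : s'.nat 13 = s.nat 13) (h14 : s'.nat 14 = s.nat 14) : s'.Searching n B Al col p := by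
  obtain ⟨a, b⟩ := h
  exact ⟨by rwa [Mem.supp_congr h9, h10], by rwa [Mem.supp_congr h9, h13, h14]⟩

/-- The search has been continued from the memory `s` to the memory `s'`. -/
structure Mem.Progress (n : ℕ) (B Al : ℕ → ℕ → Prop) (col : ℕ → ℕ) (p : ℕ) (s s' : Mem) :
    Prop where
  searching : s'.Searching n B Al col p
  subset : s.supp n 9 ⊆ s'.supp n 9
  found : s.nat 14 0 ≠ 0 → s'.nat 14 0 ≠ 0

theorem Mem.Progress.congr {n : ℕ} {B Al : ℕ → ℕ → Prop} {col : ℕ → ℕ} {p : ℕ} {s s' s'' : Mem}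
    (h : s.Progress n B Al col p s') (h9 : s''.nat 9 = s'.nat 9) (h10 : s''.nat 10 = s'.nat 10)
    (h13 : s''.nat 13 = s'.nat 13) (h14 : s''.nat 14 = s'.nat 14) :
    s.Progress n B Al col p s'' :=
  ⟨h.searching.congr h9 h10 h13 h14, by rw [Mem.supp_congr h9]; exact h.subset,
    by rw [h14]; exact h.found⟩

theorem Mem.Progress.trans {n : ℕ} {B Al : ℕ → ℕ → Prop} {col : ℕ → ℕ} {p : ℕ} {s s' s'' : Mem}
    (h : s.Progress n B Al col p s') (h' : s'.Progress n B Al col p s'') :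
    s.Progress n B Al col p s'' :=
  ⟨h'.searching, h.subset.trans h'.subset, fun h0 => h'.found (h.found h0)⟩

/-- The color `x` at `v` is blocked by a vertex in the search tree. -/
def Mem.Blocked (n : ℕ) (B : ℕ → ℕ → Prop) (col : ℕ → ℕ) (s : Mem) (v x : ℕ) : Prop :=
  ∃ y ∈ s.supp n 9, col y = x ∧ B y v

theorem Mem.Blocked.mono {n : ℕ} {B : ℕ → ℕ → Prop} {col : ℕ → ℕ} {s s' : Mem} {v x : ℕ}
    (h : s.Blocked n B col v x) (hs : s.supp n 9 ⊆ s'.supp n 9) : s'.Blocked n B col v x := by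
  obtain ⟨y, hy, h⟩ := h
  exact ⟨y, hs hy, h⟩

/-! ### Search for augmenting paths and the greedy program -/

namespace LoopProg

/-- Visit the vertices that block the color `c + 1` at the vertex in register `22`; if there are
none, record that the color is free. -/
def scanProg (c : ℕ) : LoopProg :=
  .seq (.setNat 16 (.const 0) (.const 0))
    (.seq
      (.count 23 (.cond
        (.conj (.natEq (.get 8 (.reg 23)) (.const (c + 1))) (.nz (.adj (.reg 23) (.reg 22))))
        (.seq (.setNat 16 (.const 0) (.const 1))
          (.cond (.nz (.get 9 (.reg 23))) .skip
            (.seq (.setNat 9 (.reg 23) (.const 1)) (.setNat 10 (.reg 23) (.reg 22)))))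
        .skip))
      (.cond (.nz (.reg 16)) .skip
        (.seq (.setNat 13 (.const 0) (.reg 22)) (.setNat 14 (.const 0) (.const (c + 1))))))

theorem supp_setNat_one {n A v : ℕ} (s : Mem) (hv : v < n) :
    (s.setNat A v 1).supp n A = insert v (s.supp n A) := by
  ext x
  simp only [Mem.mem_supp, Mem.nat_setNat_same, mem_insert]
  by_cases hx : x = v
  · simp [hx, hv]
  · simp [hx]

/-- The vertices that hold the color `c + 1` next to `v` are its blockers, and join the tree as
children of `v`. If register 16 shows that none was met, the color is free at `v`, where an
augmenting path ends. -/
theorem run_scanProg {n r c p v : ℕ} {B Al : ℕ → ℕ → Prop} {col : ℕ → ℕ} {s : Mem}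
    (hB : IsColorSystem B Al) (hs : s.MatchEnv n r B Al) (hcol : s.nat 8 = col)
    (hS : s.Searching n B Al col p) (hv : s.nat 22 0 = v) (hvis : v ∈ s.supp n 9)
    (hal : Al v (c + 1)) :
    s.Progress n B Al col p ((scanProg c).run s) ∧
      (((scanProg c).run s).nat 14 0 ≠ 0 ∨ ((scanProg c).run s).Blocked n B col v (c + 1)) := by
  have hvn : v < n := (Mem.mem_supp.1 hvis).1
  rw [scanProg, run_seq, run_seq]
  set s1 := (setNat 16 (.const 0) (.const 0)).run s with hs1
  have hs1' : ∀ A, A ≠ 16 → s1.nat A = s.nat A := fun A hA => Mem.nat_setNat_of_ne _ _ _ hA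
  set q : LoopProg := .count 23 (.cond
        (.conj (.natEq (.get 8 (.reg 23)) (.const (c + 1))) (.nz (.adj (.reg 23) (.reg 22))))
        (.seq (.setNat 16 (.const 0) (.const 1))
          (.cond (.nz (.get 9 (.reg 23))) .skip
            (.seq (.setNat 9 (.reg 23) (.const 1)) (.setNat 10 (.reg 23) (.reg 22)))))
        .skip) with hq
  have hqf : ∀ A, A ∉ ({9, 10, 16, 23} : Finset ℕ) → (q.run s1).nat A = s1.nat A := by
    intro A hA
    refine nat_run ?_ s1
    simp only [mem_insert, mem_singleton, not_or] at hA
    simp [hq, natWrites, hA]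
  have key : s.Progress n B Al col p (q.run s1) ∧
      ((q.run s1).nat 16 0 ≠ 0 → (q.run s1).Blocked n B col v (c + 1)) ∧
      ((q.run s1).nat 16 0 = 0 → ∀ x < n, ¬ (col x = c + 1 ∧ B x v)) := by
    refine run_for (n := n) (by rw [hs1' 0 (by omega), hs.graph.size]) (fun i u =>
      s.Progress n B Al col p u ∧ (u.nat 16 0 ≠ 0 → u.Blocked n B col v (c + 1)) ∧
      (u.nat 16 0 = 0 → ∀ x < i, ¬ (col x = c + 1 ∧ B x v))) ⟨?_, ?_, ?_⟩ ?_
    · have e : ∀ A, A ≠ 16 → A ≠ 23 → (s1.setNat 23 0 0).nat A = s.nat A := fun A h1 h2 => by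
        rw [Mem.nat_setNat_of_ne _ _ _ h2, hs1' A h1]
      exact ⟨hS.congr (e 9 (by omega) (by omega)) (e 10 (by omega) (by omega))
        (e 13 (by omega) (by omega)) (e 14 (by omega) (by omega)),
        by rw [Mem.supp_congr (e 9 (by omega) (by omega))], by
          rw [e 14 (by omega) (by omega)]; exact id⟩
    · rw [Mem.nat_setNat_of_ne _ _ _ (by omega)]
      simp [hs1, run_setNat, NatExp.eval]
    · simp
    · intro i hi u hui hf _ ⟨hP, hne, he⟩
      have hf' : ∀ A, A ∉ ({9, 10, 16, 23} : Finset ℕ) → u.nat A = s.nat A := by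
        intro A hA
        simp only [mem_insert, mem_singleton, not_or] at hA
        rw [hf A (by simp [natWrites, hA]), hs1' A hA.2.2.1]
      have hG : u.HasGraph n B := hs.graph.congr (hf' 0 (by simp)) (hf' 1 (by simp))
        (hf' 4 (by simp))
      have e22 : (NatExp.reg 22).eval u = v := by simp only [NatExp.eval, hf' 22 (by simp), hv]
      have e23 : (NatExp.reg 23).eval u = i := hui
      have a1 := hG.eval_adj (e := .reg 23) (f := .reg 22) (by omega) (by omega)
      rw [e22, e23] at a1
      have e8 : (NatExp.get 8 (.reg 23)).eval u = col i := by
        rw [NatExp.eval_get, e23, hf' 8 (by simp), hcol]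
      have htest : (Test.conj (.natEq (.get 8 (.reg 23)) (.const (c + 1)))
          (.nz (.adj (.reg 23) (.reg 22)))).holds u ↔ col i = c + 1 ∧ B i v := by
        rw [Test.holds_conj, Test.holds_natEq, Test.holds_nz, a1, e8, NatExp.eval_const]
      have hmono : ∀ w : Mem, (∀ A, A ≠ 23 → (w.setNat 23 0 (i + 1)).nat A = w.nat A) :=
        fun w A hA => Mem.nat_setNat_of_ne _ _ _ hA
      by_cases ht : col i = c + 1 ∧ B i v
      · rw [run_cond_pos (htest.2 ht), run_seq, run_setNat]
        set u1 := u.setNat 16 ((NatExp.const 0).eval u) ((NatExp.const 1).eval u) with hu1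
        have hu1' : ∀ A, A ≠ 16 → u1.nat A = u.nat A := fun A hA => Mem.nat_setNat_of_ne _ _ _ hA
        have hu16 : u1.nat 16 0 = 1 := by simp [hu1, NatExp.eval]
        have e23' : (NatExp.reg 23).eval u1 = i := by
          simp only [NatExp.eval, hu1' 23 (by omega), hui]
        by_cases h9 : u.nat 9 i = 0
        · rw [run_cond_neg (by
            rw [Test.holds_nz, NatExp.eval_get, e23', hu1' 9 (by omega)]
            simpa using h9), run_seq, run_setNat, run_setNat, e23', NatExp.eval_const]
          set u2 := u1.setNat 9 i 1 with hu2
          have hu2' : ∀ A, A ≠ 9 → u2.nat A = u1.nat A := fun A hA =>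
            Mem.nat_setNat_of_ne _ _ _ hA
          have e23'' : (NatExp.reg 23).eval u2 = i := by
            simp only [NatExp.eval, hu2' 23 (by omega), hu1' 23 (by omega), hui]
          have e22'' : (NatExp.reg 22).eval u2 = v := by
            simp only [NatExp.eval, hu2' 22 (by omega), hu1' 22 (by omega)]
            exact e22
          rw [e23'', e22'']
          set u3 := (u2.setNat 10 i v).setNat 23 0 (i + 1) with hu3
          have hu3' : ∀ A, A ≠ 23 → A ≠ 10 → u3.nat A = u2.nat A := fun A h1 h2 => by
            rw [hu3, Mem.nat_setNat_of_ne _ _ _ h1, Mem.nat_setNat_of_ne _ _ _ h2]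
          have hsupp : u3.supp n 9 = insert i (u.supp n 9) := by
            rw [Mem.supp_congr (hu3' 9 (by omega) (by omega)), hu2, supp_setNat_one _ hi,
              Mem.supp_congr (hu1' 9 (by omega))]
          have h10 : u3.nat 10 = Function.update (u.nat 10) i v := by
            ext x
            rw [hu3, Mem.nat_setNat_of_ne _ _ _ (by omega), Mem.nat_setNat_same,
              hu2' 10 (by omega), hu1' 10 (by omega), Function.update_apply]
          have h1314 : u3.nat 13 = u.nat 13 ∧ u3.nat 14 = u.nat 14 := by
            constructor <;> rw [hu3' _ (by omega) (by omega), hu2' _ (by omega), hu1' _ (by omega)]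
          have hsub : u.supp n 9 ⊆ u3.supp n 9 := hsupp ▸ subset_insert _ _
          obtain ⟨d, hd⟩ := hP.searching.tree
          refine ⟨⟨⟨⟨Function.update d i (u.supp n 9).card, ?_⟩, ?_⟩, hP.subset.trans hsub, ?_⟩,
            fun _ => ⟨i, ?_, ht⟩, fun h => ?_⟩
          · rw [hsupp, h10]
            exact hd.extend hB (hP.subset hvis) hi (fun h => (Mem.mem_supp.1 h).2 h9)
              (ht.1 ▸ hal) ht.2
          · rw [h1314.1, h1314.2]
            exact fun h => ⟨hsub (hP.searching.found h).1, (hP.searching.found h).2⟩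
          · rw [h1314.2]
            exact hP.found
          · rw [hsupp]
            exact mem_insert_self _ _
          · rw [hu3' 16 (by omega) (by omega), hu2' 16 (by omega), hu16] at h
            exact absurd h one_ne_zero
        · rw [run_cond_pos (by
            rw [Test.holds_nz, NatExp.eval_get, e23', hu1' 9 (by omega)]
            exact h9), run_skip]
          have e : ∀ A, A ≠ 16 → A ≠ 23 → (u1.setNat 23 0 (i + 1)).nat A = u.nat A :=
            fun A h1 h2 => by rw [hmono u1 A h2, hu1' A h1]
          refine ⟨hP.congr (e 9 (by omega) (by omega)) (e 10 (by omega) (by omega))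
            (e 13 (by omega) (by omega)) (e 14 (by omega) (by omega)), fun _ => ⟨i, ?_, ht⟩,
            fun h => ?_⟩
          · rw [Mem.supp_congr (e 9 (by omega) (by omega))]
            exact Mem.mem_supp.2 ⟨hi, h9⟩
          · rw [hmono u1 16 (by omega), hu16] at h
            exact absurd h one_ne_zero
      · rw [run_cond_neg (fun h => ht (htest.1 h)), run_skip]
        refine ⟨hP.congr (hmono u 9 (by omega)) (hmono u 10 (by omega)) (hmono u 13 (by omega))
          (hmono u 14 (by omega)), ?_, ?_⟩
        · rw [hmono u 16 (by omega), Mem.Blocked, Mem.supp_congr (hmono u 9 (by omega))]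
          exact hne
        · rw [hmono u 16 (by omega)]
          intro h x hx
          rcases Nat.lt_succ_iff_lt_or_eq.1 hx with h' | rfl
          exacts [he h x h', ht]
  set s2 := q.run s1 with hs2
  by_cases h16 : s2.nat 16 0 = 0
  · rw [run_cond_neg (by rw [Test.holds_nz]; simpa [NatExp.eval] using h16), run_seq, run_setNat,
      run_setNat]
    simp only [NatExp.eval]
    have h22 : s2.nat 22 0 = v := by rw [hs2, hqf 22 (by simp), hs1' 22 (by omega), hv]
    rw [h22]
    set s3 := (s2.setNat 13 0 v).setNat 14 0 (c + 1) with hs3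
    have hs3' : ∀ A, A ≠ 13 → A ≠ 14 → s3.nat A = s2.nat A := fun A h1 h2 => by
      rw [hs3, Mem.nat_setNat_of_ne _ _ _ h2, Mem.nat_setNat_of_ne _ _ _ h1]
    have h14 : s3.nat 14 0 = c + 1 := by simp [hs3]
    have h13 : s3.nat 13 0 = v := by
      rw [hs3, Mem.nat_setNat_of_ne _ _ _ (by omega)]
      simp
    have hsupp : s3.supp n 9 = s2.supp n 9 := Mem.supp_congr (hs3' 9 (by omega) (by omega))
    refine ⟨⟨⟨?_, ?_⟩, ?_, fun _ => ?_⟩, .inl ?_⟩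
    · rw [hsupp, hs3' 10 (by omega) (by omega)]
      exact key.1.searching.tree
    · rw [hsupp, h13, h14]
      exact fun _ => ⟨key.1.subset hvis, hal, fun x hx h1 h2 => key.2.2 h16 x hx ⟨h1, h2⟩⟩
    · rw [hsupp]
      exact key.1.subset
    · rw [h14]
      omega
    · rw [h14]
      omega
  · rw [run_cond_pos (by rw [Test.holds_nz]; simpa [NatExp.eval] using h16), run_skip]
    exact ⟨key.1, .inr (key.2.1 h16)⟩

/-- Scan all colors that are allowed at the vertex in register `22`. -/
def scanAllProg (r : ℕ) : LoopProg :=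
  unroll (fun c => .cond (.nz (.get (clusterArr c) (.reg 22))) (scanProg c) .skip) r

theorem nat_run_scanAllProg {r A : ℕ} (hA : A ∉ ({9, 10, 13, 14, 16, 23} : Finset ℕ)) (s : Mem) :
    ((scanAllProg r).run s).nat A = s.nat A := by
  refine nat_run (natWrites_unroll fun c _ => ?_) s
  simp only [mem_insert, mem_singleton, not_or] at hA
  simp [scanProg, natWrites, hA]

theorem run_scanAllProg {n r p v : ℕ} {B Al : ℕ → ℕ → Prop} {col : ℕ → ℕ} {s : Mem}
    (hB : IsColorSystem B Al) (hs : s.MatchEnv n r B Al) (hcol : s.nat 8 = col)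
    (hS : s.Searching n B Al col p) (hv : s.nat 22 0 = v) (hvis : v ∈ s.supp n 9) :
    s.Progress n B Al col p ((scanAllProg r).run s) ∧
      (((scanAllProg r).run s).nat 14 0 ≠ 0 ∨
        ∀ x, Al v x → ((scanAllProg r).run s).Blocked n B col v x) := by
  have hvn : v < n := (Mem.mem_supp.1 hvis).1
  have key : ∀ r' ≤ r, s.Progress n B Al col p ((scanAllProg r').run s) ∧
      (((scanAllProg r').run s).nat 14 0 ≠ 0 ∨
        ∀ c < r', Al v (c + 1) → ((scanAllProg r').run s).Blocked n B col v (c + 1)) := by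
    intro r'
    induction r' with
    | zero => exact fun _ => ⟨⟨hS, subset_rfl, id⟩, .inr fun c hc => by omega⟩
    | succ r' ih =>
      intro hr'
      obtain ⟨hP, h⟩ := ih (by omega)
      have hrun : (scanAllProg (r' + 1)).run s =
          (cond (.nz (.get (clusterArr r') (.reg 22))) (scanProg r') .skip).run
            ((scanAllProg r').run s) := rfl
      rw [hrun]
      set u := (scanAllProg r').run s with hu
      have hf : ∀ A, A ∉ ({9, 10, 13, 14, 16, 23} : Finset ℕ) → u.nat A = s.nat A :=
        fun A hA => nat_run_scanAllProg hA s
      have hE : u.MatchEnv n r B Al := hs.congr fun A hA => hf A (by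
        simp only [mem_insert, mem_singleton]
        omega)
      have h22 : u.nat 22 0 = v := by rw [hf 22 (by simp), hv]
      have hal : Al v (r' + 1) ↔ u.nat (clusterArr r') v ≠ 0 := by
        rw [hE.allowed v hvn]
        constructor
        · rintro ⟨c, -, hc, h⟩
          obtain rfl : r' = c := by omega
          exact h
        · exact fun h => ⟨r', by omega, rfl, h⟩
      have htest : (Test.nz (.get (clusterArr r') (.reg 22))).holds u ↔ Al v (r' + 1) := by
        rw [hal, Test.holds_nz, NatExp.eval_get]
        simp only [NatExp.eval, h22]
      by_cases ht : Al v (r' + 1)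
      · rw [run_cond_pos (htest.2 ht)]
        obtain ⟨hP', h'⟩ := run_scanProg hB hE (by rw [hf 8 (by simp), hcol]) hP.searching h22
          (hP.subset hvis) ht
        refine ⟨hP.trans hP', ?_⟩
        rcases h with h | h
        · exact .inl (hP'.found h)
        · rcases h' with h' | h'
          · exact .inl h'
          · refine .inr fun c hc hal => ?_
            rcases Nat.lt_succ_iff_lt_or_eq.1 hc with hc | rfl
            exacts [(h c hc hal).mono hP'.subset, h']
      · rw [run_cond_neg (fun h => ht (htest.1 h)), run_skip]
        refine ⟨hP, h.imp id fun h c hc hc' => ?_⟩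
        rcases Nat.lt_succ_iff_lt_or_eq.1 hc with hc | rfl
        exacts [h c hc hc', absurd hc' ht]
  refine ⟨(key r le_rfl).1, (key r le_rfl).2.imp id fun h x hx => ?_⟩
  obtain ⟨c, hc, rfl, -⟩ := (hs.allowed v hvn x).1 hx
  exact h c hc hx

/-- One round of the search: scan all vertices found so far. -/
def roundProg (r : ℕ) : LoopProg := .count 22 (.cond (.nz (.get 9 (.reg 22))) (scanAllProg r) .skip)

theorem natWrites_roundProg {r A : ℕ} (hA : A ∉ ({9, 10, 13, 14, 16, 22, 23} : Finset ℕ)) :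
    A ∉ (roundProg r).natWrites := by
  simp only [mem_insert, mem_singleton, not_or] at hA
  have : A ∉ (scanAllProg r).natWrites := natWrites_unroll fun c _ => by
    simp [scanProg, natWrites, hA]
  simp [roundProg, natWrites, hA, this]

/-- Vertices found during the round need not be scanned in it, so blocking is claimed only for
vertices found before the round. -/
theorem run_roundProg {n r p : ℕ} {B Al : ℕ → ℕ → Prop} {col : ℕ → ℕ} {s : Mem}
    (hB : IsColorSystem B Al) (hs : s.MatchEnv n r B Al) (hcol : s.nat 8 = col)
    (hS : s.Searching n B Al col p) :
    s.Progress n B Al col p ((roundProg r).run s) ∧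
      (((roundProg r).run s).nat 14 0 ≠ 0 ∨
        ∀ v ∈ s.supp n 9, ∀ x, Al v x → ((roundProg r).run s).Blocked n B col v x) := by
  have key : s.Progress n B Al col p ((roundProg r).run s) ∧ (((roundProg r).run s).nat 14 0 ≠ 0 ∨
      ∀ v < n, v ∈ s.supp n 9 → ∀ x, Al v x → ((roundProg r).run s).Blocked n B col v x) := by
    refine run_for hs.graph.size (fun i u => s.Progress n B Al col p u ∧ (u.nat 14 0 ≠ 0 ∨
      ∀ v < i, v ∈ s.supp n 9 → ∀ x, Al v x → u.Blocked n B col v x)) ⟨?_, .inr fun v hv => ?_⟩ ?_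
    · have e : ∀ A, A ≠ 22 → (s.setNat 22 0 0).nat A = s.nat A := fun A h =>
        Mem.nat_setNat_of_ne _ _ _ h
      exact ⟨hS.congr (e 9 (by omega)) (e 10 (by omega)) (e 13 (by omega)) (e 14 (by omega)),
        by rw [Mem.supp_congr (e 9 (by omega))], by rw [e 14 (by omega)]; exact id⟩
    · omega
    · intro i hi u hui hf _ ⟨hP, h⟩
      have hf' : ∀ A, A ∉ ({9, 10, 13, 14, 16, 22, 23} : Finset ℕ) → u.nat A = s.nat A :=
        fun A hA => hf A (natWrites_roundProg hA)
      have hE : u.MatchEnv n r B Al := hs.congr fun A hA => hf' A (by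
        simp only [mem_insert, mem_singleton]
        omega)
      have htest : (Test.nz (.get 9 (.reg 22))).holds u ↔ u.nat 9 i ≠ 0 := by
        rw [Test.holds_nz, NatExp.eval_get]
        simp only [NatExp.eval, hui]
      have e : ∀ (w : Mem) A, A ≠ 22 → (w.setNat 22 0 (i + 1)).nat A = w.nat A := fun w A h =>
        Mem.nat_setNat_of_ne _ _ _ h
      have hfin : ∀ w : Mem, (s.Progress n B Al col p w ∧ (w.nat 14 0 ≠ 0 ∨
          ∀ v < i + 1, v ∈ s.supp n 9 → ∀ x, Al v x → w.Blocked n B col v x)) →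
          (s.Progress n B Al col p (w.setNat 22 0 (i + 1)) ∧
            ((w.setNat 22 0 (i + 1)).nat 14 0 ≠ 0 ∨ ∀ v < i + 1, v ∈ s.supp n 9 → ∀ x, Al v x →
              (w.setNat 22 0 (i + 1)).Blocked n B col v x)) := by
        rintro w ⟨h1, h2⟩
        refine ⟨h1.congr (e w 9 (by omega)) (e w 10 (by omega)) (e w 13 (by omega))
          (e w 14 (by omega)), ?_⟩
        rw [e w 14 (by omega)]
        simpa only [Mem.Blocked, Mem.supp_congr (e w 9 (by omega))] using h2
      apply hfin
      by_cases h9 : u.nat 9 i = 0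
      · rw [run_cond_neg (fun h => htest.1 h h9), run_skip]
        refine ⟨hP, h.imp id fun h v hv hvs => ?_⟩
        rcases Nat.lt_succ_iff_lt_or_eq.1 hv with hv | rfl
        exacts [h v hv hvs, absurd h9 (Mem.mem_supp.1 (hP.subset hvs)).2]
      · rw [run_cond_pos (htest.2 h9)]
        obtain ⟨hP', h'⟩ := run_scanAllProg hB hE (by rw [hf' 8 (by simp), hcol]) hP.searching hui
          (Mem.mem_supp.2 ⟨hi, h9⟩)
        refine ⟨hP.trans hP', ?_⟩
        rcases h with h | h
        · exact .inl (hP'.found h)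
        · rcases h' with h' | h'
          · exact .inl h'
          · refine .inr fun v hv hvs x hx => ?_
            rcases Nat.lt_succ_iff_lt_or_eq.1 hv with hv | rfl
            exacts [(h v hv hvs x hx).mono hP'.subset, h' x hx]
  exact ⟨key.1, key.2.imp id fun h v hv => h v (Mem.mem_supp.1 hv).1 hv⟩

/-- Search an augmenting path from the vertex in register `12`. -/
def searchProg (r : ℕ) : LoopProg :=
  .seq (fillProg 9 0)
    (.seq (.setNat 9 (.reg 12) (.const 1))
      (.seq (.setNat 14 (.const 0) (.const 0)) (.count 21 (roundProg r))))

theorem natWrites_searchProg {r A : ℕ}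
    (hA : A ∉ ({9, 10, 13, 14, 16, 20, 21, 22, 23} : Finset ℕ)) :
    A ∉ (searchProg r).natWrites := by
  simp only [mem_insert, mem_singleton, not_or] at hA
  have : A ∉ (roundProg r).natWrites := natWrites_roundProg (by simp [hA])
  simp [searchProg, natWrites, fillProg, natWrites_mapProg, hA, this]

theorem run_searchProg {n r p : ℕ} {B Al : ℕ → ℕ → Prop} {col : ℕ → ℕ} {s : Mem}
    (hB : IsColorSystem B Al) (hs : s.MatchEnv n r B Al) (hcol : s.nat 8 = col)
    (hp : s.nat 12 0 = p) (hpn : p < n) :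
    ((searchProg r).run s).Searching n B Al col p ∧ (((searchProg r).run s).nat 14 0 ≠ 0 ∨
      ∃ R, IsTight n B Al col R ∧ p ∈ R ∧ ∀ v ∈ R, v ≠ p → col v ≠ 0) := by
  rw [searchProg, run_seq, run_seq, run_seq]
  set s1 := (fillProg 9 0).run s with hs1
  have hs1' : ∀ A, A ≠ 20 → A ≠ 9 → s1.nat A = s.nat A := fun A h1 h2 =>
    nat_run (by simp [fillProg, natWrites_mapProg, h1, h2]) s
  have h9 : s1.supp n 9 = ∅ := by
    ext v
    simp only [Mem.mem_supp, notMem_empty, iff_false, not_and, not_not]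
    exact nat_run_fillProg hs.graph.size (by omega) v
  rw [run_setNat, run_setNat]
  simp only [NatExp.eval, hs1' 12 (by omega) (by omega), hp]
  set s2 := (s1.setNat 9 p 1).setNat 14 0 0 with hs2
  have hs2' : ∀ A, A ≠ 20 → A ≠ 9 → A ≠ 14 → s2.nat A = s.nat A := fun A h1 h2 h3 => by
    rw [hs2, Mem.nat_setNat_of_ne _ _ _ h3, Mem.nat_setNat_of_ne _ _ _ h2, hs1' A h1 h2]
  have h9' : s2.supp n 9 = {p} := by
    rw [Mem.supp_congr (s' := s1.setNat 9 p 1) (Mem.nat_setNat_of_ne _ _ _ (by omega)),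
      supp_setNat_one _ hpn, h9]
    rfl
  have hE2 : s2.MatchEnv n r B Al := hs.congr fun A hA => hs2' A (by omega) (by omega) (by omega)
  have key : ((LoopProg.count 21 (roundProg r)).run s2).Searching n B Al col p ∧
      (((LoopProg.count 21 (roundProg r)).run s2).nat 14 0 ≠ 0 ∨
        (∃ R, IsTight n B Al col R ∧ p ∈ R ∧ ∀ v ∈ R, v ≠ p → col v ≠ 0) ∨
        -- Each round without success or obstruction finds a new vertex, starting from the root;
        -- after `n` rounds this is absurd.
        n + 1 ≤ (((LoopProg.count 21 (roundProg r)).run s2).supp n 9).card) := by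
    refine run_for hE2.graph.size (fun i u => u.Searching n B Al col p ∧ (u.nat 14 0 ≠ 0 ∨
      (∃ R, IsTight n B Al col R ∧ p ∈ R ∧ ∀ v ∈ R, v ≠ p → col v ≠ 0) ∨
        i + 1 ≤ (u.supp n 9).card)) ⟨?_, ?_⟩ ?_
    · refine Mem.Searching.congr (s := s2) ⟨⟨fun _ => 0, ?_⟩, ?_⟩
        (Mem.nat_setNat_of_ne _ _ _ (by omega)) (Mem.nat_setNat_of_ne _ _ _ (by omega))
        (Mem.nat_setNat_of_ne _ _ _ (by omega)) (Mem.nat_setNat_of_ne _ _ _ (by omega))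
      · rw [h9']
        exact .singleton hpn _
      · simp [hs2]
    · rw [Mem.supp_congr (s' := s2) (Mem.nat_setNat_of_ne _ _ _ (by omega)), h9']
      simp
    · intro i hi u hui hf _ ⟨hS, h⟩
      have hf' : ∀ A, A ∉ ({9, 10, 13, 14, 16, 20, 21, 22, 23} : Finset ℕ) →
          u.nat A = s.nat A := by
        intro A hA
        simp only [mem_insert, mem_singleton, not_or] at hA
        rw [hf A, hs2' A (by omega) (by omega) (by omega)]
        rw [mem_insert, not_or]
        exact ⟨by omega, natWrites_roundProg (by simp [hA])⟩
      have hE : u.MatchEnv n r B Al := hs.congr fun A hA => hf' A (by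
        simp only [mem_insert, mem_singleton]
        omega)
      obtain ⟨hP, h'⟩ := run_roundProg hB hE (by rw [hf' 8 (by simp), hcol]) hS
      have e : ∀ A, A ≠ 21 → (((roundProg r).run u).setNat 21 0 (i + 1)).nat A =
          ((roundProg r).run u).nat A := fun A h => Mem.nat_setNat_of_ne _ _ _ h
      refine ⟨hP.searching.congr (e 9 (by omega)) (e 10 (by omega)) (e 13 (by omega))
        (e 14 (by omega)), ?_⟩
      rw [e 14 (by omega), Mem.supp_congr (e 9 (by omega))]
      rcases h with h | h | h
      · exact .inl (hP.found h)
      · exact .inr (.inl h)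
      rcases h' with h' | h'
      · exact .inl h'
      -- A round that finds nothing new shows that all allowed colors of found vertices are blocked
      -- by found vertices: the tree is a tight set.
      by_cases heq : ((roundProg r).run u).supp n 9 ⊆ u.supp n 9
      · obtain ⟨d, hd⟩ := hS.tree
        refine .inr (.inl ⟨u.supp n 9, ⟨hd.subset, fun v hv x hx => ?_⟩, hd.root,
          fun v hv hvp => (hd.edge v hv hvp).ne_zero⟩)
        obtain ⟨y, hy, hyx⟩ := h' v hv x hx
        exact ⟨y, heq hy, hyx⟩
      · have := card_lt_card (ssubset_of_subset_not_subset hP.subset heq)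
        exact .inr (.inr (by omega))
  refine ⟨key.1, key.2.imp id fun h => h.resolve_right fun hcard => ?_⟩
  have := Mem.card_supp_le n 9 ((LoopProg.count 21 (roundProg r)).run s2)
  omega

/-- Shift the colors along the path to the vertex in register `13`, which receives the color in
register `14`. -/
def augmentProg : LoopProg :=
  .count 20 (.cond (.nz (.reg 14))
    (.seq (.setNat 15 (.const 0) (.get 8 (.reg 13)))
      (.seq (.setNat 8 (.reg 13) (.reg 14))
        (.seq (.setNat 14 (.const 0) (.reg 15)) (.setNat 13 (.const 0) (.get 10 (.reg 13))))))
    .skip)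

theorem run_augmentProg_of_eq_zero {n : ℕ} {s : Mem} (hn : s.nat 0 0 = n) (h : s.nat 14 0 = 0) :
    (augmentProg.run s).nat 8 = s.nat 8 := by
  refine (run_for hn (fun _ u => u.nat 14 0 = 0 ∧ u.nat 8 = s.nat 8) ⟨?_, ?_⟩ ?_).2
  · rwa [Mem.nat_setNat_of_ne _ _ _ (by omega)]
  · rw [Mem.nat_setNat_of_ne _ _ _ (by omega)]
  · intro i hi u _ _ _ ⟨h14, h8⟩
    rw [run_cond_neg (by rw [Test.holds_nz]; simpa [NatExp.eval] using h14), run_skip,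
      Mem.nat_setNat_of_ne _ _ _ (by omega), Mem.nat_setNat_of_ne _ _ _ (by omega)]
    exact ⟨h14, h8⟩

/-- Each round passes the current color change to the parent and lowers the rank. The bound on rank
plus rounds shows that the root is reached within `n` rounds; afterwards register 14 holds the old
color `0` of the root, which stops the shifting. -/
theorem run_augmentProg {n p : ℕ} {B Al : ℕ → ℕ → Prop} {s : Mem}
    (hB : IsColorSystem B Al) (hn : s.nat 0 0 = n) (hcol : IsPartialColoring n B Al (s.nat 8))
    (hp : s.nat 8 p = 0) (hS : s.Searching n B Al (s.nat 8) p) (h14 : s.nat 14 0 ≠ 0) :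
    IsAugmentation n B Al (s.nat 8) p ((augmentProg.run s).nat 8) := by
  obtain ⟨⟨d, hd⟩, hfound⟩ := hS
  obtain ⟨hx, hal, hfree⟩ := hfound h14
  have key := run_for (x := 20) (p := .cond (.nz (.reg 14))
    (.seq (.setNat 15 (.const 0) (.get 8 (.reg 13)))
      (.seq (.setNat 8 (.reg 13) (.reg 14))
        (.seq (.setNat 14 (.const 0) (.reg 15)) (.setNat 13 (.const 0) (.get 10 (.reg 13))))))
    .skip) hn (fun i u => (u.nat 14 0 = 0 ∧ IsAugmentation n B Al (s.nat 8) p (u.nat 8)) ∨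
      (u.nat 14 0 ≠ 0 ∧ IsShiftState n B Al (s.nat 8) p (s.supp n 9) (s.nat 10) d (u.nat 8)
        (u.nat 13 0) (u.nat 14 0) ∧ d (u.nat 13 0) + i < n)) ?_ ?_
  · rcases key with h | h
    · exact h.2
    · have := h.2.2
      omega
  · right
    have e : ∀ A, A ≠ 20 → (s.setNat 20 0 0).nat A = s.nat A := fun A h =>
        Mem.nat_setNat_of_ne _ _ _ h
    rw [e 14 (by omega), e 8 (by omega), e 13 (by omega)]
    refine ⟨h14, hd.isShiftState hcol hp hx hal hfree, ?_⟩
    have h1 := hd.lt_card _ hx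
    have h2 := card_le_card hd.subset
    rw [card_range] at h2
    omega
  · intro i hi u hui hf _ hI
    have e : ∀ (w : Mem) A, A ≠ 20 → (w.setNat 20 0 (i + 1)).nat A = w.nat A := fun w A h =>
      Mem.nat_setNat_of_ne _ _ _ h
    rw [e _ 14 (by omega), e _ 8 (by omega), e _ 13 (by omega)]
    rcases hI with ⟨h0, hA⟩ | ⟨h0, hI, hlt⟩
    · left
      rw [run_cond_neg (by rw [Test.holds_nz]; simpa [NatExp.eval] using h0), run_skip]
      exact ⟨h0, hA⟩
    · have h10 : u.nat 10 = s.nat 10 := hf 10 (by simp [natWrites])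
      rw [run_cond_pos (by rw [Test.holds_nz]; simpa [NatExp.eval] using h0)]
      simp only [run_seq, run_setNat]
      set x := u.nat 13 0 with hx
      set c := u.nat 14 0 with hc
      set u1 := u.setNat 15 ((NatExp.const 0).eval u) ((NatExp.get 8 (.reg 13)).eval u) with hu1
      have hu1' : ∀ A, A ≠ 15 → u1.nat A = u.nat A := fun A hA => Mem.nat_setNat_of_ne _ _ _ hA
      have hu15 : u1.nat 15 0 = u.nat 8 x := by simp [hu1, NatExp.eval, hx]
      set u2 := u1.setNat 8 ((NatExp.reg 13).eval u1) ((NatExp.reg 14).eval u1) with hu2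
      have hu2' : ∀ A, A ≠ 8 → u2.nat A = u1.nat A := fun A hA => Mem.nat_setNat_of_ne _ _ _ hA
      have hu28 : u2.nat 8 = Function.update (u.nat 8) x c := by
        ext y
        simp only [hu2, NatExp.eval, Mem.nat_setNat_same, hu1' 13 (by omega), hu1' 14 (by omega),
          hu1' 8 (by omega), Function.update_apply, ← hx, ← hc]
      set u3 := u2.setNat 14 ((NatExp.const 0).eval u2) ((NatExp.reg 15).eval u2) with hu3
      have hu3' : ∀ A, A ≠ 14 → u3.nat A = u2.nat A := fun A hA => Mem.nat_setNat_of_ne _ _ _ hA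
      have hu314 : u3.nat 14 0 = u.nat 8 x := by
        simp [hu3, NatExp.eval, hu2' 15 (by omega), hu15]
      set u4 := u3.setNat 13 ((NatExp.const 0).eval u3) ((NatExp.get 10 (.reg 13)).eval u3) with hu4
      have hu4' : ∀ A, A ≠ 13 → u4.nat A = u3.nat A := fun A hA => Mem.nat_setNat_of_ne _ _ _ hA
      have hu413 : u4.nat 13 0 = s.nat 10 x := by
        simp [hu4, NatExp.eval, hu3' 13 (by omega), hu2' 13 (by omega), hu1' 13 (by omega),
          hu3' 10 (by omega), hu2' 10 (by omega), hu1' 10 (by omega), h10, ← hx]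
      rw [hu4' 14 (by omega), hu4' 8 (by omega), hu3' 8 (by omega), hu28, hu314, hu413]
      by_cases hxp : x = p
      · left
        rw [hxp] at hI ⊢
        exact ⟨hI.root, hI.isAugmentation hB⟩
      · right
        obtain ⟨h1, h2⟩ := hI.step hB hd.subset hxp
        exact ⟨(hI.edge x hI.mem hxp le_rfl).ne_zero, h1, by omega⟩

/-- Put an unprocessed vertex of maximum weight into register `12`. -/
def selectProg : LoopProg :=
  .seq (.setNat 16 (.const 0) (.const 0))
    (.count 20 (.cond (.nz (.get 11 (.reg 20))) .skip
      (.cond (.conj (.nz (.reg 16)) (.ratLE (.get 0 (.reg 20)) (.get 0 (.reg 12)))) .skip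
        (.seq (.setNat 12 (.const 0) (.reg 20)) (.setNat 16 (.const 0) (.const 1))))))

/-- Register 16 tells whether a candidate was seen in the present run, as register 12 may still hold
the vertex of an earlier selection. -/
theorem run_selectProg {n : ℕ} {w : ℕ → ℚ} {s : Mem} (hn : s.nat 0 0 = n)
    (hw : ∀ v < n, s.rat 0 v = w v) (hex : ∃ v < n, s.nat 11 v = 0) :
    (selectProg.run s).nat 12 0 < n ∧ s.nat 11 ((selectProg.run s).nat 12 0) = 0 ∧
      ∀ v < n, s.nat 11 v = 0 → w v ≤ w ((selectProg.run s).nat 12 0) := by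
  rw [selectProg, run_seq, run_setNat]
  set s1 := s.setNat 16 ((NatExp.const 0).eval s) ((NatExp.const 0).eval s) with hs1
  have hs1' : ∀ A, A ≠ 16 → s1.nat A = s.nat A := fun A hA => Mem.nat_setNat_of_ne _ _ _ hA
  set q : LoopProg := .count 20 (.cond (.nz (.get 11 (.reg 20))) .skip
      (.cond (.conj (.nz (.reg 16)) (.ratLE (.get 0 (.reg 20)) (.get 0 (.reg 12)))) .skip
        (.seq (.setNat 12 (.const 0) (.reg 20)) (.setNat 16 (.const 0) (.const 1))))) with hq
  have key : ((q.run s1).nat 16 0 ≠ 0 ∧ (q.run s1).nat 12 0 < n ∧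
      s.nat 11 ((q.run s1).nat 12 0) = 0 ∧
      ∀ v < n, s.nat 11 v = 0 → w v ≤ w ((q.run s1).nat 12 0)) ∨
      ((q.run s1).nat 16 0 = 0 ∧ ∀ v < n, s.nat 11 v ≠ 0) := by
    refine run_for (n := n) (by rw [hs1' 0 (by omega), hn]) (fun i u =>
      (u.nat 16 0 ≠ 0 ∧ u.nat 12 0 < n ∧ s.nat 11 (u.nat 12 0) = 0 ∧
        ∀ v < i, s.nat 11 v = 0 → w v ≤ w (u.nat 12 0)) ∨
      (u.nat 16 0 = 0 ∧ ∀ v < i, s.nat 11 v ≠ 0)) (.inr ⟨?_, by simp⟩) ?_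
    · rw [Mem.nat_setNat_of_ne _ _ _ (by omega)]
      simp [hs1, NatExp.eval]
    · intro i hi u hui hf hfr hI
      have e : ∀ (w : Mem) A, A ≠ 20 → (w.setNat 20 0 (i + 1)).nat A = w.nat A := fun w A h =>
        Mem.nat_setNat_of_ne _ _ _ h
      rw [e _ 16 (by omega), e _ 12 (by omega)]
      have h11 : u.nat 11 = s.nat 11 := by
        rw [hf 11 (by simp [natWrites]), hs1' 11 (by omega)]
      have hrat : ∀ v < n, u.rat 0 v = w v := by
        intro v hv
        rw [hfr 0 (by simp [ratWrites]), ← hw v hv]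
        rfl
      have htest : (Test.nz (.get 11 (.reg 20))).holds u ↔ s.nat 11 i ≠ 0 := by
        rw [Test.holds_nz, NatExp.eval_get]
        simp only [NatExp.eval, hui, h11]
      by_cases hi11 : s.nat 11 i = 0
      · rw [run_cond_neg (fun h => htest.1 h hi11)]
        have htest2 : (Test.conj (.nz (.reg 16))
            (.ratLE (.get 0 (.reg 20)) (.get 0 (.reg 12)))).holds u ↔
            u.nat 16 0 ≠ 0 ∧ u.rat 0 i ≤ u.rat 0 (u.nat 12 0) := by
          rw [Test.holds_conj, Test.holds_nz]
          simp only [Test.holds, RatExp.eval, NatExp.eval, hui]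
        by_cases ht : u.nat 16 0 ≠ 0 ∧ u.rat 0 i ≤ u.rat 0 (u.nat 12 0)
        · rw [run_cond_pos (htest2.2 ht), run_skip]
          left
          rcases hI with ⟨h1, h2, h3, h4⟩ | ⟨h1, -⟩
          · refine ⟨h1, h2, h3, fun v hv hv11 => ?_⟩
            rcases Nat.lt_succ_iff_lt_or_eq.1 hv with hv | rfl
            · exact h4 v hv hv11
            · rw [← hrat v hi, ← hrat _ h2]
              exact ht.2
          · exact absurd h1 ht.1
        · rw [run_cond_neg (fun h => ht (htest2.1 h)), run_seq, run_setNat, run_setNat]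
          simp only [NatExp.eval, hui]
          left
          rw [Mem.nat_setNat_same, if_pos rfl, Mem.nat_setNat_of_ne _ _ _ (by omega),
            Mem.nat_setNat_same, if_pos rfl]
          refine ⟨one_ne_zero, hi, hi11, fun v hv hv11 => ?_⟩
          rcases Nat.lt_succ_iff_lt_or_eq.1 hv with hv | rfl
          · rcases hI with ⟨h1, h2, h3, h4⟩ | ⟨-, h1⟩
            · have h5 : ¬ u.rat 0 i ≤ u.rat 0 (u.nat 12 0) := fun h => ht ⟨h1, h⟩
              rw [hrat i hi, hrat _ h2] at h5
              exact (h4 v hv hv11).trans (not_le.1 h5).le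
            · exact absurd hv11 (h1 v hv)
          · exact le_rfl
      · rw [run_cond_pos (htest.2 hi11), run_skip]
        refine hI.imp (fun ⟨h1, h2, h3, h4⟩ => ⟨h1, h2, h3, fun v hv hv11 => ?_⟩)
          (fun ⟨h1, h2⟩ => ⟨h1, fun v hv => ?_⟩)
        · rcases Nat.lt_succ_iff_lt_or_eq.1 hv with hv | rfl
          exacts [h4 v hv hv11, absurd hv11 hi11]
        · rcases Nat.lt_succ_iff_lt_or_eq.1 hv with hv | rfl
          exacts [h2 v hv, hi11]
  rcases key with h | h
  · exact h.2
  · obtain ⟨v, hv, hv11⟩ := hex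
    exact absurd hv11 (h.2 v hv)

/-- Process one vertex in the greedy algorithm. -/
def greedyProg (r : ℕ) : LoopProg :=
  .seq selectProg (.seq (.setNat 11 (.reg 12) (.const 1)) (.seq (searchProg r) augmentProg))

/-- Find a partial coloring of maximum weight. -/
def matchProg (r : ℕ) : LoopProg :=
  .seq (fillProg 8 0) (.seq (fillProg 11 0) (.count 24 (greedyProg r)))

theorem natWrites_greedyProg {r A : ℕ}
    (hA : A ∉ ({8, 9, 10, 11, 12, 13, 14, 15, 16, 20, 21, 22, 23} : Finset ℕ)) :
    A ∉ (greedyProg r).natWrites := by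
  simp only [mem_insert, mem_singleton, not_or] at hA
  have : A ∉ (searchProg r).natWrites := natWrites_searchProg (by simp [hA])
  simp [greedyProg, selectProg, augmentProg, natWrites, hA, this]

theorem natWrites_matchProg {r A : ℕ}
    (hA : A ∉ ({8, 9, 10, 11, 12, 13, 14, 15, 16, 20, 21, 22, 23, 24} : Finset ℕ)) :
    A ∉ (matchProg r).natWrites := by
  simp only [mem_insert, mem_singleton, not_or] at hA
  have : A ∉ (greedyProg r).natWrites := natWrites_greedyProg (by simp [hA])
  simp [matchProg, fillProg, natWrites_mapProg, natWrites, hA, this]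

theorem ratWrites_unroll {f : ℕ → LoopProg} {r : ℕ} (h : ∀ c < r, (f c).ratWrites = ∅) :
    (unroll f r).ratWrites = ∅ := by
  induction r with
  | zero => rfl
  | succ r ih =>
    simp only [unroll, ratWrites, ih fun c hc => h c (by omega), h r (by omega), union_empty]

theorem ratWrites_greedyProg (r : ℕ) : (greedyProg r).ratWrites = ∅ := by
  have : (scanAllProg r).ratWrites = ∅ := ratWrites_unroll fun c _ => by simp [ratWrites, scanProg]
  simp [greedyProg, selectProg, augmentProg, searchProg, roundProg, fillProg, mapProg, ratWrites,
    this]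

theorem ratWrites_matchProg (r : ℕ) : (matchProg r).ratWrites = ∅ := by
  simp [matchProg, fillProg, mapProg, ratWrites, ratWrites_greedyProg]

theorem run_matchProg {n r : ℕ} {B Al : ℕ → ℕ → Prop} {w : ℕ → ℚ} {s : Mem}
    (hB : IsColorSystem B Al) (hs : s.MatchEnv n r B Al) (hw : ∀ v < n, s.rat 0 v = w v)
    (hw0 : ∀ v < n, 0 ≤ w v) :
    IsPartialColoring n B Al (((matchProg r).run s).nat 8) ∧
      ∀ F, IsColorable n B Al F →
        ∑ v ∈ F, w v ≤ ∑ v ∈ colored n (((matchProg r).run s).nat 8), w v := by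
  rw [matchProg, run_seq, run_seq]
  set s1 := (fillProg 8 0).run s with hs1
  have hs1' : ∀ A, A ≠ 20 → A ≠ 8 → s1.nat A = s.nat A := fun A h1 h2 =>
    nat_run (by simp [fillProg, natWrites_mapProg, h1, h2]) s
  have hE1 : s1.MatchEnv n r B Al := hs.congr fun A hA => hs1' A (by omega) (by omega)
  set s2 := (fillProg 11 0).run s1 with hs2
  have hs2' : ∀ A, A ≠ 20 → A ≠ 11 → s2.nat A = s1.nat A := fun A h1 h2 =>
    nat_run (by simp [fillProg, natWrites_mapProg, h1, h2]) s1
  have hE2 : s2.MatchEnv n r B Al := hE1.congr fun A hA => hs2' A (by omega) (by omega)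
  have hrat2 : s2.rat 0 = s.rat 0 := by
    rw [hs2, rat_run (by simp [fillProg, mapProg, ratWrites]), hs1,
      rat_run (by simp [fillProg, mapProg, ratWrites])]
  have h8 : ∀ v < n, s2.nat 8 v = 0 := by
    rw [hs2' 8 (by omega) (by omega)]
    exact nat_run_fillProg hs.graph.size (by omega)
  have h11 : ∀ v < n, s2.nat 11 v = 0 := nat_run_fillProg hE1.graph.size (by omega)
  have key : ∀ u, u = (LoopProg.count 24 (greedyProg r)).run s2 →
      IsGreedyState n B Al w (u.supp n 11) (u.nat 8) ∧ (u.supp n 11).card = n := by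
    rintro u rfl
    refine run_for hE2.graph.size (fun i u => IsGreedyState n B Al w (u.supp n 11) (u.nat 8) ∧
      (u.supp n 11).card = i) ?_ ?_
    · have h0 : s2.supp n 11 = ∅ := by
        ext v
        simpa [Mem.mem_supp] using h11 v
      rw [Mem.supp_congr (s' := s2) (Mem.nat_setNat_of_ne _ _ _ (by omega)),
        Mem.nat_setNat_of_ne _ _ _ (by omega), h0]
      exact ⟨.empty h8, rfl⟩
    · intro i hi u hui hf hfr ⟨hI, hcard⟩
      have e : ∀ (w : Mem) A, A ≠ 24 → (w.setNat 24 0 (i + 1)).nat A = w.nat A := fun w A h =>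
        Mem.nat_setNat_of_ne _ _ _ h
      rw [Mem.supp_congr (e _ 11 (by omega)), e _ 8 (by omega)]
      have hf' : ∀ A, A ∉ ({8, 9, 10, 11, 12, 13, 14, 15, 16, 20, 21, 22, 23, 24} : Finset ℕ) →
          u.nat A = s2.nat A := by
        intro A hA
        simp only [mem_insert, mem_singleton, not_or] at hA
        refine hf A ?_
        rw [mem_insert, not_or]
        exact ⟨by omega, natWrites_greedyProg (by simp [hA])⟩
      have hE : u.MatchEnv n r B Al := hE2.congr fun A hA => hf' A (by
        simp only [mem_insert, mem_singleton]
        omega)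
      have hrat : ∀ v < n, u.rat 0 v = w v := by
        intro v hv
        rw [hfr 0 (by simp [ratWrites_greedyProg]), hrat2, hw v hv]
      have hex : ∃ v < n, u.nat 11 v = 0 := by
        by_contra! h
        have : u.supp n 11 = range n := by
          ext v
          simp only [Mem.mem_supp, mem_range]
          exact ⟨fun h => h.1, fun hv => ⟨hv, h v hv⟩⟩
        rw [this, card_range] at hcard
        omega
      obtain ⟨hpn, hp11, hpmax⟩ := run_selectProg hE.graph.size hrat hex
      rw [greedyProg, run_seq, run_seq, run_seq]
      set u1 := selectProg.run u with hu1
      set p := u1.nat 12 0 with hp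
      have hu1' : ∀ A, A ∉ ({12, 16, 20} : Finset ℕ) → u1.nat A = u.nat A := by
        intro A hA
        simp only [mem_insert, mem_singleton, not_or] at hA
        exact nat_run (by simp [selectProg, natWrites, hA]) u
      set u2 := (setNat 11 (.reg 12) (.const 1)).run u1 with hu2
      have hu2' : ∀ A, A ≠ 11 → u2.nat A = u1.nat A := fun A hA => Mem.nat_setNat_of_ne _ _ _ hA
      have hu2eq : u2 = u1.setNat 11 p 1 := rfl
      have hE2' : u2.MatchEnv n r B Al := hE.congr fun A hA => by
        rw [hu2' A (by omega), hu1' A]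
        simp only [mem_insert, mem_singleton]
        omega
      have hcol2 : u2.nat 8 = u.nat 8 := by rw [hu2' 8 (by omega), hu1' 8 (by simp)]
      obtain ⟨hS, hR⟩ := run_searchProg hB hE2' hcol2 (by rw [hu2' 12 (by omega)]) hpn
      set u3 := (searchProg r).run u2 with hu3
      have hu3' : ∀ A, A ∉ ({9, 10, 13, 14, 16, 20, 21, 22, 23} : Finset ℕ) →
          u3.nat A = u2.nat A := fun A hA => nat_run (natWrites_searchProg hA) u2
      have hcol3 : u3.nat 8 = u.nat 8 := by rw [hu3' 8 (by simp), hcol2]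
      have hsupp : (augmentProg.run u3).supp n 11 = insert p (u.supp n 11) := by
        rw [Mem.supp_congr (s' := u3) (nat_run (by simp [augmentProg, natWrites]) u3),
          Mem.supp_congr (hu3' 11 (by simp)), hu2eq, supp_setNat_one _ hpn,
          Mem.supp_congr (hu1' 11 (by simp))]
      have hpP : p ∉ u.supp n 11 := fun h => (Mem.mem_supp.1 h).2 hp11
      have hmax : ∀ v < n, v ∉ u.supp n 11 → w v ≤ w p := fun v hv hvP =>
        hpmax v hv (by
          by_contra h
          exact hvP (Mem.mem_supp.2 ⟨hv, h⟩))
      rw [hsupp, card_insert_of_notMem hpP, hcard]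
      refine ⟨?_, rfl⟩
      -- Either the search left a tight set containing `p`, and `p` is rejected, or the shift of
      -- colors along the path adds `p`.
      by_cases h14 : u3.nat 14 0 = 0
      · rw [run_augmentProg_of_eq_zero (n := n) (by
          rw [hu3' 0 (by simp)]; exact hE2'.graph.size) h14, hcol3]
        obtain ⟨R, h1, h2, h3⟩ := hR.resolve_left (not_not.2 h14)
        exact hI.reject hB hpn hpP hmax (hw0 p hpn) h1 h2 h3
      · refine hI.accept hB hpn hpP hmax (hw0 p hpn) ?_
        have hp0 : u.nat 8 p = 0 := by
          by_contra h
          exact hpP (hI.mem_of_ne_zero p hpn h)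
        rw [← hcol3] at hS hp0 ⊢
        exact run_augmentProg hB (by rw [hu3' 0 (by simp)]; exact hE2'.graph.size)
          (hcol3 ▸ hI.coloring) hp0 hS h14
  obtain ⟨hI, hcard⟩ := key _ rfl
  set u := (LoopProg.count 24 (greedyProg r)).run s2
  have hall : u.supp n 11 = range n :=
    eq_of_subset_of_card_le (filter_subset _ _) (by rw [hcard, card_range])
  rw [hall] at hI
  exact ⟨hI.coloring, fun F hF => hI.sum_le hw0 hF⟩

end LoopProg

/-! ## The main program -/

/-- The vertices of `F` can be colored with `0, …, r - 1` from the lists `Ls`. -/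
structure IsListColoring (r : ℕ) (B Ls : ℕ → ℕ → Prop) (F : Finset ℕ) (φ : ℕ → ℕ) : Prop where
  lt : ∀ v ∈ F, φ v < r
  mem : ∀ v ∈ F, Ls v (φ v)
  inj : ∀ u ∈ F, ∀ v ∈ F, φ u = φ v → B u v → u = v

/-- The memory holds the input. -/
structure Mem.HasInput (n r : ℕ) (A Ls : ℕ → ℕ → Prop) (w : ℕ → ℚ) (s : Mem) : Prop where
  size : s.nat 0 0 = n
  adj : ∀ u < n, ∀ v < n, (s.nat 1 (u * n + v) ≠ 0 ↔ A u v)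
  adj_le : ∀ u < n, ∀ v < n, s.nat 1 (u * n + v) ≤ 1
  list : ∀ v < n, ∀ c < r, (s.nat 2 (v * r + c) ≠ 0 ↔ Ls v c)
  weight : ∀ v < n, s.rat 0 v = w v

/-- The memory holds the problem with tables for the positions of the rows. -/
structure Mem.HasProblem (n r : ℕ) (B Ls : ℕ → ℕ → Prop) (w : ℕ → ℚ) (s : Mem) : Prop where
  graph : s.HasGraph n B
  row : ∀ v < n, s.nat 6 v = v * r
  list : ∀ v < n, ∀ c < r, (s.nat 2 (v * r + c) ≠ 0 ↔ Ls v c)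
  weight : ∀ v < n, s.rat 0 v = w v

theorem Mem.HasProblem.congr {n r : ℕ} {B Ls : ℕ → ℕ → Prop} {w : ℕ → ℚ} {s s' : Mem}
    (h : s.HasProblem n r B Ls w) (h' : ∀ A ∈ ({0, 1, 2, 4, 6} : Finset ℕ), s'.nat A = s.nat A)
    (hr : s'.rat 0 = s.rat 0) : s'.HasProblem n r B Ls w where
  graph := h.graph.congr (h' 0 (by simp)) (h' 1 (by simp)) (h' 4 (by simp))
  row := by rw [h' 6 (by simp)]; exact h.row
  list := by rw [h' 2 (by simp)]; exact h.list
  weight := by rw [hr]; exact h.weight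

/-- Array `3` holds a feasible solution, rational register `1` its weight. -/
structure Mem.HasSolution (n r : ℕ) (B Ls : ℕ → ℕ → Prop) (w : ℕ → ℚ) (s : Mem) : Prop where
  feasible : ∃ φ, IsListColoring r B Ls (s.supp n 3) φ
  weight : s.rat 1 0 = ∑ v ∈ s.supp n 3, w v

theorem Mem.HasSolution.congr {n r : ℕ} {B Ls : ℕ → ℕ → Prop} {w : ℕ → ℚ} {s s' : Mem}
    (h : s.HasSolution n r B Ls w) (h' : s'.nat 3 = s.nat 3)
    (hr : s'.rat 1 = s.rat 1) : s'.HasSolution n r B Ls w where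
  feasible := by rw [Mem.supp_congr h']; exact h.feasible
  weight := by rw [Mem.supp_congr h', hr]; exact h.weight

/-- The color classes of some coloring of `F` lie in the clusters encoded by the certificates `g`,
of `5 * K` entries for each color. -/
def IsEncoded (n r K : ℕ) (B Ls : ℕ → ℕ → Prop) (g : ℕ → ℕ) (F : Finset ℕ) : Prop :=
  F ⊆ range n ∧ ∃ φ, IsListColoring r B Ls F φ ∧
    ∀ v ∈ F, v ∈ decode B n (fun d => g (5 * K * φ v + d)) K (range n : Finset ℕ)

/-! ### From digits to clusters, and the enumeration of all digits -/

namespace LoopProg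

/-- Compute the vertices that may receive color `c`, according to the certificate for `c` and the
lists. -/
def clusterProg (K c : ℕ) : LoopProg :=
  .seq (fillProg (levelArr K) 1)
    (.seq (decodeProg (clusterArr c) (5 * K * c) K)
      (mapProg (clusterArr c) (.nz (.get 2 (.add (.get 6 (.reg 20)) (.const c))))
        (.get (clusterArr c) (.reg 20)) (.const 0)))

theorem natWrites_clusterProg {K c A : ℕ} (h1 : A ≠ clusterArr c)
    (h2 : A ∉ ({7, 20, 21, 22} : Finset ℕ)) (h3 : ∀ j, A ≠ levelArr j) :
    A ∉ (clusterProg K c).natWrites := by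
  have : A ∉ (decodeProg (clusterArr c) (5 * K * c) K).natWrites := fun h => by
    rcases natWrites_decodeProg h with h | h | ⟨j, hj, h⟩
    exacts [h1 h, h2 h, h3 j h]
  simp only [mem_insert, mem_singleton, not_or] at h2
  simp [clusterProg, natWrites, fillProg, natWrites_mapProg, this, h1, h2, h3]

theorem ratWrites_decodeProg (C β m : ℕ) : (decodeProg C β m).ratWrites = ∅ := by
  induction m with
  | zero => simp [decodeProg, ratWrites, fillProg, mapProg, sweepProg]
  | succ m ih => simp [decodeProg, ratWrites, mapProg, sweepProg, residualProg, isolateProg, ih]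

theorem ratWrites_clusterProg (K c : ℕ) : (clusterProg K c).ratWrites = ∅ := by
  simp [clusterProg, ratWrites, fillProg, mapProg, ratWrites_decodeProg]

theorem mem_supp_run_clusterProg {n r K c : ℕ} {B Ls : ℕ → ℕ → Prop} {w : ℕ → ℚ} {s : Mem}
    (hs : s.HasProblem n r B Ls w) (hr : ∀ u, B u u) (hsymm : ∀ u v, B u v → B v u)
    (hc : c < r) (hd : ∀ d < 5 * K, s.digits (5 * K * c) d < n) (v : ℕ) :
    v ∈ ((clusterProg K c).run s).supp n (clusterArr c) ↔
      v < n ∧ v ∈ decode B n (s.digits (5 * K * c)) K (range n : Finset ℕ) ∧ Ls v c := by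
  rw [clusterProg, run_seq, run_seq]
  set s1 := (fillProg (levelArr K) 1).run s with hs1
  have hs1' : ∀ A, A ≠ 20 → A ≠ levelArr K → s1.nat A = s.nat A := fun A h1 h2 =>
    nat_run (by simp [fillProg, natWrites_mapProg, h1, h2]) s
  have hlev : ∀ j, 100 ≤ levelArr j := fun j => by simp only [levelArr]; omega
  have hclu : ∀ j, 100 ≤ clusterArr j := fun j => by simp only [clusterArr]; omega
  have hdig : s1.digits (5 * K * c) = s.digits (5 * K * c) := by
    funext d
    rw [Mem.digits, Mem.digits, hs1' _ (by simp only [digitArr]; omega)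
      (by simp only [digitArr, levelArr]; omega)]
  have hG1 : s1.HasGraph n B := by
    have := hlev K
    exact hs.graph.congr (hs1' _ (by omega) (by omega)) (hs1' _ (by omega) (by omega))
      (hs1' _ (by omega) (by omega))
  have hfull : s1.supp n (levelArr K) = range n := by
    ext j
    simp only [Mem.mem_supp, mem_range]
    refine ⟨fun h => h.1, fun hj => ⟨hj, ?_⟩⟩
    rw [nat_run_fillProg hs.graph.size (by have := hlev K; omega) j hj]
    exact one_ne_zero
  have hdec := supp_run_decodeProg (c := c) hG1 hr hsymm (by rw [hdig]; exact hd)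
  rw [hdig, hfull] at hdec
  set s2 := (decodeProg (clusterArr c) (5 * K * c) K).run s1 with hs2
  have hs2' : ∀ A, A < 7 → s2.nat A = s.nat A := fun A hA => by
    rw [nat_run_decodeProg (by have := hclu c; omega)
      (by simp only [mem_insert, mem_singleton]; omega)
      (fun j _ => by have := hlev j; omega), hs1' A (by omega) (by have := hlev K; omega)]
  classical
  have hval := nat_run_mapProg (C := clusterArr c) (s := s2) (n := n)
    (b := .nz (.get 2 (.add (.get 6 (.reg 20)) (.const c))))
    (e := .get (clusterArr c) (.reg 20)) (f := .const 0)
    (by rw [hs2' 0 (by omega), hs.graph.size]) (by have := hclu c; omega)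
    (fun i => if Ls i c then s2.nat (clusterArr c) i else 0) (by
      intro i hi u hu hf _ hCi
      have h := hclu c
      have e20 : (NatExp.reg 20).eval u = i := hu
      have htest : (Test.nz (.get 2 (.add (.get 6 (.reg 20)) (.const c)))).holds u ↔ Ls i c := by
        rw [Test.holds_nz, NatExp.eval_get, NatExp.eval_add, NatExp.eval_get, e20,
          NatExp.eval_const, hf 6 (by omega) (by omega), hf 2 (by omega) (by omega),
          hs2' 6 (by omega), hs2' 2 (by omega), hs.row i hi, hs.list i hi c hc]
      rw [htest, NatExp.eval_get, e20, hCi]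
      exact ⟨fun h => (if_pos h).symm, fun h => (if_neg h).symm⟩)
  rw [Mem.mem_supp]
  refine and_congr_right fun hv => ?_
  rw [hval v hv, ← hdec, mem_coe, Mem.mem_supp]
  split_ifs with h
  · simp [hv, h]
  · simp [h]

/-- Compute the clusters for all colors. -/
def clustersProg (K r : ℕ) : LoopProg := unroll (clusterProg K) r

theorem natWrites_clustersProg {K r A : ℕ} (h1 : ∀ c, A ≠ clusterArr c)
    (h2 : A ∉ ({7, 20, 21, 22} : Finset ℕ)) (h3 : ∀ j, A ≠ levelArr j) :
    A ∉ (clustersProg K r).natWrites :=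
  natWrites_unroll fun c _ => natWrites_clusterProg (h1 c) h2 h3

theorem natWrites_clustersProg_of_lt {K r A : ℕ} (hA : A < 20) (h7 : A ≠ 7) :
    A ∉ (clustersProg K r).natWrites := by
  refine natWrites_clustersProg (fun c => ?_) ?_ fun j => ?_
  · simp only [clusterArr]
    omega
  · simp only [mem_insert, mem_singleton]
    omega
  · simp only [levelArr]
    omega

theorem digitArr_notMem_natWrites_clustersProg (K r d : ℕ) :
    digitArr d ∉ (clustersProg K r).natWrites := by
  refine natWrites_clustersProg (fun c => ?_) ?_ fun j => ?_
  · simp only [clusterArr, digitArr]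
    omega
  · simp only [mem_insert, mem_singleton, digitArr]
    omega
  · simp only [levelArr, digitArr]
    omega

theorem rat_run_clustersProg {K r : ℕ} (s : Mem) : ((clustersProg K r).run s).rat = s.rat := by
  funext A
  exact rat_run (by
    rw [clustersProg, ratWrites_unroll fun c _ => ratWrites_clusterProg K c]; simp) s

/-- Computing the cluster of one color changes neither the digits nor the clusters of other colors.
-/
theorem mem_supp_run_clustersProg {n r R K : ℕ} {B Ls : ℕ → ℕ → Prop} {w : ℕ → ℚ} {s : Mem}
    (hs : s.HasProblem n R B Ls w) (hr : ∀ u, B u u) (hsymm : ∀ u v, B u v → B v u)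
    (hrR : r ≤ R) (hd : ∀ d < 5 * K * r, s.digits 0 d < n) {c : ℕ} (hc : c < r) (v : ℕ) :
    v ∈ ((clustersProg K r).run s).supp n (clusterArr c) ↔
      v < n ∧ v ∈ decode B n (s.digits (5 * K * c)) K (range n : Finset ℕ) ∧ Ls v c := by
  induction r with
  | zero => omega
  | succ r ih =>
    rw [clustersProg, unroll, run_seq]
    set s1 := (unroll (clusterProg K) r).run s with hs1
    by_cases hcr : c = r
    · subst hcr
      have hdig : s1.digits (5 * K * c) = s.digits (5 * K * c) := by
        funext d
        exact congrFun (nat_run (digitArr_notMem_natWrites_clustersProg K c _) s) 0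
      have hP : s1.HasProblem n R B Ls w := hs.congr (fun A hA => by
        refine nat_run (natWrites_clustersProg_of_lt ?_ ?_) s <;>
        · simp only [mem_insert, mem_singleton] at hA
          omega) (by rw [hs1]; exact congrFun (rat_run_clustersProg s) 0)
      rw [mem_supp_run_clusterProg hP hr hsymm (by omega) (by
        rw [hdig]
        intro d hd'
        have := hd (5 * K * c + d) (by rw [Nat.mul_succ]; omega)
        simpa [Mem.digits] using this), hdig]
    · rw [Mem.supp_congr (s' := s1) (nat_run (natWrites_clusterProg
        (by simp only [clusterArr]; omega)
        (by simp only [mem_insert, mem_singleton, clusterArr]; omega)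
        (by simp only [clusterArr, levelArr]; omega)) s1)]
      exact ih (by omega) (fun d hd' => hd d (by rw [Nat.mul_succ]; omega)) (by omega)

/-- Compare the coloring in array `8` with the best solution so far. -/
def recordProg : LoopProg :=
  .seq (.setRat 2 (.const 0) (.const 0))
    (.seq
      (.count 20 (.cond (.nz (.get 8 (.reg 20)))
        (.setRat 2 (.const 0) (.add (.get 2 (.const 0)) (.get 0 (.reg 20)))) .skip))
      (.cond (.ratLE (.get 2 (.const 0)) (.get 1 (.const 0))) .skip
        (.seq (.setRat 1 (.const 0) (.get 2 (.const 0)))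
          (mapProg 3 (.natLE (.const 0) (.const 0)) (.get 8 (.reg 20)) (.get 8 (.reg 20))))))

theorem natWrites_recordProg : recordProg.natWrites = {20, 3} := by
  simp [recordProg, natWrites, natWrites_mapProg]

theorem run_recordProg {n r : ℕ} {B Ls : ℕ → ℕ → Prop} {w : ℕ → ℚ} {s : Mem}
    (hs : s.HasProblem n r B Ls w) (hsol : s.HasSolution n r B Ls w)
    (hcol : ∃ φ, IsListColoring r B Ls (colored n (s.nat 8)) φ) :
    (recordProg.run s).HasSolution n r B Ls w ∧ s.rat 1 0 ≤ (recordProg.run s).rat 1 0 ∧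
      ∑ v ∈ colored n (s.nat 8), w v ≤ (recordProg.run s).rat 1 0 := by
  rw [recordProg, run_seq, run_seq, run_setRat]
  set s1 := s.setRat 2 ((NatExp.const 0).eval s) ((RatExp.const 0).eval s) with hs1
  set q : LoopProg := .count 20 (.cond (.nz (.get 8 (.reg 20)))
        (.setRat 2 (.const 0) (.add (.get 2 (.const 0)) (.get 0 (.reg 20)))) .skip) with hq
  have hnat : ∀ A, A ≠ 20 → (q.run s1).nat A = s.nat A := fun A hA => by
    rw [nat_run (by simp [hq, natWrites, hA])]
    rfl
  have hrat : ∀ A, A ≠ 2 → (q.run s1).rat A = s.rat A := fun A hA => by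
    rw [rat_run (by simp [hq, ratWrites, hA]), hs1, Mem.rat_setRat_of_ne _ _ _ hA]
  have hsum : (q.run s1).rat 2 0 = ∑ v ∈ colored n (s.nat 8), w v := by
    rw [colored, sum_filter]
    refine run_for (n := n) (s := s1) hs.graph.size (fun i u => u.rat 2 0 =
      ∑ v ∈ range i, if s.nat 8 v ≠ 0 then w v else 0) ?_ ?_
    · simp [hs1, RatExp.eval, NatExp.eval]
    · intro i hi u hui hf hfr hI
      have h8 : u.nat 8 = s.nat 8 := by
        rw [hf 8 (by simp [natWrites])]
        rfl
      have h0 : u.rat 0 = s.rat 0 := by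
        rw [hfr 0 (by simp [ratWrites]), hs1, Mem.rat_setRat_of_ne _ _ _ (by omega)]
      have htest : (Test.nz (.get 8 (.reg 20))).holds u ↔ s.nat 8 i ≠ 0 := by
        rw [Test.holds_nz, NatExp.eval_get]
        simp only [NatExp.eval, hui, h8]
      rw [Mem.rat_setNat, sum_range_succ]
      by_cases h : s.nat 8 i = 0
      · rw [run_cond_neg (fun h' => htest.1 h' h), run_skip, hI]
        simp [h]
      · rw [run_cond_pos (htest.2 h), run_setRat, if_pos h]
        simp [RatExp.eval, NatExp.eval, hui, hI, h0, hs.weight i hi]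
  set s2 := q.run s1 with hs2
  have htest : (Test.ratLE (.get 2 (.const 0)) (.get 1 (.const 0))).holds s2 ↔
      ∑ v ∈ colored n (s.nat 8), w v ≤ s.rat 1 0 := by
    simp only [Test.holds, RatExp.eval, NatExp.eval, hsum, hrat 1 (by omega)]
  by_cases ht : ∑ v ∈ colored n (s.nat 8), w v ≤ s.rat 1 0
  · rw [run_cond_pos (htest.2 ht), run_skip, hrat 1 (by omega)]
    exact ⟨hsol.congr (hnat 3 (by omega)) (hrat 1 (by omega)), le_rfl, ht⟩
  · rw [run_cond_neg (fun h => ht (htest.1 h)), run_seq, run_setRat]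
    simp only [RatExp.eval, NatExp.eval, hsum]
    set s3 := s2.setRat 1 0 (∑ v ∈ colored n (s.nat 8), w v) with hs3
    have hfin := nat_run_mapProg (C := 3) (s := s3) (n := n) (b := .natLE (.const 0) (.const 0))
      (e := .get 8 (.reg 20)) (f := .get 8 (.reg 20))
      ((congrFun (hnat 0 (by omega)) 0).trans hs.graph.size) (by omega) (s.nat 8) (by
        intro i hi u hui hf _ _
        have : (NatExp.get 8 (.reg 20)).eval u = s.nat 8 i := by
          simp only [NatExp.eval, hui, hf 8 (by omega) (by omega)]
          exact congrFun (hnat 8 (by omega)) i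
        exact ⟨fun _ => this, fun _ => this⟩)
    set s4 := (mapProg 3 (.natLE (.const 0) (.const 0)) (.get 8 (.reg 20)) (.get 8 (.reg 20))).run s3
      with hs4
    have h1 : s4.rat 1 0 = ∑ v ∈ colored n (s.nat 8), w v := by
      rw [hs4, rat_run (by simp [mapProg, ratWrites]), hs3]
      simp
    have hsupp : s4.supp n 3 = colored n (s.nat 8) := by
      ext v
      rw [Mem.mem_supp, mem_colored]
      exact and_congr_right fun hv => by rw [hfin v hv]
    exact ⟨⟨by rw [hsupp]; exact hcol, by rw [hsupp, h1]⟩, by rw [h1]; exact (not_le.1 ht).le,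
      h1.ge⟩

/-- Decode the certificates in memory, and find the best solution within the clusters. -/
def bodyProg (K r : ℕ) : LoopProg := .seq (clustersProg K r) (.seq (matchProg r) recordProg)

theorem natWrites_bodyProg {K r A : ℕ}
    (hA : A ∈ ({0, 1, 2, 4, 6} : Finset ℕ) ∨ ∃ d, A = digitArr d) :
    A ∉ (bodyProg K r).natWrites := by
  have h1 : A < 7 ∧ A ≠ 3 ∨ 100 ≤ A := by
    rcases hA with h | ⟨d, rfl⟩
    · simp only [mem_insert, mem_singleton] at h
      omega
    · simp only [digitArr]
      omega
  have h2 : A ∉ (matchProg r).natWrites := natWrites_matchProg (by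
    simp only [mem_insert, mem_singleton]
    omega)
  have h3 : A ∉ (clustersProg K r).natWrites := by
    rcases hA with h | ⟨d, rfl⟩
    · simp only [mem_insert, mem_singleton] at h
      exact natWrites_clustersProg_of_lt (by omega) (by omega)
    · exact digitArr_notMem_natWrites_clustersProg K r d
  simp only [bodyProg, natWrites, mem_union, natWrites_recordProg, mem_insert, mem_singleton, h2,
    h3, false_or]
  omega

/-- Whatever the digits are, the decoded sets are clusters, so the matching yields a feasible
solution. Conversely, a set encoded by the digits is colorable within these clusters, so its weight
does not exceed that of the optimal matching. -/
theorem run_bodyProg {n r K : ℕ} {B Ls : ℕ → ℕ → Prop} {w : ℕ → ℚ} {s : Mem}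
    (hs : s.HasProblem n r B Ls w) (hsol : s.HasSolution n r B Ls w)
    (hr : ∀ u, B u u) (hsymm : ∀ u v, B u v → B v u) (hw0 : ∀ v < n, 0 ≤ w v)
    (hd : ∀ d < 5 * K * r, s.digits 0 d < n) :
    ((bodyProg K r).run s).HasProblem n r B Ls w ∧ ((bodyProg K r).run s).HasSolution n r B Ls w ∧
      s.rat 1 0 ≤ ((bodyProg K r).run s).rat 1 0 ∧
      ∀ F, IsEncoded n r K B Ls (s.digits 0) F →
        ∑ v ∈ F, w v ≤ ((bodyProg K r).run s).rat 1 0 := by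
  have hclu := fun c (hc : c < r) => mem_supp_run_clustersProg hs hr hsymm le_rfl hd hc
  have hrat1 : ((clustersProg K r).run s).rat = s.rat := rat_run_clustersProg s
  have hP1 : ((clustersProg K r).run s).HasProblem n r B Ls w := hs.congr (fun A hA => by
    refine nat_run (natWrites_clustersProg_of_lt ?_ ?_) s <;>
    · simp only [mem_insert, mem_singleton] at hA
      omega) (congrFun hrat1 0)
  have hP : ((bodyProg K r).run s).HasProblem n r B Ls w :=
    hs.congr (fun A hA => nat_run (natWrites_bodyProg (.inl hA)) s) (by
      rw [bodyProg, run_seq, run_seq, rat_run (by simp [recordProg, mapProg, ratWrites]),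
        rat_run (by simp [ratWrites_matchProg]), hrat1])
  refine ⟨hP, ?_⟩
  rw [bodyProg, run_seq, run_seq]
  set s1 := (clustersProg K r).run s with hs1
  -- Colors are shifted by one, since `0` stands for uncolored.
  set Al : ℕ → ℕ → Prop := fun v x => ∃ c < r, x = c + 1 ∧ v ∈ s1.supp n (clusterArr c) with hAl
  have hE : s1.MatchEnv n r B Al := ⟨hP1.graph, fun v hv x => by simp [hAl, Mem.mem_supp, hv]⟩
  have hB : IsColorSystem B Al := by
    refine ⟨hr, hsymm, fun v => by simp [hAl], ?_⟩
    rintro _ x y z ⟨c, hc, rfl, hx⟩ ⟨c', hc', h', hy⟩ ⟨c'', hc'', h'', hz⟩ hxy hyz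
    obtain rfl : c = c' := by omega
    obtain rfl : c = c'' := by omega
    exact IsCluster.decode hsymm n _ K _ x ((hclu c hc x).1 hx).2.1 y ((hclu c hc y).1 hy).2.1
      z ((hclu c hc z).1 hz).2.1 hxy hyz
  obtain ⟨hcol, hopt⟩ := run_matchProg hB hE hP1.weight hw0
  set s2 := (matchProg r).run s1 with hs2
  have hs2' : ∀ A, A < 7 → s2.nat A = s1.nat A := fun A hA => nat_run (natWrites_matchProg (by
    simp only [mem_insert, mem_singleton]
    omega)) s1
  have hrat2 : s2.rat = s1.rat := funext fun A => rat_run (by simp [ratWrites_matchProg]) s1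
  have hP2 : s2.HasProblem n r B Ls w := hP1.congr (fun A hA => by
    refine hs2' A ?_
    simp only [mem_insert, mem_singleton] at hA
    omega) (congrFun hrat2 0)
  have hsol2 : s2.HasSolution n r B Ls w := hsol.congr
    (by rw [hs2' 3 (by omega), hs1, nat_run (natWrites_clustersProg_of_lt (by omega) (by omega))])
    (by rw [hrat2, hrat1])
  obtain ⟨h1, h2, h3⟩ := run_recordProg hP2 hsol2 ⟨fun v => s2.nat 8 v - 1, by
    have hc : ∀ v ∈ colored n (s2.nat 8), ∃ c < r, s2.nat 8 v = c + 1 ∧ Ls v c := by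
      intro v hv
      obtain ⟨hvn, hv0⟩ := mem_colored.1 hv
      obtain ⟨c, hc, hvc, hmem⟩ := hcol.allowed v hvn hv0
      exact ⟨c, hc, hvc, ((hclu c hc v).1 hmem).2.2⟩
    refine ⟨fun v hv => ?_, fun v hv => ?_, fun u hu v hv huv hadj => ?_⟩
    · obtain ⟨c, hc, h, -⟩ := hc v hv
      simpa [h] using hc
    · obtain ⟨c, hc, h, hl⟩ := hc v hv
      simpa [h] using hl
    · obtain ⟨c, -, h, -⟩ := hc u hu
      obtain ⟨c', -, h', -⟩ := hc v hv
      refine hcol.inj u (mem_colored.1 hu).1 v (mem_colored.1 hv).1 ?_ (mem_colored.1 hu).2 hadj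
      have huv' : s2.nat 8 u - 1 = s2.nat 8 v - 1 := huv
      omega⟩
  rw [hrat2, hrat1] at h2
  refine ⟨h1, h2, fun F hF => le_trans (hopt F ?_) h3⟩
  obtain ⟨hFn, φ, hφ, hdec⟩ := hF
  have hcolF : ∀ v ∈ F, v ∈ s1.supp n (clusterArr (φ v)) := fun v hv =>
    (hclu (φ v) (hφ.lt v hv) v).2 ⟨mem_range.1 (hFn hv), by
      have e : s.digits (5 * K * φ v) = fun d => s.digits 0 (5 * K * φ v + d) := by
        funext d
        simp [Mem.digits]
      rw [e]
      exact hdec v hv, hφ.mem v hv⟩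
  classical
  refine ⟨hFn, fun v => if v ∈ F then φ v + 1 else 0, ⟨fun v hv hv0 => ?_,
    fun u hu v hv huv hu0 hadj => ?_⟩, fun v hv => by simp [hv]⟩
  · by_cases hvF : v ∈ F
    · simp only [hvF, if_true]
      exact ⟨φ v, hφ.lt v hvF, rfl, hcolF v hvF⟩
    · simp [hvF] at hv0
  · by_cases huF : u ∈ F
    · by_cases hvF : v ∈ F
      · simp only [huF, hvF, if_true, Nat.add_right_cancel_iff] at huv
        exact hφ.inj u huF v hvF huv hadj
      · simp [huF, hvF] at huv
    · simp [huF] at hu0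

/-- Run `p` for all values of the digits `0`, …, `D - 1`. -/
def nest (p : LoopProg) : ℕ → LoopProg
  | 0 => p
  | D + 1 => .count (digitArr D) (nest p D)

theorem digitArr_injective {d d' : ℕ} (h : digitArr d = digitArr d') : d = d' := by
  simp only [digitArr] at h
  omega

theorem natWrites_nest {p : LoopProg} {D A : ℕ} (h : A ∈ (nest p D).natWrites) :
    A ∈ p.natWrites ∨ ∃ d < D, A = digitArr d := by
  induction D with
  | zero => exact .inl h
  | succ D ih =>
    rcases mem_insert.1 h with h | h
    · exact .inr ⟨D, by omega, h⟩
    · exact (ih h).imp id fun ⟨d, hd, h⟩ => ⟨d, by omega, h⟩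

/-- The colors are less than `r`, and each one reads its own block of `5 * K` digits. -/
theorem IsEncoded_digits_congr {n r K : ℕ} {B Ls : ℕ → ℕ → Prop} {g g' : ℕ → ℕ} {F : Finset ℕ}
    (h : IsEncoded n r K B Ls g F) (hg : ∀ d < 5 * K * r, g d = g' d) :
    IsEncoded n r K B Ls g' F := by
  obtain ⟨hF, φ, hφ, hdec⟩ := h
  refine ⟨hF, φ, hφ, fun v hv => ?_⟩
  have h1 := hdec v hv
  rwa [decode, seed_congr n (g' := fun d => g' (5 * K * φ v + d)) (fun d hd => hg _ ?_)] at h1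
  have h2 : 5 * K * (φ v + 1) ≤ 5 * K * r := Nat.mul_le_mul_left _ (hφ.lt v hv)
  rw [Nat.mul_succ] at h2
  omega

/-- The digits below `D` range over all values, those from `D` on are fixed in memory; each further
loop frees one digit. The recorded weight never decreases, so a bound reached in one round persists.
-/
theorem run_nest {n r K : ℕ} {B Ls : ℕ → ℕ → Prop} {w : ℕ → ℚ} (hr : ∀ u, B u u)
    (hsymm : ∀ u v, B u v → B v u) (hw0 : ∀ v < n, 0 ≤ w v) {D : ℕ} (hD : D ≤ 5 * K * r) {s : Mem}
    (hs : s.HasProblem n r B Ls w) (hsol : s.HasSolution n r B Ls w)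
    (hd : ∀ d, D ≤ d → d < 5 * K * r → s.digits 0 d < n) :
    ((nest (bodyProg K r) D).run s).HasProblem n r B Ls w ∧
      ((nest (bodyProg K r) D).run s).HasSolution n r B Ls w ∧
      s.rat 1 0 ≤ ((nest (bodyProg K r) D).run s).rat 1 0 ∧
      ∀ g : ℕ → ℕ, (∀ d < D, g d < n) → (∀ d, D ≤ d → d < 5 * K * r → g d = s.digits 0 d) →
        ∀ F, IsEncoded n r K B Ls g F →
          ∑ v ∈ F, w v ≤ ((nest (bodyProg K r) D).run s).rat 1 0 := by
  induction D generalizing s with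
  | zero =>
    obtain ⟨h1, h2, h3, h4⟩ := run_bodyProg hs hsol hr hsymm hw0 fun d => hd d (Nat.zero_le d)
    exact ⟨h1, h2, h3, fun g _ hg F hF =>
      h4 F (IsEncoded_digits_congr hF fun d hd => hg d (Nat.zero_le d) hd)⟩
  | succ D ih =>
    have hx : ∀ (u : Mem) (j : ℕ) (A : ℕ), A ≠ digitArr D →
        (u.setNat (digitArr D) 0 j).nat A = u.nat A := fun u j A hA =>
      Mem.nat_setNat_of_ne _ _ _ hA
    have hsmall : ∀ A, A < 50 → A ≠ digitArr D := fun A hA => by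
      simp only [digitArr]
      omega
    have hPset : ∀ (u : Mem) (j : ℕ), u.HasProblem n r B Ls w →
        (u.setNat (digitArr D) 0 j).HasProblem n r B Ls w := fun u j hu =>
      hu.congr (fun A hA => hx u j A (hsmall A (by
        simp only [mem_insert, mem_singleton] at hA
        omega))) rfl
    have hSset : ∀ (u : Mem) (j : ℕ), u.HasSolution n r B Ls w →
        (u.setNat (digitArr D) 0 j).HasSolution n r B Ls w := fun u j hu =>
      hu.congr (hx u j 3 (hsmall 3 (by omega))) rfl
    have key := run_for (x := digitArr D) (p := nest (bodyProg K r) D) hs.graph.size (fun i u =>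
      u.HasProblem n r B Ls w ∧ u.HasSolution n r B Ls w ∧
      (∀ d, D < d → u.digits 0 d = s.digits 0 d) ∧ s.rat 1 0 ≤ u.rat 1 0 ∧
      ∀ g : ℕ → ℕ, (∀ d < D, g d < n) → g D < i →
        (∀ d, D < d → d < 5 * K * r → g d = s.digits 0 d) →
        ∀ F, IsEncoded n r K B Ls g F → ∑ v ∈ F, w v ≤ u.rat 1 0) ?_ ?_
    · obtain ⟨h1, h2, -, h3, h4⟩ := key
      exact ⟨h1, h2, h3, fun g hg hg' => h4 g (fun d hd => hg d (by omega)) (hg D (by omega))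
        fun d hd => hg' d hd⟩
    · refine ⟨hPset s 0 hs, hSset s 0 hsol, fun d hd' => ?_, le_rfl, fun g _ h => by omega⟩
      rw [Mem.digits, Mem.digits, Nat.zero_add, hx]
      intro h
      have := digitArr_injective h
      omega
    · intro i hi u hui _ _ ⟨h1, h2, h3, h4, h5⟩
      have hDi : u.digits 0 D = i := by
        rw [Mem.digits, Nat.zero_add, hui]
      obtain ⟨k1, k2, k3, k4⟩ := ih (by omega) h1 h2 (fun d hd1 hd2 => by
        rcases Nat.lt_or_eq_of_le hd1 with h | rfl
        · rw [h3 d h]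
          exact hd d h hd2
        · rw [hDi]
          exact hi)
      refine ⟨hPset _ _ k1, hSset _ _ k2, fun d hd' => ?_, h4.trans k3, fun g hg hgi hg' F hF => ?_⟩
      · rw [← h3 d hd', Mem.digits, Mem.digits, Nat.zero_add, hx _ _ _ (fun h => by
          have := digitArr_injective h
          omega), nat_run]
        intro h
        rcases natWrites_nest h with h | ⟨d', hd'', h⟩
        · exact natWrites_bodyProg (.inr ⟨d, rfl⟩) h
        · have := digitArr_injective h
          omega
      · rcases Nat.lt_succ_iff_lt_or_eq.1 hgi with h | h
        · exact (h5 g hg h hg' F hF).trans k3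
        · refine k4 g hg (fun d hd1 hd2 => ?_) F hF
          rcases Nat.lt_or_eq_of_le hd1 with h' | rfl
          · rw [h3 d h', hg' d h' hd2]
          · rw [hDi, h]

end LoopProg

/-! ### Preparation of the input and correctness of the main program -/

namespace LoopProg

/-- Compute the positions of the rows of the matrices, make the adjacency relation reflexive, and
store the empty solution. -/
def prepareProg (r : ℕ) : LoopProg :=
  .seq (.setNat 5 (.const 0) (.const 0))
    (.seq (.setNat 17 (.const 0) (.const 0))
      (.seq
        (.count 20 (.seq (.setNat 4 (.reg 20) (.reg 5))
          (.seq (.setNat 6 (.reg 20) (.reg 17))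
            (.seq (.setNat 1 (.add (.reg 5) (.reg 20)) (.const 1))
              (.seq (.setNat 5 (.const 0) (.add (.reg 5) (.reg 0)))
                (.setNat 17 (.const 0) (.add (.reg 17) (.const r))))))))
        (.seq (fillProg 3 0) (.setRat 1 (.const 0) (.const 0)))))

/-- Uniqueness of quotient and remainder: distinct matrix entries have distinct positions. -/
theorem eq_and_eq_of_mul_add_eq {n i j i' j' : ℕ} (hj : j < n) (hj' : j' < n)
    (h : i * n + j = i' * n + j') : i = i' ∧ j = j' := by
  have hn : 0 < n := by omega
  have h1 := congrArg (· / n) h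
  have h2 := congrArg (· % n) h
  simp only [mul_comm _ n, Nat.mul_add_div hn, Nat.mul_add_mod, Nat.div_eq_of_lt hj,
    Nat.div_eq_of_lt hj', Nat.mod_eq_of_lt hj, Nat.mod_eq_of_lt hj', Nat.add_zero] at h1 h2
  exact ⟨h1, h2⟩

theorem run_prepareProg {n r : ℕ} {A Ls : ℕ → ℕ → Prop} {w : ℕ → ℚ} {s : Mem}
    (hs : s.HasInput n r A Ls w) :
    ((prepareProg r).run s).HasProblem n r (fun u v => u = v ∨ A u v) Ls w ∧
      ((prepareProg r).run s).HasSolution n r (fun u v => u = v ∨ A u v) Ls w := by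
  classical
  rw [prepareProg]
  simp only [run_seq, run_setNat, run_setRat]
  set s1 := (s.setNat 5 ((NatExp.const 0).eval s) ((NatExp.const 0).eval s)) with hs1
  set s2 := s1.setNat 17 ((NatExp.const 0).eval s1) ((NatExp.const 0).eval s1) with hs2
  have hs2' : ∀ a, a ≠ 5 → a ≠ 17 → s2.nat a = s.nat a := fun a h1 h2 => by
    rw [hs2, Mem.nat_setNat_of_ne _ _ _ h2, hs1, Mem.nat_setNat_of_ne _ _ _ h1]
  have h25 : s2.nat 5 0 = 0 := by
    rw [hs2, Mem.nat_setNat_of_ne _ _ _ (by omega)]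
    simp [hs1, NatExp.eval]
  have h217 : s2.nat 17 0 = 0 := by simp [hs2, NatExp.eval]
  set q : LoopProg := .count 20 (.seq (.setNat 4 (.reg 20) (.reg 5))
          (.seq (.setNat 6 (.reg 20) (.reg 17))
            (.seq (.setNat 1 (.add (.reg 5) (.reg 20)) (.const 1))
              (.seq (.setNat 5 (.const 0) (.add (.reg 5) (.reg 0)))
                (.setNat 17 (.const 0) (.add (.reg 17) (.const r))))))) with hq
  have key : (q.run s2).nat 5 0 = n * n ∧ (q.run s2).nat 17 0 = n * r ∧
      (∀ v < n, (q.run s2).nat 4 v = v * n ∧ (q.run s2).nat 6 v = v * r) ∧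
      ∀ u < n, ∀ v < n, (q.run s2).nat 1 (u * n + v) =
        if u = v ∧ u < n then 1 else s.nat 1 (u * n + v) := by
    -- Registers 5 and 17 are running multiples of `n` and `r`; they replace the missing
    -- multiplication.
    refine run_for (n := n) (by rw [hs2' 0 (by omega) (by omega), hs.size]) (fun i u =>
      u.nat 5 0 = i * n ∧ u.nat 17 0 = i * r ∧
      (∀ v < i, u.nat 4 v = v * n ∧ u.nat 6 v = v * r) ∧
      ∀ x < n, ∀ y < n, u.nat 1 (x * n + y) =
        if x = y ∧ x < i then 1 else s.nat 1 (x * n + y)) ?_ ?_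
    · have e : ∀ a, a ≠ 20 → (s2.setNat 20 0 0).nat a = s2.nat a := fun a h =>
        Mem.nat_setNat_of_ne _ _ _ h
      rw [e 5 (by omega), e 17 (by omega), e 1 (by omega), h25, h217,
        hs2' 1 (by omega) (by omega)]
      simp
    · intro i hi u hui hf _ ⟨h5, h17, h46, h1⟩
      have h0 : u.nat 0 0 = n := by
        rw [hf 0 (by simp [natWrites]), hs2' 0 (by omega) (by omega), hs.size]
      simp only [run_seq, run_setNat]
      set u1 := u.setNat 4 ((NatExp.reg 20).eval u) ((NatExp.reg 5).eval u) with hu1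
      have e1 : ∀ a, a ≠ 4 → u1.nat a = u.nat a := fun a h => Mem.nat_setNat_of_ne _ _ _ h
      set u2 := u1.setNat 6 ((NatExp.reg 20).eval u1) ((NatExp.reg 17).eval u1) with hu2
      have e2 : ∀ a, a ≠ 6 → u2.nat a = u1.nat a := fun a h => Mem.nat_setNat_of_ne _ _ _ h
      set u3 := u2.setNat 1 ((NatExp.add (.reg 5) (.reg 20)).eval u2) ((NatExp.const 1).eval u2)
        with hu3
      have e3 : ∀ a, a ≠ 1 → u3.nat a = u2.nat a := fun a h => Mem.nat_setNat_of_ne _ _ _ h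
      set u4 := u3.setNat 5 ((NatExp.const 0).eval u3) ((NatExp.add (.reg 5) (.reg 0)).eval u3)
        with hu4
      have e4 : ∀ a, a ≠ 5 → u4.nat a = u3.nat a := fun a h => Mem.nat_setNat_of_ne _ _ _ h
      set u5 := u4.setNat 17 ((NatExp.const 0).eval u4) ((NatExp.add (.reg 17) (.const r)).eval u4)
        with hu5
      have e5 : ∀ a, a ≠ 17 → u5.nat a = u4.nat a := fun a h => Mem.nat_setNat_of_ne _ _ _ h
      have e6 : ∀ a, a ≠ 20 → (u5.setNat 20 0 (i + 1)).nat a = u5.nat a := fun a h =>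
        Mem.nat_setNat_of_ne _ _ _ h
      have f5 : u5.nat 5 0 = (i + 1) * n := by
        rw [e5 5 (by omega), hu4]
        simp [NatExp.eval, e3, e2, e1, h5, h0, Nat.succ_mul]
      have f17 : u5.nat 17 0 = (i + 1) * r := by
        rw [hu5]
        simp [NatExp.eval, e4, e3, e2, e1, h17, Nat.succ_mul]
      have f4 : ∀ v, u5.nat 4 v = if v = i then i * n else u.nat 4 v := by
        intro v
        rw [e5 4 (by omega), e4 4 (by omega), e3 4 (by omega), e2 4 (by omega), hu1]
        simp [NatExp.eval, hui, h5]
      have f6 : ∀ v, u5.nat 6 v = if v = i then i * r else u.nat 6 v := by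
        intro v
        rw [e5 6 (by omega), e4 6 (by omega), e3 6 (by omega), hu2]
        simp [NatExp.eval, e1, hui, h17]
      have f1 : ∀ a, u5.nat 1 a = if a = i * n + i then 1 else u.nat 1 a := by
        intro a
        rw [e5 1 (by omega), e4 1 (by omega), hu3]
        simp [NatExp.eval, e2, e1, hui, h5]
      rw [e6 5 (by omega), e6 17 (by omega), e6 4 (by omega), e6 6 (by omega), e6 1 (by omega)]
      refine ⟨f5, f17, fun v hv => ?_, fun x hx y hy => ?_⟩
      · rw [f4, f6]
        by_cases hvi : v = i
        · simp [hvi]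
        · simpa [hvi] using h46 v (by omega)
      · rw [f1, h1 x hx y hy]
        by_cases hxy : x = i ∧ y = i
        · obtain ⟨rfl, rfl⟩ := hxy
          simp
        · have h2 : ¬ x * n + y = i * n + i := fun h => hxy (eq_and_eq_of_mul_add_eq hy hi h)
          rw [if_neg h2]
          have h3 : x = y ∧ x < i + 1 ↔ x = y ∧ x < i := by omega
          simp only [h3]
  set s3 := q.run s2 with hs3
  have hs3' : ∀ a, a ∉ ({1, 4, 5, 6, 17, 20} : Finset ℕ) → s3.nat a = s.nat a := by
    intro a ha
    simp only [mem_insert, mem_singleton, not_or] at ha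
    rw [hs3, nat_run (by simp [hq, natWrites, ha]), hs2' a (by omega) (by omega)]
  set s4 := (fillProg 3 0).run s3 with hs4
  have hs4' : ∀ a, a ≠ 20 → a ≠ 3 → s4.nat a = s3.nat a := fun a h1 h2 =>
    nat_run (by simp [fillProg, natWrites_mapProg, h1, h2]) s3
  have hrat4 : s4.rat = s.rat := by
    funext a
    rw [hs4, rat_run (by simp [fillProg, mapProg, ratWrites]), hs3,
      rat_run (by simp [hq, ratWrites])]
    rfl
  set s5 := s4.setRat 1 ((NatExp.const 0).eval s4) ((RatExp.const 0).eval s4) with hs5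
  have hs5' : ∀ a, a ≠ 20 → a ≠ 3 → s5.nat a = s3.nat a := hs4'
  refine ⟨⟨⟨?_, ?_, ?_, ?_⟩, ?_, ?_, ?_⟩, ⟨fun _ => 0, ?_⟩, ?_⟩
  · rw [hs5' 0 (by omega) (by omega), hs3' 0 (by simp), hs.size]
  · rw [hs5' 4 (by omega) (by omega)]
    exact fun v hv => (key.2.2.1 v hv).1
  · intro u hu v hv
    rw [hs5' 1 (by omega) (by omega), key.2.2.2 u hu v hv]
    by_cases huv : u = v
    · simp [huv, hv]
    · simpa [huv] using hs.adj u hu v hv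
  · intro u hu v hv
    rw [hs5' 1 (by omega) (by omega), key.2.2.2 u hu v hv]
    split_ifs
    exacts [le_rfl, hs.adj_le u hu v hv]
  · rw [hs5' 6 (by omega) (by omega)]
    exact fun v hv => (key.2.2.1 v hv).2
  · rw [hs5' 2 (by omega) (by omega), hs3' 2 (by simp)]
    exact hs.list
  · rw [hs5, Mem.rat_setRat_of_ne _ _ _ (by omega), hrat4]
    exact hs.weight
  all_goals
    have hempty : s5.supp n 3 = ∅ := by
      ext v
      simp only [Mem.mem_supp, notMem_empty, iff_false, not_and, not_not]
      exact nat_run_fillProg (by rw [hs3' 0 (by simp), hs.size]) (by omega) v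
    rw [hempty]
  · exact ⟨by simp, by simp, by simp⟩
  · simp [hs5, RatExp.eval, NatExp.eval]

/-- The program for Max-Weight List `r`-Colorable Induced Subgraph on graphs without packing of
`K + 1` induced paths on three vertices. -/
def mainProg (K r : ℕ) : LoopProg := .seq (prepareProg r) (nest (bodyProg K r) (5 * K * r))

/-- Each color class of a feasible set is independent, hence lies in the cluster of some
certificate. The enumeration reaches the concatenation of these certificates. -/
theorem run_mainProg {n r K : ℕ} {A Ls : ℕ → ℕ → Prop} {w : ℕ → ℚ} {s : Mem}
    (hs : s.HasInput n r A Ls w) (hA : ∀ u v, A u v → A v u) (hw0 : ∀ v < n, 0 ≤ w v)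
    (hfree : ¬ HasPacking (fun u v => u = v ∨ A u v) (K + 1) (range n : Finset ℕ)) :
    (∃ φ, IsListColoring r (fun u v => u = v ∨ A u v) Ls (((mainProg K r).run s).supp n 3) φ) ∧
      ∀ F ⊆ range n, (∃ φ, IsListColoring r (fun u v => u = v ∨ A u v) Ls F φ) →
        ∑ v ∈ F, w v ≤ ∑ v ∈ ((mainProg K r).run s).supp n 3, w v := by
  obtain ⟨h1, h2⟩ := run_prepareProg hs
  have hr : ∀ u, (fun u v => u = v ∨ A u v) u u := fun u => .inl rfl
  have hsymm : ∀ u v, (fun u v => u = v ∨ A u v) u v → (fun u v => u = v ∨ A u v) v u :=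
    fun u v h => h.imp Eq.symm (hA u v)
  obtain ⟨-, h3, -, h4⟩ := run_nest hr hsymm hw0 le_rfl h1 h2 fun d hd hd' => by omega
  rw [mainProg, run_seq]
  refine ⟨h3.feasible, fun F hFn ⟨φ, hφ⟩ => ?_⟩
  rw [← h3.weight]
  -- With no vertices there are no digits less than `n`, so the empty graph is treated apart.
  rcases Nat.eq_zero_or_pos n with hn | hn
  · rw [h3.weight]
    have : F = ∅ := subset_empty.1 (by simpa [hn] using hFn)
    rw [this, sum_empty]
    exact sum_nonneg fun v hv => hw0 v (Mem.mem_supp.1 hv).1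
  have hcert : ∀ c, ∃ g : ℕ → ℕ, (∀ d, g d < n) ∧ {v | v ∈ F ∧ φ v = c} ∩ (range n : Finset ℕ) ⊆
      decode (fun u v => u = v ∨ A u v) n g K (range n : Finset ℕ) := by
    intro c
    obtain ⟨g, hg, -, hgI⟩ := exists_certificate hr hsymm hn (I := {v | v ∈ F ∧ φ v = c})
      (fun x hx y hy hxy => hφ.inj x hx.1 y hy.1 (hx.2.trans hy.2.symm) hxy) K
      (U := (range n : Finset ℕ)) (fun u hu => by simpa using hu) hfree
    exact ⟨g, hg, hgI⟩
  choose g hg hgI using hcert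
  -- Quotient and remainder split a position into the color and the digit of its certificate.
  refine h4 (fun d => g (d / (5 * K)) (d % (5 * K))) (fun d _ => hg _ _)
    (fun d hd hd' => by omega) F ⟨hFn, φ, hφ, fun v hv => ?_⟩
  have hmem := hgI (φ v) ⟨⟨hv, rfl⟩, by simpa using hFn hv⟩
  rwa [decode, seed_congr n (g' := fun d => g ((5 * K * φ v + d) / (5 * K))
    ((5 * K * φ v + d) % (5 * K))) (fun d hd => by
      rw [Nat.mul_add_div (by omega), Nat.mul_add_mod, Nat.div_eq_of_lt hd, Nat.mod_eq_of_lt hd,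
        Nat.add_zero])] at hmem

end LoopProg

/-! ## Running times -/

namespace LoopProg

/-- A program with `WF`, bounded constants, bounded weight and bounded depth. -/
structure Bounded (b W d : ℕ) (p : LoopProg) : Prop where
  wf : p.WF
  const : p.compile.ConstLT b
  weight_le : p.weight ≤ W
  depth_le : p.depth ≤ d

section
variable {b : ℕ}

theorem Bounded.seq {W W' d : ℕ} {p q : LoopProg} (hp : p.Bounded b W d) (hq : q.Bounded b W' d) :
    (LoopProg.seq p q).Bounded b (W + W') d where
  wf := ⟨hp.wf, hq.wf⟩
  const := ⟨hp.const, hq.const⟩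
  weight_le := Nat.add_le_add hp.weight_le hq.weight_le
  depth_le := max_le hp.depth_le hq.depth_le

theorem Bounded.mono {W W' d d' : ℕ} {p : LoopProg} (hp : p.Bounded b W d) (hW : W ≤ W')
    (hd : d ≤ d') : p.Bounded b W' d' :=
  ⟨hp.wf, hp.const, hp.weight_le.trans hW, hp.depth_le.trans hd⟩

theorem Bounded.cond {W W' d : ℕ} {t : Test} {p q : LoopProg} (ht : t.ConstLT b)
    (hp : p.Bounded b W d) (hq : q.Bounded b W' d) :
    (LoopProg.cond t p q).Bounded b (1 + t.steps + W + W') d where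
  wf := ⟨hp.wf, hq.wf⟩
  const := ⟨ht, hp.const, hq.const⟩
  weight_le := by
    have := hp.weight_le
    have := hq.weight_le
    simp only [weight]
    omega
  depth_le := max_le hp.depth_le hq.depth_le

theorem Bounded.count {W d x : ℕ} (hb : 1 ≤ b) {p : LoopProg} (hx : x ≠ 0) (hxp : x ∉ p.natWrites)
    (hp : p.Bounded b W d) : (LoopProg.count x p).Bounded b (W + 16) (d + 1) where
  wf := ⟨hx, hxp, hp.wf⟩
  const := by
    have h1 : 1 < 2 ^ b := Nat.one_lt_two_pow (by omega)
    have h0 : 0 < 2 ^ b := by omega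
    simp [compile, Prog.ConstLT, Test.ConstLT, NatExp.ConstLT, hp.const, h0, h1]
  weight_le := Nat.add_le_add_right hp.weight_le 16
  depth_le := Nat.add_le_add_right hp.depth_le 1

theorem Bounded.skip (b d : ℕ) : LoopProg.skip.Bounded b 1 d :=
  ⟨trivial, trivial, le_rfl, Nat.zero_le d⟩

theorem Bounded.unroll {f : ℕ → LoopProg} {r W d : ℕ} (h : ∀ c < r, (f c).Bounded b W d) :
    (LoopProg.unroll f r).Bounded b (W * r + 1) d := by
  induction r with
  | zero => exact (Bounded.skip b d).mono (by omega) le_rfl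
  | succ r ih =>
    exact ((ih fun c hc => h c (by omega)).seq (h r (by omega))).mono
      (by rw [Nat.mul_succ]; omega) le_rfl

theorem bounded_sweepProg (hb : 1 ≤ b) {U C : ℕ} (hC : 50 ≤ C) : (sweepProg U C).Bounded b 200 3 := by
  have h1 : 1 < 2 ^ b := Nat.one_lt_two_pow (by omega)
  have h0 : 0 < 2 ^ b := by omega
  refine ⟨?_, ?_, ?_, ?_⟩
  · simp [sweepProg, WF, natWrites]
    omega
  · simp [sweepProg, compile, Prog.ConstLT, Test.ConstLT, NatExp.ConstLT, h0, h1]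
  · simp [sweepProg, weight, NatExp.steps, Test.steps]
  · simp [sweepProg, depth]

theorem bounded_mapProg (hb : 1 ≤ b) {C : ℕ} (hC0 : C ≠ 0) (hC : C ≠ 20) {t : Test} {e f : NatExp}
    (ht : t.ConstLT b) (he : e.ConstLT b) (hf : f.ConstLT b) :
    (mapProg C t e f).Bounded b (23 + t.steps + e.steps + f.steps) 1 := by
  have h1 : 1 < 2 ^ b := Nat.one_lt_two_pow (by omega)
  have h0 : 0 < 2 ^ b := by omega
  refine ⟨?_, ?_, ?_, ?_⟩
  · simp [mapProg, WF, natWrites, hC0, hC.symm]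
  · simp [mapProg, compile, Prog.ConstLT, Test.ConstLT, NatExp.ConstLT, h0, h1, ht, he, hf]
  · simp only [mapProg, weight, NatExp.steps]
    omega
  · simp [mapProg, depth]

theorem bounded_fillProg (hb : 1 ≤ b) {C c : ℕ} (hC0 : C ≠ 0) (hC : C ≠ 20) (hc : c < 2 ^ b) :
    (fillProg C c).Bounded b 28 1 :=
  (bounded_mapProg hb hC0 hC (t := .natLE (.const 0) (.const 0)) (e := .const c) (f := .const c)
    ⟨Nat.two_pow_pos b, Nat.two_pow_pos b⟩ hc hc).mono
    (by simp [NatExp.steps, Test.steps]) le_rfl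

theorem bounded_residualProg (hb : 1 ≤ b) {V U v x y : ℕ} (hV : 50 ≤ V) :
    (residualProg V U v x y).Bounded b 100 1 := by
  have h1 : 1 < 2 ^ b := Nat.one_lt_two_pow (by omega)
  have h0 : 0 < 2 ^ b := by omega
  refine (bounded_mapProg hb (by omega) (by omega) ?_ ?_ ?_).mono
    (by simp [NatExp.steps, Test.steps]) le_rfl <;>
  simp [Test.ConstLT, NatExp.ConstLT, h0, h1]

theorem bounded_setNat {A : ℕ} {i e : NatExp} (hA : A ≠ 0) (hi : i.ConstLT b) (he : e.ConstLT b)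
    (d : ℕ) : (LoopProg.setNat A i e).Bounded b (1 + i.steps + e.steps) d :=
  ⟨hA, ⟨hi, he⟩, le_rfl, Nat.zero_le d⟩

theorem bounded_isolateProg (hb : 1 ≤ b) {C a : ℕ} (hC : 50 ≤ C) :
    (isolateProg C a).Bounded b 100 1 := by
  have h1 : 1 < 2 ^ b := Nat.one_lt_two_pow (by omega)
  have h0 : 0 < 2 ^ b := by omega
  refine ((bounded_mapProg hb (by omega) (by omega) ?_ ?_ ?_).seq
    (bounded_setNat (by omega) ?_ ?_ 1)).mono (by simp [NatExp.steps, Test.steps]) le_rfl <;>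
  simp [Test.ConstLT, NatExp.ConstLT, h0, h1]

theorem bounded_decodeProg (hb : 1 ≤ b) (c β m : ℕ) :
    (decodeProg (clusterArr c) β m).Bounded b (900 * (m + 1)) 3 := by
  have h1 : 1 < 2 ^ b := Nat.one_lt_two_pow (by omega)
  have h0 : 0 < 2 ^ b := by omega
  have hc : 100 ≤ clusterArr c := Nat.le_add_right 100 (3 * c)
  have hl : ∀ j, 100 ≤ levelArr j := fun j => by simp only [levelArr]; omega
  have ht : ∀ x y, (Test.natEq (.reg x) (.reg y)).ConstLT b := fun x y => by
    simp [Test.ConstLT, NatExp.ConstLT, h0]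
  induction m with
  | zero =>
    exact (((bounded_fillProg hb (by omega) (by omega) h0).mono le_rfl (by omega)).seq
      (bounded_sweepProg hb (by omega))).mono (by omega) le_rfl
  | succ m ih =>
    have hm := hl m
    have hiso : ∀ a, (isolateProg (clusterArr c) a).Bounded b 100 3 := fun a =>
      (bounded_isolateProg hb (by omega)).mono le_rfl (by omega)
    have hmap := bounded_mapProg (b := b) hb (C := levelArr m) (by omega) (by omega)
      (t := .natLE (.const 0) (.const 0)) (e := .get (levelArr (m + 1)) (.reg 20))
      (f := .get (levelArr (m + 1)) (.reg 20)) ⟨h0, h0⟩ (by simp [NatExp.ConstLT, h0])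
      (by simp [NatExp.ConstLT, h0])
    exact ((((hmap.mono le_rfl (by omega)).cond (ht _ _)
      ((bounded_residualProg hb (by omega)).mono le_rfl (by omega))).seq
      (ih.seq (((Bounded.skip b 3).cond (ht _ _)
        ((hiso _).seq ((hiso _).seq (hiso _)))).seq (bounded_sweepProg hb (by omega)))))).mono (by
          simp only [Test.steps, NatExp.steps]
          omega) le_rfl

theorem bounded_clusterProg {K c : ℕ} (hb : 1 ≤ b) (hc : c < 2 ^ b) :
    (clusterProg K c).Bounded b (1000 * (K + 1)) 3 := by
  have h1 : 1 < 2 ^ b := Nat.one_lt_two_pow (by omega)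
  have h0 : 0 < 2 ^ b := by omega
  have hca : 100 ≤ clusterArr c := Nat.le_add_right 100 (3 * c)
  have hl : 100 ≤ levelArr K := by simp only [levelArr]; omega
  refine (((bounded_fillProg hb (by omega) (by omega) h1).mono le_rfl (by omega)).seq
    ((bounded_decodeProg hb c _ K).seq ((bounded_mapProg hb (by omega) (by omega) ?_ ?_ ?_).mono
      le_rfl (by omega)))).mono (by
        simp only [Test.steps, NatExp.steps]
        omega) le_rfl <;>
  simp [Test.ConstLT, NatExp.ConstLT, h0, h1, hc]

theorem bounded_scanProg {c : ℕ} (hc : c + 1 < 2 ^ b) : (scanProg c).Bounded b 100 1 := by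
  have h1 : 1 < 2 ^ b := by omega
  have h0 : 0 < 2 ^ b := by omega
  refine ⟨?_, ?_, ?_, ?_⟩
  · simp [scanProg, WF, natWrites]
  · simp [scanProg, compile, Prog.ConstLT, Test.ConstLT, NatExp.ConstLT, h0, h1, hc]
  · simp [scanProg, weight, NatExp.steps, Test.steps]
  · simp [scanProg, depth]

theorem bounded_searchProg {r : ℕ} (hr : r < 2 ^ b) (hb : 1 ≤ b) :
    (searchProg r).Bounded b (150 * r + 150) 3 := by
  have h1 : 1 < 2 ^ b := Nat.one_lt_two_pow (by omega)
  have h0 : 0 < 2 ^ b := by omega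
  have hscan : (scanAllProg r).Bounded b (110 * r + 1) 1 := Bounded.unroll fun c hc =>
    ((bounded_scanProg (by omega)).cond (by simp [Test.ConstLT, NatExp.ConstLT, h0, h1])
      (Bounded.skip b 1)).mono (by simp [Test.steps, NatExp.steps]) le_rfl
  have hround : (roundProg r).Bounded b (110 * r + 30) 2 :=
    (Bounded.count hb (by omega) (by
      have : 22 ∉ (scanAllProg r).natWrites := natWrites_unroll fun c _ => by
        simp [scanProg, natWrites]
      simp [natWrites, this]) (hscan.cond (by simp [Test.ConstLT, NatExp.ConstLT, h0, h1])
        (Bounded.skip b 1))).mono (by simp only [Test.steps, NatExp.steps]; omega) le_rfl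
  refine (((bounded_fillProg hb (by omega) (by omega) h0).mono le_rfl (by omega)).seq
    ((bounded_setNat (by omega) ?_ ?_ 3).seq ((bounded_setNat (by omega) ?_ ?_ 3).seq
      (Bounded.count hb (by omega) (natWrites_roundProg (by simp)) hround)))).mono (by
        simp only [NatExp.steps]
        omega) le_rfl <;>
  simp [NatExp.ConstLT, h0, h1]

theorem bounded_greedyProg {r : ℕ} (hr : r < 2 ^ b) (hb : 1 ≤ b) :
    (greedyProg r).Bounded b (150 * r + 350) 3 := by
  have h1 : 1 < 2 ^ b := Nat.one_lt_two_pow (by omega)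
  have h0 : 0 < 2 ^ b := by omega
  have hsel : selectProg.Bounded b 80 3 := by
    refine ⟨?_, ?_, ?_, ?_⟩
    · simp [selectProg, WF, natWrites]
    · simp [selectProg, compile, Prog.ConstLT, Test.ConstLT, NatExp.ConstLT, RatExp.ConstLT, h0, h1]
    · simp [selectProg, weight, NatExp.steps, RatExp.steps, Test.steps]
    · simp [selectProg, depth]
  have haug : augmentProg.Bounded b 80 3 := by
    refine ⟨?_, ?_, ?_, ?_⟩
    · simp [augmentProg, WF, natWrites]
    · simp [augmentProg, compile, Prog.ConstLT, Test.ConstLT, NatExp.ConstLT, h0, h1]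
    · simp [augmentProg, weight, NatExp.steps, Test.steps]
    · simp [augmentProg, depth]
  refine (hsel.seq ((bounded_setNat (by omega) ?_ ?_ 3).seq
    ((bounded_searchProg hr hb).seq haug))).mono (by
      simp only [NatExp.steps]
      omega) le_rfl <;>
  simp [NatExp.ConstLT, h0, h1]

theorem bounded_bodyProg {K r : ℕ} (hr : r < 2 ^ b) (hb : 1 ≤ b) :
    (bodyProg K r).Bounded b (2000 * (K + 1) * (r + 1)) 4 := by
  have h1 : 1 < 2 ^ b := Nat.one_lt_two_pow (by omega)
  have h0 : 0 < 2 ^ b := by omega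
  have hclu : (clustersProg K r).Bounded b (1000 * (K + 1) * r + 1) 4 :=
    Bounded.unroll fun c hc => (bounded_clusterProg hb (by omega)).mono le_rfl (by omega)
  have hfill : ∀ C, C ≠ 0 → C ≠ 20 → (fillProg C 0).Bounded b 28 4 := fun C h2 h3 =>
    (bounded_fillProg hb h2 h3 h0).mono le_rfl (by omega)
  have hmatch : (matchProg r).Bounded b (28 + (28 + (150 * r + 350 + 16))) 4 :=
    (hfill 8 (by omega) (by omega)).seq ((hfill 11 (by omega) (by omega)).seq
      (Bounded.count hb (by omega) (natWrites_greedyProg (by simp)) (bounded_greedyProg hr hb)))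
  have hrec : recordProg.Bounded b 150 4 := by
    refine ⟨?_, ?_, ?_, ?_⟩
    · simp [recordProg, mapProg, WF, natWrites]
    · simp [recordProg, mapProg, compile, Prog.ConstLT, Test.ConstLT, NatExp.ConstLT,
        RatExp.ConstLT, h0, h1]
    · simp [recordProg, mapProg, weight, NatExp.steps, RatExp.steps, Test.steps]
    · simp [recordProg, mapProg, depth]
  refine (hclu.seq (hmatch.seq hrec)).mono ?_ le_rfl
  nlinarith

/-- Every digit costs one level of nesting, that is, one factor `n + 2`. This is the source of the
exponent `5 * K * r`. -/
theorem bounded_nest {p : LoopProg} {W d : ℕ} (hb : 1 ≤ b) (hp : p.Bounded b W d)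
    (hpd : ∀ j, digitArr j ∉ p.natWrites) (D : ℕ) :
    (nest p D).Bounded b (W + 16 * D) (d + D) := by
  induction D with
  | zero => exact hp
  | succ D ih =>
    refine (Bounded.count hb (by simp only [digitArr]; omega) (fun h => ?_) ih).mono
      (by omega) (by omega)
    rcases natWrites_nest h with h | ⟨j, hj, h⟩
    · exact hpd _ h
    · have := digitArr_injective h
      omega

theorem bounded_mainProg {K r : ℕ} (hr : r < 2 ^ b) (hb : 1 ≤ b) :
    (mainProg K r).Bounded b (3000 * (K + 1) * (r + 1)) (4 + 5 * K * r) := by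
  have h1 : 1 < 2 ^ b := Nat.one_lt_two_pow (by omega)
  have h0 : 0 < 2 ^ b := by omega
  have hprep : (prepareProg r).Bounded b 200 4 := by
    refine ⟨?_, ?_, ?_, ?_⟩
    · simp [prepareProg, fillProg, mapProg, WF, natWrites]
    · simp [prepareProg, fillProg, mapProg, compile, Prog.ConstLT, Test.ConstLT, NatExp.ConstLT,
        RatExp.ConstLT, h0, h1, hr]
    · simp [prepareProg, fillProg, mapProg, weight, NatExp.steps, RatExp.steps, Test.steps]
    · simp [prepareProg, fillProg, mapProg, depth]
  refine ((hprep.mono le_rfl (Nat.le_add_right _ _)).seq (bounded_nest hb (bounded_bodyProg hr hb)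
    (fun j => natWrites_bodyProg (.inr ⟨j, rfl⟩)) _)).mono ?_ le_rfl
  nlinarith [Nat.zero_le (K * r)]

end

/-- During `T` steps all numbers stay within about `m + T` bits, so the bit cost is roughly
quadratic in the time. -/
theorem Bounded.haltsWithin {b W d : ℕ} {p : LoopProg} (hp : p.Bounded b W d) {s : Mem}
    {D m : ℕ} (hbm : b ≤ m) (hD0 : 0 < D) (hD : D ≤ 2 ^ m) (hs : s.SizeLE D m) {T : ℕ}
    (hT : W * (s.nat 0 0 + 2) ^ d ≤ T) :
    HaltsWithin p.compile s (p.run s) T (T * (4 + 2 * (m + T))) := by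
  obtain ⟨t, c, h, ht⟩ := exec_compile hp.wf s
  have htT : t ≤ T := by
    refine ht.trans (le_trans ?_ hT)
    exact Nat.mul_le_mul hp.weight_le (Nat.pow_le_pow_right (by omega) hp.depth_le)
  refine ⟨t, c, h, htT, ?_⟩
  exact (h.bits_le hp.const hbm hD0 hD hs (N := m + T) (by omega)).1.trans
    (Nat.mul_le_mul_right _ htT)

end LoopProg

/-! ## Odd cycles and two-colorings -/

namespace SimpleGraph.Walk

variable {V : Type*} {G : SimpleGraph V}

/-- A walk that is not a path contains a closed walk. -/
theorem exists_closed_of_not_isPath {u v : V} (p : G.Walk u v) (hp : ¬ p.IsPath) :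
    ∃ (x : V) (a : G.Walk u x) (b : G.Walk x x) (c : G.Walk x v),
      0 < b.length ∧ a.length + b.length + c.length = p.length := by
  classical
  induction p with
  | nil => exact absurd IsPath.nil hp
  | @cons u v w h p ih =>
    by_cases hp' : p.IsPath
    · have hu : u ∈ p.support := by
        by_contra hu
        exact hp ((cons_isPath_iff h p).2 ⟨hp', hu⟩)
      refine ⟨u, nil, cons h (p.takeUntil u hu), p.dropUntil u hu, by simp, ?_⟩
      have := congrArg length (p.take_spec hu)
      rw [length_append] at this
      simp only [length_nil, length_cons]
      omega
    · obtain ⟨x, a, b, c, hb, hl⟩ := ih hp'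
      refine ⟨x, cons h a, b, c, hb, ?_⟩
      simp only [length_cons]
      omega

/-- A graph with a closed walk of odd length has an odd cycle. -/
theorem exists_isCycle_odd {u : V} (p : G.Walk u u) (hp : Odd p.length) :
    ∃ (v : V) (c : G.Walk v v), c.IsCycle ∧ Odd c.length := by
  induction hl : p.length using Nat.strong_induction_on generalizing u with
  | _ l ih =>
    subst hl
    cases p with
    | nil => simp at hp
    | @cons _ v _ h p =>
      rw [length_cons] at hp
      by_cases hpp : p.IsPath
      · refine ⟨u, cons h p, (cons_isCycle_iff p h).2 ⟨hpp, fun he => ?_⟩, by simpa using hp⟩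
        cases p with
        | nil => exact h.ne rfl
        | @cons _ x _ h' q =>
          rw [cons_isPath_iff] at hpp
          rw [edges_cons, List.mem_cons] at he
          -- The first edge can reappear only as the second one. Then the walk goes forth and back
          -- and has length two, which is even.
          rcases he with he | he
          · have hx : u = x := by
              rcases Sym2.eq_iff.1 he with ⟨h1, -⟩ | ⟨h1, -⟩
              exacts [absurd h1 h.ne, h1]
            subst hx
            rw [isPath_iff_nil, ← length_eq_zero_iff] at hpp
            rw [length_cons, hpp.1] at hp
            exact absurd hp (by decide)
          · exact hpp.2 (snd_mem_support_of_mem_edges q he)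
      · obtain ⟨x, a, b, c, hb, hsum⟩ := p.exists_closed_of_not_isPath hpp
        -- Either the closed part is odd and shorter, or removing it keeps the length odd.
        rcases Nat.even_or_odd b.length with hbe | hbo
        · refine ih _ ?_ (cons h (a.append c)) ?_ rfl
          · simp only [length_cons, length_append]
            omega
          · simp only [length_cons, length_append]
            rw [← hsum] at hp
            rw [Nat.odd_iff] at hp ⊢
            rw [Nat.even_iff] at hbe
            omega
        · refine ih _ ?_ b hbo rfl
          simp only [length_cons]
          omega

end SimpleGraph.Walk

/-- Two-colorability means that there is no odd closed walk. Such a walk in `G[F]` contains an odd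
cycle, and an odd cycle of `G` that avoids the complement of `F` lives in `G[F]`. -/
theorem isOddCycleTransversal_compl_iff {V : Type*} [Fintype V] [DecidableEq V]
    (G : SimpleGraph V) (F : Finset V) :
    IsOddCycleTransversal G Fᶜ ↔ InducedListColorable G (fun _ => (univ : Finset (Fin 2))) F := by
  have hcol : InducedListColorable G (fun _ => (univ : Finset (Fin 2))) F ↔
      (G.induce (F : Set V)).Colorable 2 := by
    simp [InducedListColorable, ListColorable, SimpleGraph.Colorable]
  rw [hcol, SimpleGraph.two_colorable_iff_forall_loop_even]
  constructor
  · intro h u p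
    by_contra hp
    obtain ⟨v, c, hc, hodd⟩ := p.exists_isCycle_odd (Nat.not_even_iff_odd.1 hp)
    let f := SimpleGraph.Embedding.induce (G := G) (F : Set V)
    obtain ⟨x, hx, hx'⟩ := h _ (c.map f.toHom) (hc.map f.injective) (by simpa using hodd)
    rw [SimpleGraph.Walk.support_map, List.mem_map] at hx'
    obtain ⟨y, -, rfl⟩ := hx'
    exact (mem_compl.1 hx) y.2
  · intro h v p _ hodd
    by_contra! hX
    have hF : ∀ x ∈ p.support, x ∈ (F : Set V) := fun x hx => by
      by_contra hxF
      exact hX x (mem_compl.2 hxF) hx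
    have := h _ (p.induce _ hF)
    rw [← SimpleGraph.Walk.length_map (SimpleGraph.Embedding.induce (G := G) (F : Set V)).toHom,
      SimpleGraph.Walk.map_induce] at this
    exact Nat.not_even_iff_odd.2 hodd this

/-! ## Graphs on `Fin n` as relations on the natural numbers -/

/-- Adjacency in `G` as a relation on the natural numbers. -/
def natAdj {n : ℕ} (G : SimpleGraph (Fin n)) (u v : ℕ) : Prop :=
  ∃ (hu : u < n) (hv : v < n), G.Adj ⟨u, hu⟩ ⟨v, hv⟩

/-- Membership in the lists as a relation on the natural numbers. -/
def natList {n r : ℕ} (L : Fin n → Finset (Fin r)) (v c : ℕ) : Prop :=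
  ∃ (hv : v < n) (hc : c < r), (⟨c, hc⟩ : Fin r) ∈ L ⟨v, hv⟩

/-- The weights, extended by `0` to the natural numbers. -/
def natWeight {n : ℕ} (w : Fin n → ℚ≥0) (v : ℕ) : ℚ := if h : v < n then (w ⟨v, h⟩ : ℚ) else 0

theorem natAdj_val {n : ℕ} {G : SimpleGraph (Fin n)} {u v : Fin n} :
    natAdj G u v ↔ G.Adj u v := by
  simp [natAdj]

theorem natAdj.symm {n : ℕ} {G : SimpleGraph (Fin n)} {u v : ℕ} (h : natAdj G u v) :
    natAdj G v u := by
  obtain ⟨hu, hv, h⟩ := h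
  exact ⟨hv, hu, h.symm⟩

theorem natList_val {n r : ℕ} {L : Fin n → Finset (Fin r)} {v : Fin n} {c : Fin r} :
    natList L v c ↔ c ∈ L v := by
  simp [natList]

theorem natWeight_val {n : ℕ} (w : Fin n → ℚ≥0) (v : Fin n) : natWeight w v = w v := by
  simp [natWeight]

theorem HasPacking.exists_fun {B : ℕ → ℕ → Prop} (hs : ∀ u v, B u v → B v u) {k : ℕ}
    {U : Set ℕ} (h : HasPacking B k U) : ∃ f : Fin k → Fin 3 → ℕ, (∀ i a, f i a ∈ U) ∧
      (∀ i, IsInducedP3 B (f i 0) (f i 1) (f i 2)) ∧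
      ∀ i j, i ≠ j → ∀ a b, ¬ B (f i a) (f j b) := by
  induction k generalizing U with
  | zero => exact ⟨fun i => i.elim0, fun i => i.elim0, fun i => i.elim0, fun i => i.elim0⟩
  | succ k ih =>
    obtain ⟨x, hx, y, hy, z, hz, hxyz, h⟩ := h
    obtain ⟨f, h1, h2, h3⟩ := ih h
    have hf : ∀ i a b, ¬ B (f i a) (![x, y, z] b) := fun i a b => by
      fin_cases b
      exacts [(h1 i a).2.1, (h1 i a).2.2.1, (h1 i a).2.2.2]
    refine ⟨Fin.cons ![x, y, z] f, fun i a => ?_, fun i => ?_, fun i j hij a b => ?_⟩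
    · refine Fin.cases ?_ (fun i => (h1 i a).1) i
      fin_cases a
      exacts [hx, hy, hz]
    · exact Fin.cases hxyz h2 i
    · induction i using Fin.cases with
      | zero =>
        induction j using Fin.cases with
        | zero => exact absurd rfl hij
        | succ j => exact fun hB => hf j b a (hs _ _ hB)
      | succ i =>
        induction j using Fin.cases with
        | zero => exact hf i a b
        | succ j => exact h3 i j (fun h => hij (h ▸ rfl)) a b

/-- As the relation is reflexive, its failure between different paths gives both disjointness and
nonadjacency, so a packing is an induced copy of `kP3 k`. -/
theorem IsKP3Free.not_hasPacking {n k : ℕ} {G : SimpleGraph (Fin n)} (h : IsKP3Free k G) :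
    ¬ HasPacking (fun u v => u = v ∨ natAdj G u v) k (range n : Finset ℕ) := by
  intro hp
  have hs : ∀ u v, u = v ∨ natAdj G u v → v = u ∨ natAdj G v u :=
    fun u v => Or.imp Eq.symm natAdj.symm
  obtain ⟨f, h1, h2, h3⟩ := hp.exists_fun hs
  have hlt : ∀ i a, f i a < n := fun i a => by simpa using h1 i a
  let g : Fin k × Fin 3 → Fin n := fun x => ⟨f x.1 x.2, hlt _ _⟩
  have hrow : ∀ i a b, (f i a = f i b ↔ a = b) ∧
      (natAdj G (f i a) (f i b) ↔ (SimpleGraph.pathGraph 3).Adj a b) := by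
    intro i a b
    obtain ⟨hxy, hyz, hxz⟩ := h2 i
    have hirr : ∀ u, ¬ natAdj G u u := fun u ⟨_, _, h⟩ => h.ne rfl
    -- If two of the three vertices coincided, reflexivity or one of the two edges would relate the
    -- ends.
    have h01 : f i 0 ≠ f i 1 := fun h => hxz (h ▸ hyz)
    have h12 : f i 1 ≠ f i 2 := fun h => hxz (h ▸ hxy)
    have h02 : f i 0 ≠ f i 2 := fun h => hxz (.inl h)
    have a01 := hxy.resolve_left h01
    have a12 := hyz.resolve_left h12
    have a02 : ¬ natAdj G (f i 0) (f i 2) := fun h => hxz (.inr h)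
    have a20 : ¬ natAdj G (f i 2) (f i 0) := fun h => a02 h.symm
    rw [SimpleGraph.pathGraph_adj]
    fin_cases a <;> fin_cases b <;>
      simp [hirr, h01, h12, h02, h01.symm, h12.symm, h02.symm, a01, a12, a02, a20, a01.symm,
        a12.symm]
  refine h ⟨⟨⟨g, fun x y hxy => ?_⟩, fun {x y} => ?_⟩⟩
  · have hxy' : f x.1 x.2 = f y.1 y.2 := congrArg Fin.val hxy
    by_cases hi : x.1 = y.1
    · rw [← hi] at hxy'
      exact Prod.ext hi ((hrow _ _ _).1.1 hxy')
    · exact absurd (.inl hxy') (h3 _ _ hi x.2 y.2)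
  · change G.Adj (g x) (g y) ↔ x.1 = y.1 ∧ (SimpleGraph.pathGraph 3).Adj x.2 y.2
    rw [← natAdj_val]
    change natAdj G (f x.1 x.2) (f y.1 y.2) ↔ _
    by_cases hi : x.1 = y.1
    · rw [← hi, (hrow _ _ _).2]
      simp
    · simp only [hi, false_and, iff_false]
      exact fun h => h3 _ _ hi x.2 y.2 (.inr h)

theorem inducedListColorable_iff {n r : ℕ} (G : SimpleGraph (Fin n)) (L : Fin n → Finset (Fin r))
    (F : Finset (Fin n)) : InducedListColorable G L F ↔
      ∃ φ, IsListColoring r (fun u v => u = v ∨ natAdj G u v) (natList L)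
        (F.map Fin.valEmbedding) φ := by
  have hmem : ∀ v ∈ F.map Fin.valEmbedding, ∃ (h : v < n), (⟨v, h⟩ : Fin n) ∈ F := by
    intro v hv
    obtain ⟨x, hx, rfl⟩ := mem_map.1 hv
    exact ⟨x.2, hx⟩
  constructor
  · rintro ⟨φ, hφ⟩
    let ψ : ℕ → ℕ := fun v => if h : ∃ h : v < n, (⟨v, h⟩ : Fin n) ∈ F then
      (φ ⟨⟨v, h.1⟩, h.2⟩ : Fin r) else 0
    have hψ : ∀ (v : ℕ) (h : v < n) (h' : (⟨v, h⟩ : Fin n) ∈ F), ψ v = φ ⟨⟨v, h⟩, h'⟩ :=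
      fun v h h' => dif_pos ⟨h, h'⟩
    refine ⟨ψ, fun v hv => ?_, fun v hv => ?_, fun u hu v hv huv hB => ?_⟩
    · obtain ⟨h, h'⟩ := hmem v hv
      rw [hψ v h h']
      exact Fin.is_lt _
    · obtain ⟨h, h'⟩ := hmem v hv
      rw [hψ v h h']
      exact ⟨h, Fin.is_lt _, hφ ⟨⟨v, h⟩, h'⟩⟩
    · obtain ⟨h1, h1'⟩ := hmem u hu
      obtain ⟨h2, h2'⟩ := hmem v hv
      rw [hψ u h1 h1', hψ v h2 h2'] at huv
      refine hB.resolve_right fun ⟨_, _, h⟩ => ?_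
      exact φ.valid (v := ⟨⟨u, h1⟩, h1'⟩) (w := ⟨⟨v, h2⟩, h2'⟩) h (Fin.ext huv)
  · rintro ⟨φ, h1, h2, h3⟩
    have hm : ∀ v : (F : Set (Fin n)), (v : ℕ) ∈ F.map Fin.valEmbedding :=
      fun v => mem_map_of_mem Fin.valEmbedding v.2
    refine ⟨SimpleGraph.Coloring.mk (fun v => ⟨φ v, h1 _ (hm v)⟩) fun {u v} huv he => ?_,
      fun v => ?_⟩
    · have huv' : G.Adj u v := huv
      exact huv'.ne (Fin.ext (h3 _ (hm u) _ (hm v) (congrArg Fin.val he)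
        (.inr (natAdj_val.2 huv'))))
    · exact natList_val.1 (h2 _ (hm v))

theorem map_outputSet (n : ℕ) (s : Mem) : (outputSet n s).map Fin.valEmbedding = s.supp n 3 := by
  ext v
  simp only [outputSet, mem_map, mem_filter, mem_univ, true_and, Fin.valEmbedding_apply,
    Mem.mem_supp]
  exact ⟨fun ⟨x, hx, h⟩ => h ▸ ⟨x.2, hx⟩, fun h => ⟨⟨v, h.1⟩, h.2, rfl⟩⟩

theorem sum_natWeight {n : ℕ} (w : Fin n → ℚ≥0) (F : Finset (Fin n)) :
    ∑ v ∈ F.map Fin.valEmbedding, natWeight w v = ((∑ v ∈ F, w v : ℚ≥0) : ℚ) := by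
  rw [sum_map, NNRat.cast_sum]
  exact sum_congr rfl fun v _ => natWeight_val w v

theorem isMaxWeightListColorable_run_mainProg {n r K : ℕ} {G : SimpleGraph (Fin n)}
    {w : Fin n → ℚ≥0} {L : Fin n → Finset (Fin r)} {s : Mem} (hG : IsKP3Free (K + 1) G)
    (hs : s.HasInput n r (natAdj G) (natList L) (natWeight w)) :
    IsMaxWeightListColorable G w L (outputSet n ((LoopProg.mainProg K r).run s)) := by
  obtain ⟨h1, h2⟩ := LoopProg.run_mainProg hs (fun u v => natAdj.symm)
    (fun v hv => by rw [natWeight, dif_pos hv]; exact NNRat.cast_nonneg _) hG.not_hasPacking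
  refine ⟨(inducedListColorable_iff G L _).2 (by rwa [map_outputSet]), fun F hF => ?_⟩
  have := h2 (F.map Fin.valEmbedding) (fun v hv => ?_) ((inducedListColorable_iff G L F).1 hF)
  · rw [← map_outputSet, sum_natWeight, sum_natWeight] at this
    exact_mod_cast this
  · obtain ⟨x, -, rfl⟩ := mem_map.1 hv
    exact mem_range.2 x.2

/-! ## The three algorithms -/

section inputMem

variable {n r : ℕ} (G : SimpleGraph (Fin n)) (w : Fin n → ℚ≥0) (L : Fin n → Finset (Fin r))

/-- The product of all denominators is a common denominator. The numerator of a weight over it is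
the own numerator times the other denominators, whose total length is bounded by the input size. -/
theorem sizeLE_inputMem {b : ℕ} (hb : 1 ≤ b) :
    (inputMem G w L).SizeLE (∏ v, (w v : ℚ).den) (inputSize w + b) := by
  have hle : 2 ^ inputSize w ≤ 2 ^ (inputSize w + b) :=
    Nat.pow_le_pow_right (by omega) (by omega)
  have h1 : 1 < 2 ^ (inputSize w + b) := Nat.one_lt_two_pow (by omega)
  have hn : n < 2 ^ (inputSize w + b) :=
    Nat.lt_two_pow_self.trans_le (Nat.pow_le_pow_right (by omega) (by
      simp only [inputSize]
      omega))
  refine ⟨fun A i => ?_, fun A i => ?_⟩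
  · simp only [inputMem]
    split_ifs <;> omega
  · simp only [inputMem]
    split_ifs with h
    · set a : Fin n := ⟨i, h.2⟩
      set q : Fin n → ℚ := fun v => w v
      refine ⟨(q a).num * (∏ v ∈ univ.erase a, (q v).den : ℕ), ?_, ?_⟩
      · rw [← mul_prod_erase univ (fun v => (q v).den) (mem_univ a)]
        push_cast
        rw [← mul_assoc, Rat.mul_den_eq_num]
      · rw [Int.natAbs_mul, Int.natAbs_natCast]
        refine le_trans ?_ hle
        have hden : ∏ v ∈ univ.erase a, (q v).den ≤ 2 ^ ∑ v ∈ univ.erase a, ratSize (q v) := by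
          rw [← prod_pow_eq_pow_sum]
          refine prod_le_prod' fun v _ => (Nat.lt_size_self _).le.trans
            (Nat.pow_le_pow_right (by omega) ?_)
          simp only [ratSize]
          omega
        have hnum : (q a).num.natAbs ≤ 2 ^ ratSize (q a) := (Nat.lt_size_self _).le.trans
          (Nat.pow_le_pow_right (by omega) (by simp only [ratSize]; omega))
        refine (Nat.mul_le_mul hnum hden).trans ?_
        rw [← pow_add, add_sum_erase univ (fun v => ratSize (q v)) (mem_univ a)]
        exact Nat.pow_le_pow_right (by omega) (by simp only [inputSize, q]; omega)
    · exact ⟨0, by simp, by simp⟩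

theorem prod_den_le {b : ℕ} : ∏ v, (w v : ℚ).den ≤ 2 ^ (inputSize w + b) := by
  refine le_trans ?_ (Nat.pow_le_pow_right (by omega)
    (show ∑ v, ratSize (w v) ≤ inputSize w + b by simp only [inputSize]; omega))
  rw [← prod_pow_eq_pow_sum]
  refine prod_le_prod' fun v _ => (Nat.lt_size_self _).le.trans
    (Nat.pow_le_pow_right (by omega) ?_)
  simp only [ratSize]
  omega

theorem hasInput_inputMem : (inputMem G w L).HasInput n r (natAdj G) (natList L) (natWeight w) := by
  have hadj : ∀ u < n, ∀ v < n,
      ((∃ u' v' : Fin n, u * n + v = u' * n + v' ∧ G.Adj u' v') ↔ natAdj G u v) := by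
    refine fun u hu v hv => ⟨fun ⟨u', v', h, h'⟩ => ?_, fun ⟨_, _, h⟩ => ⟨_, _, rfl, h⟩⟩
    obtain ⟨rfl, rfl⟩ := LoopProg.eq_and_eq_of_mul_add_eq hv v'.2 h
    exact natAdj_val.2 h'
  refine ⟨by simp [inputMem], fun u hu v hv => ?_, fun u hu v hv => ?_, fun v hv c hc => ?_,
    fun v hv => ?_⟩
  · simp [inputMem, hadj u hu v hv]
  · simp only [inputMem, one_ne_zero, false_and, if_false]
    split_ifs <;> omega
  · have hlist : (∃ (v' : Fin n) (c' : Fin r), v * r + c = v' * r + c' ∧ c' ∈ L v') ↔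
        natList L v c := by
      refine ⟨fun ⟨v', c', h, h'⟩ => ?_, fun ⟨_, _, h⟩ => ⟨_, _, rfl, h⟩⟩
      obtain ⟨rfl, rfl⟩ := LoopProg.eq_and_eq_of_mul_add_eq hc c'.2 h
      exact natList_val.2 h'
    simp [inputMem, hlist]
  · simp [inputMem, natWeight, hv]

end inputMem

theorem HaltsWithin.mono {p : Prog} {s s' : Mem} {T T' B B' : ℕ} (h : HaltsWithin p s s' T B)
    (hT : T ≤ T') (hB : B ≤ B') : HaltsWithin p s s' T' B' := by
  obtain ⟨t, c, h, h1, h2⟩ := h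
  exact ⟨t, c, h, h1.trans hT, h2.trans hB⟩

theorem inputSize_zero (n : ℕ) : inputSize (fun _ : Fin n => 0) = 3 * n := by
  simp [inputSize, ratSize]
  ring

/-! ### Explicit exponents, and the programs for the two derived problems -/

namespace LoopProg

theorem Bounded.haltsWithin_inputMem {K r : ℕ} (hr : 1 ≤ r) {p : LoopProg}
    (hp : p.Bounded r (4000 * (K + 1) * (r + 1)) (4 + 5 * K * r)) {n r' : ℕ}
    (G : SimpleGraph (Fin n)) (w : Fin n → ℚ≥0) (L : Fin n → Finset (Fin r')) :
    HaltsWithin p.compile (inputMem G w L) (p.run (inputMem G w L))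
      ((n + 2) ^ (23 * r * (K + 1))) ((inputSize w + 2) ^ (138 * r * (K + 1))) := by
  set e := 23 * r * (K + 1) with he
  have hrk : r ≤ r * (K + 1) := Nat.le_mul_of_pos_right r (by omega)
  have hkr : K + 1 ≤ r * (K + 1) := Nat.le_mul_of_pos_left _ hr
  have he' : e = 23 * (r * (K + 1)) := by rw [he, mul_assoc]
  have hsize : (inputMem G w L).nat 0 0 = n := by simp [inputMem]
  have hT : 4000 * (K + 1) * (r + 1) * (n + 2) ^ (4 + 5 * K * r) ≤ (n + 2) ^ e := by
    -- The constant factor is absorbed into the exponent, as `n + 2 ≥ 2` and `4000 ≤ 2 ^ 12`.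
    have hW : 4000 * (K + 1) * (r + 1) ≤ 2 ^ (12 + (K + 1) + r) := by
      rw [pow_add, pow_add]
      exact Nat.mul_le_mul (Nat.mul_le_mul (by norm_num) Nat.lt_two_pow_self.le)
        Nat.lt_two_pow_self
    refine (Nat.mul_le_mul_right _ (hW.trans (Nat.pow_le_pow_left (by omega : 2 ≤ n + 2) _))).trans
      ?_
    rw [← pow_add]
    have h5 : 5 * K * r ≤ 5 * (r * (K + 1)) := by nlinarith
    -- The total exponent `12 + (K + 1) + r + 4 + 5 * K * r` is at most `23 * r * (K + 1)`: the
    -- constants give 16, the linear terms 2 and the last term 5 times `r * (K + 1)`.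
    exact Nat.pow_le_pow_right (by omega) (by omega)
  refine (hp.haltsWithin (m := inputSize w + r) (by omega)
    (prod_pos fun v _ => Rat.den_pos _) (prod_den_le w) (sizeLE_inputMem G w L hr)
    (by rwa [hsize])).mono le_rfl ?_
  set M := inputSize w + 2 with hM
  have hnM : (n + 2) ^ e ≤ M ^ e :=
    Nat.pow_le_pow_left (by simp only [hM, inputSize]; omega) e
  have h2M : 2 ^ e ≤ M ^ e := Nat.pow_le_pow_left (by omega) e
  have heM : e < 2 ^ e := Nat.lt_two_pow_self
  have hMe : M ≤ M ^ e := Nat.le_self_pow (by omega) M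
  have h16 : 16 ≤ M ^ 4 := Nat.pow_le_pow_left (by omega : 2 ≤ M) 4
  calc (n + 2) ^ e * (4 + 2 * (inputSize w + r + (n + 2) ^ e))
      ≤ M ^ e * (16 * M ^ e) := Nat.mul_le_mul hnM (by omega)
    _ ≤ M ^ e * (M ^ 4 * M ^ e) := by gcongr
    _ = M ^ (e + (4 + e)) := by rw [pow_add, pow_add]
    -- Here `138 = 6 * 23`, so `2 * e + 4 ≤ 6 * e` suffices.
    _ ≤ M ^ (138 * r * (K + 1)) := Nat.pow_le_pow_right (by omega) (by
        rw [mul_assoc]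
        omega)

theorem zero_notMem_natWrites_mainProg (K r : ℕ) : 0 ∉ (mainProg K r).natWrites :=
  (bounded_mainProg (b := r + 1) (Nat.lt_two_pow_self.trans (by
    rw [pow_succ]
    have := Nat.two_pow_pos r
    omega)) (by omega)).wf.zero_notMem

theorem nat_run_mainProg_zero (K r : ℕ) (s : Mem) : ((mainProg K r).run s).nat 0 0 = s.nat 0 0 := by
  rw [nat_run (zero_notMem_natWrites_mainProg K r)]

/-- Allow two colors at every vertex. -/
def fullListsProg : LoopProg :=
  .count 20 (.seq (.setNat 2 (.add (.reg 20) (.reg 20)) (.const 1))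
    (.setNat 2 (.add (.add (.reg 20) (.reg 20)) (.const 1)) (.const 1)))

theorem hasInput_run_fullListsProg {n r : ℕ} {A Ls : ℕ → ℕ → Prop} {w : ℕ → ℚ} {s : Mem}
    (hs : s.HasInput n r A Ls w) :
    (fullListsProg.run s).HasInput n 2 A (natList fun _ : Fin n => (univ : Finset (Fin 2))) w := by
  have hnat : ∀ B ∉ ({20, 2} : Finset ℕ), (fullListsProg.run s).nat B = s.nat B :=
    fun B hB => nat_run (by simpa [fullListsProg, natWrites] using hB) s
  have hrat : (fullListsProg.run s).rat 0 = s.rat 0 :=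
    rat_run (by simp [fullListsProg, ratWrites]) s
  have hlist : ∀ i < 2 * n, (fullListsProg.run s).nat 2 i = 1 := by
    refine run_for hs.size (fun i u => ∀ j < 2 * i, u.nat 2 j = 1) (by simp) ?_
    intro i _ u hu _ _ hI j hj
    rw [Mem.nat_setNat_of_ne _ _ _ (by omega)]
    simp only [run_seq, run_setNat, NatExp.eval, Mem.nat_setNat_same, hu,
      Mem.nat_setNat_of_ne _ _ _ (show 20 ≠ 2 by omega)]
    split_ifs with h1 h2
    · rfl
    · rfl
    · exact hI j (by omega)
  refine ⟨by rw [hnat 0 (by simp), hs.size], by rw [hnat 1 (by simp)]; exact hs.adj,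
    by rw [hnat 1 (by simp)]; exact hs.adj_le, fun v hv c hc => ?_,
    by rw [hrat]; exact hs.weight⟩
  rw [hlist _ (by omega)]
  simp [natList, hv, hc]

/-- Odd Cycle Transversal: the complement of a maximum-weight two-colorable induced subgraph. -/
def transversalProg (K : ℕ) : LoopProg :=
  .seq fullListsProg (.seq (mainProg K 2)
    (mapProg 3 (.nz (.get 3 (.reg 20))) (.const 0) (.const 1)))

theorem outputSet_run_transversalProg {n r K : ℕ} {A Ls : ℕ → ℕ → Prop} {w : ℕ → ℚ} {s : Mem}
    (hs : s.HasInput n r A Ls w) :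
    outputSet n ((transversalProg K).run s) =
      (outputSet n ((mainProg K 2).run (fullListsProg.run s)))ᶜ := by
  set u := (mainProg K 2).run (fullListsProg.run s) with hu
  have hn : u.nat 0 0 = n := by
    rw [hu, nat_run_mainProg_zero, (hasInput_run_fullListsProg hs).size]
  have h := nat_run_mapProg (C := 3) (b := .nz (.get 3 (.reg 20))) (e := .const 0)
    (f := .const 1) hn (by omega) (fun i => if u.nat 3 i ≠ 0 then 0 else 1)
    fun i _ u' hu' _ _ h3 => by
      simp only [Test.holds_nz, NatExp.eval, hu', h3]
      exact ⟨fun h => (if_pos h).symm, fun h => (if_neg h).symm⟩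
  ext v
  rw [transversalProg, run_seq, run_seq, ← hu, mem_compl, outputSet, outputSet, mem_filter,
    mem_filter, h v v.2]
  by_cases hv : u.nat 3 v = 0 <;> simp [hv]

theorem bounded_transversalProg (K : ℕ) :
    (transversalProg K).Bounded 2 (4000 * (K + 1) * (2 + 1)) (4 + 5 * K * 2) := by
  have hfull : fullListsProg.Bounded 2 100 1 := by
    refine ⟨?_, ?_, ?_, ?_⟩
    · simp [fullListsProg, WF, natWrites]
    · simp [fullListsProg, compile, Prog.ConstLT, Test.ConstLT, NatExp.ConstLT]
    · simp [fullListsProg, weight, NatExp.steps]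
    · simp [fullListsProg, depth]
  refine ((hfull.mono le_rfl (by omega)).seq ((bounded_mainProg (by omega) (by omega)).seq
    ((bounded_mapProg (by omega) (by omega) (by omega) ?_ ?_ ?_).mono le_rfl (by omega)))).mono
      ?_ le_rfl
  · simp [Test.ConstLT, NatExp.ConstLT]
  · simp [NatExp.ConstLT]
  · simp [NatExp.ConstLT]
  · simp only [Test.steps, NatExp.steps]
    omega

/-- Give weight one to every vertex. -/
def unitWeightsProg : LoopProg := .count 20 (.setRat 0 (.reg 20) (.const 1))

theorem hasInput_run_unitWeightsProg {n r : ℕ} {A Ls : ℕ → ℕ → Prop} {w : ℕ → ℚ} {s : Mem}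
    (hs : s.HasInput n r A Ls w) :
    (unitWeightsProg.run s).HasInput n r A Ls (natWeight fun _ : Fin n => 1) := by
  have hnat : ∀ B ≠ 20, (unitWeightsProg.run s).nat B = s.nat B :=
    fun B hB => nat_run (by simpa [unitWeightsProg, natWrites] using hB) s
  refine ⟨by rw [hnat 0 (by omega), hs.size], by rw [hnat 1 (by omega)]; exact hs.adj,
    by rw [hnat 1 (by omega)]; exact hs.adj_le, by rw [hnat 2 (by omega)]; exact hs.list, ?_⟩
  have hw : ∀ i < n, (unitWeightsProg.run s).rat 0 i = 1 := by
    refine run_for hs.size (fun i u => ∀ j < i, u.rat 0 j = 1) (by simp) ?_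
    intro i _ u hu _ _ hI j hj
    simp only [Mem.rat_setNat, run_setRat, NatExp.eval, RatExp.eval, Mem.rat_setRat_same, hu]
    split_ifs with h
    · rfl
    · exact hI j (by omega)
  intro v hv
  simp [hw v hv, natWeight, hv]

/-- Test whether the output set contains all vertices. -/
def isFullProg : LoopProg :=
  .seq (.setNat 7 (.const 0) (.const 1))
    (.seq (.count 20 (.cond (.nz (.get 3 (.reg 20))) .skip (.setNat 7 (.const 0) (.const 0))))
      (.setNat 3 (.const 0) (.reg 7)))

theorem accepts_run_isFullProg {n : ℕ} {s : Mem} (hn : s.nat 0 0 = n) :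
    Accepts (isFullProg.run s) ↔ outputSet n s = univ := by
  rw [Accepts, isFullProg, run_seq, run_seq, run_setNat (A := 3), NatExp.eval_const,
    Mem.nat_setNat_same, if_pos rfl, NatExp.eval_get, NatExp.eval_const,
    run_for_check (n := n) (P := fun i => s.nat 3 i ≠ 0)]
  · simp only [run_setNat, NatExp.eval, Mem.nat_setNat_same, if_true, ne_eq, one_ne_zero,
      not_false_eq_true, true_and, eq_univ_iff_forall, outputSet, mem_filter, mem_univ]
    exact ⟨fun h v => h v v.2, fun h i hi => h ⟨i, hi⟩⟩
  · rw [run_setNat, Mem.nat_setNat_of_ne _ _ _ (by omega), hn]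
  · omega
  · intro i _ u hu hf
    have h3 : u.nat 3 = s.nat 3 := by
      rw [hf 3 (by simp [natWrites]), run_setNat, Mem.nat_setNat_of_ne _ _ _ (by omega)]
    by_cases h : s.nat 3 i = 0
    · rw [run_cond_neg (by rw [Test.holds_nz]; simp [NatExp.eval, hu, h3, h])]
      simp [run_setNat, NatExp.eval, h]
    · rw [run_cond_pos (by rw [Test.holds_nz]; simp [NatExp.eval, hu, h3, h])]
      simp [run_skip, h]

/-- List `r`-Coloring. -/
def decideProg (K r : ℕ) : LoopProg :=
  .seq unitWeightsProg (.seq (mainProg K r) isFullProg)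

theorem bounded_decideProg {K r : ℕ} (hr : 1 ≤ r) :
    (decideProg K r).Bounded r (4000 * (K + 1) * (r + 1)) (4 + 5 * K * r) := by
  have h1 : 1 < 2 ^ r := Nat.one_lt_two_pow (by omega)
  have h0 : 0 < 2 ^ r := by omega
  have hunit : unitWeightsProg.Bounded r 100 1 := by
    refine ⟨?_, ?_, ?_, ?_⟩
    · simp [unitWeightsProg, WF, natWrites]
    · simp [unitWeightsProg, compile, Prog.ConstLT, Test.ConstLT, NatExp.ConstLT, RatExp.ConstLT,
        h0, h1]
    · simp [unitWeightsProg, weight, NatExp.steps, RatExp.steps]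
    · simp [unitWeightsProg, depth]
  have hfull : isFullProg.Bounded r 100 1 := by
    refine ⟨?_, ?_, ?_, ?_⟩
    · simp [isFullProg, WF, natWrites]
    · simp [isFullProg, compile, Prog.ConstLT, Test.ConstLT, NatExp.ConstLT, h0, h1]
    · simp [isFullProg, weight, NatExp.steps, Test.steps]
    · simp [isFullProg, depth]
  refine ((hunit.mono le_rfl (by omega)).seq ((bounded_mainProg Nat.lt_two_pow_self hr).seq
    (hfull.mono le_rfl (by omega)))).mono ?_ le_rfl
  nlinarith [Nat.zero_le (K * r)]

end LoopProg

/-- A set and its complement have constant total weight, so maximizing one minimizes the other.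
Cancellation replaces subtraction, which is truncated on nonnegative rationals. -/
theorem IsMaxWeightListColorable.compl {V : Type*} [Fintype V] [DecidableEq V] {G : SimpleGraph V}
    {w : V → ℚ≥0} {F : Finset V}
    (h : IsMaxWeightListColorable G w (fun _ => (univ : Finset (Fin 2))) F) :
    IsMinWeightOddCycleTransversal G w Fᶜ := by
  refine ⟨(isOddCycleTransversal_compl_iff G F).2 h.1, fun X hX => ?_⟩
  have hX' := h.2 Xᶜ ((isOddCycleTransversal_compl_iff G Xᶜ).1 (by rwa [compl_compl]))
  have h1 := sum_add_sum_compl F w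
  have h2 := sum_add_sum_compl X w
  refine le_of_add_le_add_left (a := ∑ v ∈ Xᶜ, w v) ?_
  calc ∑ v ∈ Xᶜ, w v + ∑ v ∈ Fᶜ, w v ≤ ∑ v ∈ F, w v + ∑ v ∈ Fᶜ, w v := by gcongr
    _ = ∑ v ∈ Xᶜ, w v + ∑ v ∈ X, w v := by rw [h1, ← h2, add_comm]

theorem inducedListColorable_univ_iff {V : Type*} [Fintype V] {r : ℕ} (G : SimpleGraph V)
    (L : V → Finset (Fin r)) : InducedListColorable G L univ ↔ ListColorable G L := by
  constructor
  · rintro ⟨φ, hφ⟩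
    exact ⟨SimpleGraph.Coloring.mk (fun v => φ ⟨v, by simp⟩) fun h => φ.valid h, fun v => hφ _⟩
  · rintro ⟨φ, hφ⟩
    exact ⟨SimpleGraph.Coloring.mk (fun v => φ v) fun h => φ.valid h, fun v => hφ v⟩

/-- If the whole graph is colorable, an optimal set for unit weights has at least as many vertices
as the graph. -/
theorem IsMaxWeightListColorable.eq_univ_iff {V : Type*} [Fintype V] {r : ℕ} {G : SimpleGraph V}
    {L : V → Finset (Fin r)} {F : Finset V}
    (h : IsMaxWeightListColorable G (fun _ => 1) L F) : F = univ ↔ ListColorable G L := by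
  rw [← inducedListColorable_univ_iff]
  refine ⟨fun hF => hF ▸ h.1, fun hG => ?_⟩
  have := h.2 univ hG
  simp only [sum_const, nsmul_eq_mul, mul_one, Nat.cast_le] at this
  exact eq_univ_of_card F (le_antisymm (card_le_univ F) this)

theorem mainTheorem1 :
    ∃ C : ℕ,
      -- Max-Weight List `r`-Colorable Induced Subgraph
      (∀ r k : ℕ, 1 ≤ r → 1 ≤ k → ∃ P : Prog,
        ∀ (n : ℕ) (G : SimpleGraph (Fin n)) (w : Fin n → ℚ≥0) (L : Fin n → Finset (Fin r)),
          IsKP3Free k G →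
          ∃ s' : Mem,
            HaltsWithin P (inputMem G w L) s'
              ((n + 2) ^ (C * r * k)) ((inputSize w + 2) ^ (C * r * k)) ∧
            IsMaxWeightListColorable G w L (outputSet n s')) ∧
      -- Odd Cycle Transversal (no lists in the input)
      (∀ k : ℕ, 1 ≤ k → ∃ P : Prog,
        ∀ (n : ℕ) (G : SimpleGraph (Fin n)) (w : Fin n → ℚ≥0),
          IsKP3Free k G →
          ∃ s' : Mem,
            HaltsWithin P (inputMem G w fun _ => (∅ : Finset (Fin 0))) s'
              ((n + 2) ^ (C * k)) ((inputSize w + 2) ^ (C * k)) ∧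
            IsMinWeightOddCycleTransversal G w (outputSet n s')) ∧
      -- List `r`-Coloring (no weights in the input)
      (∀ r k : ℕ, 1 ≤ r → 1 ≤ k → ∃ P : Prog,
        ∀ (n : ℕ) (G : SimpleGraph (Fin n)) (L : Fin n → Finset (Fin r)),
          IsKP3Free k G →
          ∃ s' : Mem,
            HaltsWithin P (inputMem G (fun _ => 0) L) s'
              ((n + 2) ^ (C * r * k)) ((n + 2) ^ (C * r * k)) ∧
            (Accepts s' ↔ ListColorable G L)) := by
  have hpow : ∀ {a m m' : ℕ}, m ≤ m' → (a + 2) ^ m ≤ (a + 2) ^ m' :=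
    fun h => Nat.pow_le_pow_right (by omega) h
  have hmul : ∀ {c r k : ℕ}, c ≤ 276 → c * r * k ≤ 276 * r * k :=
    fun h => Nat.mul_le_mul_right _ (Nat.mul_le_mul_right _ h)
  -- The bit exponent has the factor 138. It doubles for Odd Cycle Transversal, where `r = 2`, and
  -- for list coloring, where zero weights have size `3 * n` and `3 * n + 2 ≤ (n + 2) ^ 2`.
  refine ⟨276, fun r k hr hk => ?_, fun k hk => ?_, fun r k hr hk => ?_⟩
  · obtain ⟨K, rfl⟩ : ∃ K, k = K + 1 := ⟨k - 1, by omega⟩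
    refine ⟨(LoopProg.mainProg K r).compile, fun n G w L hG => ⟨_,
      (((LoopProg.bounded_mainProg Nat.lt_two_pow_self hr).mono ?_ le_rfl).haltsWithin_inputMem hr
        G w L).mono (hpow (hmul (by omega))) (hpow (hmul (by omega))),
      isMaxWeightListColorable_run_mainProg hG (hasInput_inputMem G w L)⟩⟩
    gcongr
    norm_num
  · obtain ⟨K, rfl⟩ : ∃ K, k = K + 1 := ⟨k - 1, by omega⟩
    refine ⟨(LoopProg.transversalProg K).compile, fun n G w hG => ⟨_,
      ((LoopProg.bounded_transversalProg K).haltsWithin_inputMem (by omega) G w _).mono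
        (hpow (by omega)) (hpow (by omega)), ?_⟩⟩
    have hs := hasInput_inputMem G w fun _ => (∅ : Finset (Fin 0))
    rw [LoopProg.outputSet_run_transversalProg hs]
    exact (isMaxWeightListColorable_run_mainProg hG
      (LoopProg.hasInput_run_fullListsProg hs)).compl
  · obtain ⟨K, rfl⟩ : ∃ K, k = K + 1 := ⟨k - 1, by omega⟩
    refine ⟨(LoopProg.decideProg K r).compile, fun n G L hG => ⟨_,
      ((LoopProg.bounded_decideProg hr).haltsWithin_inputMem hr G _ L).mono
        (hpow (hmul (by omega))) ?_, ?_⟩⟩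
    · calc (inputSize (fun _ : Fin n => 0) + 2) ^ (138 * r * (K + 1))
          ≤ ((n + 2) ^ 2) ^ (138 * r * (K + 1)) := Nat.pow_le_pow_left (by
            rw [inputSize_zero]
            nlinarith) _
        _ = (n + 2) ^ (276 * r * (K + 1)) := by rw [← pow_mul]; congr 1; ring
    · have hs := LoopProg.hasInput_run_unitWeightsProg (hasInput_inputMem G (fun _ => 0) L)
      rw [LoopProg.decideProg, LoopProg.run_seq, LoopProg.run_seq,
        LoopProg.accepts_run_isFullProg (n := n)
          (by rw [LoopProg.nat_run_mainProg_zero, hs.size])]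
      exact (isMaxWeightListColorable_run_mainProg hG hs).eq_univ_iff
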